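/- Let $n\ge 1$, $1\le p,q\le\infty$, $T=[0,1]^n$, and let $Q_0=T+c$ be a translate of $T$ that contains the origin in its interior; for $l\ge 0$ and $x\in\mathbb R^n$ put $Q_l(x)=2^{-l}Q_0+x$. For an integer $r\ge 0$ let $$\mathrm{osc}_p^{r}f(x,l)=\inf_{\deg P\le r}\Big(\frac1{|Q_l(x)|}\int_{Q_l(x)}|f(y)-P(y)|^p\,dy\Big)^{1/p},$$ and for $0<s<r+1$ let $B^s_{pq}$ be the Besov space (of the dilation matrix $2\,\mathrm{Id}$) of all $f$ with $$\|f\|_{B^s_{pq}}=\|f\|_p+\Big(\sum_{l=0}^\infty\big(2^{ls}\|\mathrm{osc}_p^{r}f(\cdot,l)\|_p\big)^q\Big)^{1/q}<\infty .$$ For a function $\varphi$ on $\mathbb R^n$ let $V_l^p=\{\sum_{\nu\in\mathbb Z^n}a(\nu)\varphi(2^lx-\nu): a\in\ell^p(\mathbb Z^n)\}$, $\sigma_l^p(f)=\inf\{\|f-S\|_p: S\in V_l^p\}$, and let $B^{s,2}_{pq}(\{\varphi\})$ be the space of all $f$ with $$\|f\|_{B^{s,2}_{pq}(\{\varphi\})}=\|f\|_p+\Big(\sum_{l=0}^\infty\big(2^{ls}\sigma_l^p(f)\big)^q\Big)^{1/q}<\infty$$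 (usual modifications if $p=\infty$ or $q=\infty$). Let $\varphi$ and the integer $k$ be one of the following. 1. $\varphi=\mathcal M_k$, $\mathcal M_k(x)=\prod_{i=1}^n M_k(x_i)$, $k\ge1$, where $M_k$ is the central B-spline of order $k$: $M_1$ is the indicator function of $[-1/2,1/2]$ and $M_{k+1}=M_k*M_1$. 2. $\varphi=B(\cdot,X)$, the box spline of the family $X=(x^1,\dots,x^{d_0})$ consisting of the unit vectors $e^1,\dots,e^n$ and of $e^{n+1}=e^1+\dots+e^n$ with multiplicities $d_1,\dots,d_n,d_{n+1}\ge0$ (that is, the density of the image of Lebesgue measure on $[0,1]^{d_0}$ under $t\mapsto\sum_j t_jx^j$), and $k=\min\{d_i+d_j: 1\le i,j\le n+1,\ i\ne j\}\ge 1$. Then for all $0<s<k-1+\frac1p$ and every integer $r\ge0$ with $r+1>s$, $$B^s_{pq}=B^{s,2}_{pq}(\{\varphi\})$$ with equivalent norms: there are constants $C_1,C_2>0$, independent of $f$, such that $C_1\|f\|_{B^s_{pq}}\le\|f\|_{B^{s,2}_{pq}(\{\varphi\})}\le C_2\|f\|_{B^s_{pq}}$ for all measurable $f$ (both sides may be infinite).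 -/

import Mathlib

open MeasureTheory Set
open scoped ENNReal NNReal

noncomputable section

namespace DyadicBesov

/-! ### The Besov space of the dilation `2 Id`, through local polynomial approximation -/

/-- The translate `Q₀ = [0,1]ⁿ + c` of the tile `T = [0,1]ⁿ`. -/
def baseCube {n : ℕ} (c : Fin n → ℝ) : Set (Fin n → ℝ) :=
  {y | ∀ i, c i ≤ y i ∧ y i ≤ c i + 1}

/-- The cube `Q_l(x) = 2^{-l} Q₀ + x`. -/
def dyadicCube {n : ℕ} (c : Fin n → ℝ) (l : ℕ) (x : Fin n → ℝ) : Set (Fin n → ℝ) :=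
  {y | (2 : ℝ) ^ l • (y - x) ∈ baseCube c}

/-- `osc_p^r f(x, l)`: the infimum over the (complex) polynomials `P` of degree at most `r` of
`(|Q_l(x)|⁻¹ ∫_{Q_l(x)} |f - P|^p)^{1/p}` (the essential supremum over `Q_l(x)` if `p = ∞`). -/
def osc {n : ℕ} (c : Fin n → ℝ) (r : ℕ) (p : ℝ≥0∞) (f : (Fin n → ℝ) → ℂ)
    (x : Fin n → ℝ) (l : ℕ) : ℝ≥0∞ :=
  ⨅ (P : MvPolynomial (Fin n) ℂ) (_ : P.totalDegree ≤ r),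
    eLpNorm (fun y => f y - MvPolynomial.eval (fun i => (y i : ℂ)) P) p
      ((volume (dyadicCube c l x))⁻¹ • volume.restrict (dyadicCube c l x))

/-- The weighted sequence norm `(∑_{l ≥ 0} (2^{ls} a_l)^q)^{1/q}`
(the supremum of `2^{ls} a_l` if `q = ∞`). -/
def weightedNorm (s : ℝ) (q : ℝ≥0∞) (a : ℕ → ℝ≥0∞) : ℝ≥0∞ :=
  eLpNorm (fun l : ℕ => (2 : ℝ≥0∞) ^ ((l : ℝ) * s) * a l) q Measure.count

/-- The Besov norm
`‖f‖_p + (∑_{l ≥ 0} (2^{ls} ‖osc_p^r f(·, l)‖_p)^q)^{1/q}`, an element of `[0, ∞]`. -/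
def besovNorm {n : ℕ} (c : Fin n → ℝ) (r : ℕ) (s : ℝ) (p q : ℝ≥0∞)
    (f : (Fin n → ℝ) → ℂ) : ℝ≥0∞ :=
  eLpNorm f p volume
    + weightedNorm s q (fun l => eLpNorm (fun x => osc c r p f x l) p volume)

/-- The Besov space `B^s_{pq}`, as a set of (a.e. strongly measurable) functions. -/
def besovSpace {n : ℕ} (c : Fin n → ℝ) (r : ℕ) (s : ℝ) (p q : ℝ≥0∞) :
    Set ((Fin n → ℝ) → ℂ) :=
  {f | AEStronglyMeasurable f volume ∧ besovNorm c r s p q f < ∞}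

/-! ### The approximation space generated by the shifts and dyadic dilates of `φ` -/

/-- `V_l^p = {∑_{ν ∈ ℤⁿ} a(ν) φ(2^l x - ν) : a ∈ ℓ^p(ℤⁿ)}`. -/
def multiresSpace {n : ℕ} (φ : (Fin n → ℝ) → ℝ) (p : ℝ≥0∞) (l : ℕ) :
    Set ((Fin n → ℝ) → ℂ) :=
  {S | ∃ a : (Fin n → ℤ) → ℂ, Memℓp a p ∧
    S = fun x => ∑' ν : Fin n → ℤ, a ν * (φ (fun i => (2 : ℝ) ^ l * x i - (ν i : ℝ)) : ℂ)}

/-- The error `σ_l^p(f)` of `L^p`-approximation of `f` from `V_l^p`. -/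
def approxError {n : ℕ} (φ : (Fin n → ℝ) → ℝ) (p : ℝ≥0∞) (l : ℕ)
    (f : (Fin n → ℝ) → ℂ) : ℝ≥0∞ :=
  ⨅ S ∈ multiresSpace φ p l, eLpNorm (fun x => f x - S x) p volume

/-- The norm `‖f‖_p + (∑_{l ≥ 0} (2^{ls} σ_l^p(f))^q)^{1/q}`, an element of `[0, ∞]`. -/
def approxNorm {n : ℕ} (φ : (Fin n → ℝ) → ℝ) (s : ℝ) (p q : ℝ≥0∞)
    (f : (Fin n → ℝ) → ℂ) : ℝ≥0∞ :=
  eLpNorm f p volume + weightedNorm s q (fun l => approxError φ p l f)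

/-- The space `B^{s,2}_{pq}({φ})`, as a set of (a.e. strongly measurable) functions. -/
def approxSpace {n : ℕ} (φ : (Fin n → ℝ) → ℝ) (s : ℝ) (p q : ℝ≥0∞) :
    Set ((Fin n → ℝ) → ℂ) :=
  {f | AEStronglyMeasurable f volume ∧ approxNorm φ s p q f < ∞}

/-! ### The splines -/

/-- The central B-spline `M_k` of order `k ≥ 1`, with Fourier transform
`(sin (t/2) / (t/2))^k`: `M_1` is the indicator function of `[-1/2, 1/2]` and
`M_{k+1} = M_k * M_1`. (The value at `k = 0` is a placeholder.) -/
def centralBSpline : ℕ → ℝ → ℝ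
  | 0 => 0
  | 1 => indicator (Icc (-(1 / 2)) (1 / 2)) 1
  | k + 2 => fun t => ∫ u in (-(1 / 2 : ℝ))..(1 / 2), centralBSpline (k + 1) (t - u)

/-- The tensor product B-spline `𝓜_k(x) = ∏ᵢ M_k(xᵢ)`. -/
def tensorBSpline (n k : ℕ) (x : Fin n → ℝ) : ℝ :=
  ∏ i, centralBSpline k (x i)

/-- The directions `e¹, …, eⁿ` (unit vectors) and `eⁿ⁺¹ = e¹ + ⋯ + eⁿ`. -/
def boxDirection (n : ℕ) (i : Fin (n + 1)) : Fin n → ℝ :=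
  Fin.snoc (α := fun _ => Fin n → ℝ) (fun j : Fin n => Pi.single j 1) (fun _ => 1) i

/-- The image of Lebesgue measure on the unit cube `[0,1]^{d₀}`, `d₀ = d₁ + ⋯ + d_{n+1}`, under
`t ↦ ∑_j t_j x^j`, where the family `X = (x^j)` contains each `eⁱ` exactly `dᵢ` times. Its
Fourier transform is `ξ ↦ ∏_j (1 - exp(-i x^j · ξ)) / (i x^j · ξ)`. -/
def boxMeasure {n : ℕ} (d : Fin (n + 1) → ℕ) : Measure (Fin n → ℝ) :=
  (volume.restrict (Icc (0 : (Σ i, Fin (d i)) → ℝ) 1)).map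
    (fun t => ∑ j, t j • boxDirection n j.1)

/-- The box spline `B(·, X)`: the Lebesgue density of `boxMeasure d`. -/
def boxSpline {n : ℕ} (d : Fin (n + 1) → ℕ) (x : Fin n → ℝ) : ℝ :=
  ((boxMeasure d).rnDeriv volume x).toReal

/-- `min {dᵢ + dⱼ : i, j = 1, …, n + 1, i ≠ j}` (for `n ≥ 1`). -/
def boxOrder {n : ℕ} (d : Fin (n + 1) → ℕ) : ℕ :=
  sInf {m | ∃ i j, i ≠ j ∧ m = d i + d j}

end DyadicBesov

end

/-! Both norms are `‖f‖_p` plus a weighted `ℓ^q` norm over the levels. The equivalence therefore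
rests on a direct (Jackson) and an inverse (Bernstein) estimate between oscillation and spline
approximation.

Reduction. Up to null sets and a translation by `τ`, both families consist of functions `spline d`,
where `d` counts the directions `e¹, …, eⁿ⁺¹` and `HasOrder d k` says that any two different
multiplicities add up to at least `k`. The functions are built from half-open indicators, so that
partition of unity, refinement equation and the averaging recursion `spline_add_single` hold at
every point. If `HasOrder d 1`, then at least `n` directions occur; any `n` of them form a basis of
`ℤⁿ`, and the basic properties of the splines follow by adding the remaining directions one by one
(`HasOrder.induction`).

Inverse estimate. Let `α = smoothExp p k r` with `r + 1 ≤ k`. At scale `2^{-m}` the `L^p` error of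
local approximation of one spline by polynomials of degree `r` is `O(2^{-mα})`. Indeed, refine the
spline by the factor `N = 2^m`. By `polyApprox_splineSeries` the local error is controlled by the
differences of order `r + 1` of the mask, which is a product of means of `N` consecutive shifts. A
difference cancels against a mean in its direction and gains `N⁻¹`. In `ℓ^1` this works for `k`
differences, in `ℓ^∞` only for `k - 1`; interpolation gives `maskNorm_wordMask_le`, and for `r + 1 =
k` the exponent is `k - 1 + 1/p`. A finite-dimensionality argument on a ball, made uniform by
lattice translations, turns this into a Bernstein inequality. It is proved for sums of splines of
two consecutive levels, because with the translation `τ` the spaces `V_l` need not be nested.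
Telescoping near-best approximants and Hardy's inequality finish `besovNorm_le_approxNorm_spline`.

Direct estimate. Let `E = I - Q`, where `Q f` is the spline series whose coefficients are means of
`f` over unit cells. Differentiating `E f` along a direction gives the error for the derivative of
`f`, with a spline of one order less and another mean. By induction `E^{m+1}` annihilates
polynomials of degree `m` if the order is at least `m + 1` (`iterate_quasiError_eq_zero`). Since `E`
is local and bounded, `f - E^{m+1} f` is a spline series that is as close to `f` on each cell as
polynomials of degree `m` are on a larger ball.

Degrees. The two estimates restrict `r` in terms of `k`. Large `r` is reached by passing through an
auxiliary spline of higher order (`besovNorm_equiv_approxNorm_spline`). -/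

noncomputable section

namespace DyadicBesov

variable {n : ℕ}

/-! ### Cardinal B-splines with half-open support -/

/-- The cardinal B-spline of order `k`, starting from the indicator function of `[0, 1)`. -/
def cardinalBSpline : ℕ → ℝ → ℝ
  | 0 => 0
  | 1 => indicator (Ico 0 1) 1
  | k + 2 => fun t => ∫ u in (0 : ℝ)..1, cardinalBSpline (k + 1) (t - u)

lemma cardinalBSpline_succ {k : ℕ} (hk : 1 ≤ k) (t : ℝ) :
    cardinalBSpline (k + 1) t = ∫ u in (0 : ℝ)..1, cardinalBSpline k (t - u) := by
  obtain ⟨k, rfl⟩ := Nat.exists_eq_add_of_le' hk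
  rfl

lemma measurable_unitIntegral {α : Type*} [MeasurableSpace α] {f : α → ℝ → ℝ}
    (hf : Measurable (Function.uncurry f)) :
    Measurable fun x => ∫ u in (0 : ℝ)..1, f x u := by
  simp_rw [intervalIntegral.integral_of_le zero_le_one]
  exact (hf.stronglyMeasurable.integral_prod_right' (ν := volume.restrict (Ioc 0 1))).measurable

lemma measurable_cardinalBSpline : ∀ k, Measurable (cardinalBSpline k)
  | 0 => measurable_const
  | 1 => measurable_one.indicator measurableSet_Ico
  | k + 2 => by
    refine measurable_unitIntegral (f := fun t u => cardinalBSpline (k + 1) (t - u)) ?_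
    exact (measurable_cardinalBSpline (k + 1)).comp (measurable_fst.sub measurable_snd)

lemma unitIntegral_mem_Icc {f : ℝ → ℝ} (h : ∀ t, f t ∈ Icc (0 : ℝ) 1) :
    (∫ u in (0 : ℝ)..1, f u) ∈ Icc (0 : ℝ) 1 := by
  constructor
  · exact intervalIntegral.integral_nonneg zero_le_one fun u _ => (h u).1
  · have h1 : ‖∫ u in (0 : ℝ)..1, f u‖ ≤ 1 * |(1 : ℝ) - 0| := by
      apply intervalIntegral.norm_integral_le_of_norm_le_const
      intro u _
      rw [Real.norm_eq_abs, abs_of_nonneg (h u).1]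
      exact (h u).2
    have := le_of_abs_le (by simpa using h1)
    exact this

lemma cardinalBSpline_mem_Icc : ∀ k t, cardinalBSpline k t ∈ Icc (0 : ℝ) 1
  | 0, t => by simp [cardinalBSpline]
  | 1, t => by
    simp only [cardinalBSpline, indicator]
    split_ifs <;> simp
  | k + 2, t => unitIntegral_mem_Icc fun u => cardinalBSpline_mem_Icc (k + 1) (t - u)

lemma cardinalBSpline_eq_zero : ∀ (k : ℕ) (t : ℝ), t ∉ Icc (0 : ℝ) k → cardinalBSpline k t = 0
  | 0, t, _ => rfl
  | 1, t, h => by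
    simp only [cardinalBSpline]
    apply indicator_of_notMem
    exact fun h' => h ⟨h'.1, by simpa using h'.2.le⟩
  | k + 2, t, h => by
    simp only [cardinalBSpline]
    rw [intervalIntegral.integral_congr (g := fun _ => (0 : ℝ))]
    · simp
    · intro u hu
      rw [uIcc_of_le zero_le_one] at hu
      apply cardinalBSpline_eq_zero (k + 1)
      intro h'
      apply h
      push_cast at h' ⊢
      exact ⟨by linarith [hu.1, h'.1], by linarith [hu.2, h'.2]⟩

lemma intervalIntegrable_of_mem_Icc {f : ℝ → ℝ} (hm : Measurable f)
    (h : ∀ t, f t ∈ Icc (0 : ℝ) 1) (a b : ℝ) : IntervalIntegrable f volume a b := by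
  refine (intervalIntegrable_const (c := (1 : ℝ))).mono_fun hm.aestronglyMeasurable ?_
  refine Filter.Eventually.of_forall fun t => ?_
  simpa [abs_of_nonneg (h t).1] using (h t).2

/-! ### A pointwise version of the box splines -/

lemma boxDirection_castSucc {n : ℕ} (j : Fin n) :
    boxDirection n j.castSucc = Pi.single j 1 := by
  simp [boxDirection]

lemma boxDirection_last (n : ℕ) : boxDirection n (Fin.last n) = fun _ => 1 := by
  simp [boxDirection]

/-- All sums of two different multiplicities are at least `k`. -/
def HasOrder {n : ℕ} (d : Fin (n + 1) → ℕ) (k : ℕ) : Prop :=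
  ∀ i j, i ≠ j → k ≤ d i + d j

open Classical in
/-- The box spline with multiplicities `d`, as a function that is defined at every point. -/
def spline {n : ℕ} (d : Fin (n + 1) → ℕ) (x : Fin n → ℝ) : ℝ :=
  if d (Fin.last n) = 0 then ∏ i : Fin n, cardinalBSpline (d i.castSucc) (x i)
  else if h : ∃ i : Fin n, d i.castSucc = 0 then
    cardinalBSpline (d (Fin.last n)) (x h.choose) *
      ∏ j ∈ Finset.univ.erase h.choose, cardinalBSpline (d j.castSucc) (x j - x h.choose)
  else ∫ t, cardinalBSpline (d (Fin.last n)) t *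
    ∏ i : Fin n, cardinalBSpline (d i.castSucc) (x i - t)


lemma spline_of_last {d : Fin (n + 1) → ℕ} (h : d (Fin.last n) = 0) (x : Fin n → ℝ) :
    spline d x = ∏ i : Fin n, cardinalBSpline (d i.castSucc) (x i) := by
  rw [spline, if_pos h]

/-- Two vanishing multiplicities would contradict `HasOrder d 1`, so the index picked by choice in
`spline` must be `i`. -/
lemma spline_of_castSucc {d : Fin (n + 1) → ℕ} (hd : HasOrder d 1) {i : Fin n}
    (h : d i.castSucc = 0) (x : Fin n → ℝ) :
    spline d x = cardinalBSpline (d (Fin.last n)) (x i) *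
      ∏ j ∈ Finset.univ.erase i, cardinalBSpline (d j.castSucc) (x j - x i) := by
  classical
  have hex : ∃ i : Fin n, d i.castSucc = 0 := ⟨i, h⟩
  have hlast : d (Fin.last n) ≠ 0 := by
    have := hd i.castSucc (Fin.last n) (Fin.castSucc_lt_last i).ne
    omega
  have hi : hex.choose = i := by
    by_contra hne
    have := hd hex.choose.castSucc i.castSucc (by simpa using hne)
    have := hex.choose_spec
    omega
  rw [spline, if_neg hlast, dif_pos hex, hi]

lemma spline_of_pos {d : Fin (n + 1) → ℕ} (h : ∀ i, d i ≠ 0) (x : Fin n → ℝ) :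
    spline d x = ∫ t, cardinalBSpline (d (Fin.last n)) t *
      ∏ i : Fin n, cardinalBSpline (d i.castSucc) (x i - t) := by
  rw [spline, if_neg (h _), dif_neg (by simp [h])]

lemma prod_mem_Icc {ι : Type*} (s : Finset ι) {f : ι → ℝ} (h : ∀ i, f i ∈ Icc (0 : ℝ) 1) :
    ∏ i ∈ s, f i ∈ Icc (0 : ℝ) 1 :=
  ⟨Finset.prod_nonneg fun i _ => (h i).1, Finset.prod_le_one (fun i _ => (h i).1) fun i _ => (h i).2⟩

lemma measurable_prod_cardinalBSpline {α : Type*} [MeasurableSpace α] (s : Finset (Fin n))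
    (k : Fin n → ℕ) {g : Fin n → α → ℝ} (hg : ∀ i, Measurable (g i)) :
    Measurable fun a => ∏ i ∈ s, cardinalBSpline (k i) (g i a) :=
  Finset.measurable_prod _ fun i _ => (measurable_cardinalBSpline _).comp (hg i)

lemma mul_mem_Icc {a b : ℝ} (ha : a ∈ Icc (0 : ℝ) 1) (hb : b ∈ Icc (0 : ℝ) 1) :
    a * b ∈ Icc (0 : ℝ) 1 :=
  ⟨mul_nonneg ha.1 hb.1, mul_le_one₀ ha.2 hb.1 hb.2⟩

lemma integrable_cardinalBSpline (k : ℕ) : Integrable (cardinalBSpline k) := by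
  have h : cardinalBSpline k = indicator (Icc (0 : ℝ) k) (cardinalBSpline k) := by
    symm
    rw [indicator_eq_self]
    intro t ht
    by_contra h
    exact ht (cardinalBSpline_eq_zero k t h)
  rw [h, integrable_indicator_iff measurableSet_Icc]
  refine Measure.integrableOn_of_bounded (M := 1) (by simp)
    (measurable_cardinalBSpline k).aestronglyMeasurable ?_
  refine Filter.Eventually.of_forall fun t => ?_
  rw [Real.norm_eq_abs, abs_of_nonneg (cardinalBSpline_mem_Icc k t).1]
  exact (cardinalBSpline_mem_Icc k t).2

/-- Averages of products of the function `cardinalBSpline k` and a function with values in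
`[0, 1]` may be computed in either order. -/
lemma unitIntegral_integral_swap {f : ℝ → ℝ → ℝ} {g : ℝ → ℝ} (hg : Integrable g)
    (hf : Measurable (Function.uncurry f)) (h : ∀ u t, |f u t| ≤ g t) :
    ∫ u in (0 : ℝ)..1, ∫ t, f u t = ∫ t, ∫ u in (0 : ℝ)..1, f u t := by
  simp_rw [intervalIntegral.integral_of_le zero_le_one]
  apply integral_integral_swap
  refine Integrable.mono' (g := fun z : ℝ × ℝ => g z.2) ?_ hf.aestronglyMeasurable
    (Filter.Eventually.of_forall fun z => h z.1 z.2)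
  exact hg.comp_snd _

/-- Because `spline` is given by closed formulas, the recursion is available in every direction and
at every point, and no order of the directions has to be fixed. A new vector raises the order of one
factor, or turns a product into the integral formula; if all multiplicities are positive, the claim
is Fubini. -/
lemma spline_add_single [NeZero n] {d : Fin (n + 1) → ℕ} (hd : HasOrder d 1) (i : Fin (n + 1))
    (x : Fin n → ℝ) :
    spline (d + Pi.single i 1) x = ∫ t in (0 : ℝ)..1, spline d (x - t • boxDirection n i) := by
  classical
  have hord : HasOrder (d + Pi.single i 1) 1 := fun a b hab =>
    (hd a b hab).trans (by simp only [Pi.add_apply]; omega)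
  by_cases hlast : d (Fin.last n) = 0
  · have hpos : ∀ j : Fin n, d j.castSucc ≠ 0 := fun j => by
      have := hd j.castSucc (Fin.last n) (Fin.castSucc_lt_last j).ne
      omega
    simp_rw [spline_of_last hlast]
    induction i using Fin.lastCases with
    | last =>
      rw [spline_of_pos]
      · have h1 : (d + Pi.single (Fin.last n) 1 : Fin (n + 1) → ℕ) (Fin.last n) = 1 := by
          simp [hlast]
        have h2 : ∀ j : Fin n, (d + Pi.single (Fin.last n) 1 : Fin (n + 1) → ℕ) j.castSucc
            = d j.castSucc := fun j => by simp [(Fin.castSucc_lt_last j).ne]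
        rw [h1]
        simp_rw [h2, boxDirection_last]
        rw [intervalIntegral.integral_of_le zero_le_one, ← integral_Ico_eq_integral_Ioc,
          ← integral_indicator measurableSet_Ico]
        congr 1 with t
        by_cases ht : t ∈ Ico (0 : ℝ) 1 <;> simp [cardinalBSpline, ht]
      · intro j
        induction j using Fin.lastCases with
        | last => simp
        | cast j => simp [hpos j]
    | cast i =>
      rw [spline_of_last (by simp [hlast, (Fin.castSucc_lt_last i).ne'])]
      rw [← Finset.mul_prod_erase _ _ (Finset.mem_univ i)]
      have h2 : ∀ t : ℝ, ∏ j : Fin n, cardinalBSpline (d j.castSucc)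
          ((x - t • boxDirection n i.castSucc) j) = cardinalBSpline (d i.castSucc) (x i - t) *
          ∏ j ∈ Finset.univ.erase i, cardinalBSpline (d j.castSucc) (x j) := by
        intro t
        rw [← Finset.mul_prod_erase _ _ (Finset.mem_univ i)]
        congr 1
        · simp [boxDirection_castSucc]
        · refine Finset.prod_congr rfl fun j hj => ?_
          simp [boxDirection_castSucc, Finset.ne_of_mem_erase hj]
      simp_rw [h2]
      rw [intervalIntegral.integral_mul_const]
      congr 1
      · simp only [Pi.add_apply, Pi.single_eq_same]
        exact cardinalBSpline_succ (Nat.pos_of_ne_zero (hpos i)) _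
      · refine Finset.prod_congr rfl fun j hj => ?_
        simp [Finset.ne_of_mem_erase hj]
  by_cases hex : ∃ i0 : Fin n, d i0.castSucc = 0
  · obtain ⟨i0, hi0⟩ := hex
    have hpos : ∀ j, j ≠ i0 → d j.castSucc ≠ 0 := fun j hj => by
      have := hd j.castSucc i0.castSucc (by simpa using hj)
      omega
    simp_rw [spline_of_castSucc hd hi0]
    induction i using Fin.lastCases with
    | last =>
      rw [spline_of_castSucc hord (i := i0) (by simp [hi0, (Fin.castSucc_lt_last i0).ne])]
      simp only [boxDirection_last, Pi.add_apply, Pi.single_eq_same, Pi.sub_apply, Pi.smul_apply,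
        smul_eq_mul, mul_one, sub_sub_sub_cancel_right]
      rw [intervalIntegral.integral_mul_const, cardinalBSpline_succ (Nat.pos_of_ne_zero hlast)]
      simp [(Fin.castSucc_lt_last _).ne]
    | cast i =>
      by_cases hi : i = i0
      · subst hi
        rw [spline_of_pos]
        -- The new factor has order one and equals `1` exactly if `x i - t ∈ [0, 1)`, so the
        -- integral over the line shrinks to `(x i - 1, x i]`. The substitution `t ↦ x i - t` then
        -- gives the skew product.
        · have h1 : ∀ t : ℝ, cardinalBSpline ((d + Pi.single i.castSucc 1 :
              Fin (n + 1) → ℕ) (Fin.last n)) t * ∏ j : Fin n, cardinalBSpline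
              ((d + Pi.single i.castSucc 1 : Fin (n + 1) → ℕ) j.castSucc) (x j - t) =
              indicator (Ioc (x i - 1) (x i)) (fun t => cardinalBSpline (d (Fin.last n)) t *
                ∏ j ∈ Finset.univ.erase i, cardinalBSpline (d j.castSucc) (x j - t)) t := by
            intro t
            rw [← Finset.mul_prod_erase _ _ (Finset.mem_univ i)]
            have e1 : ∏ j ∈ Finset.univ.erase i, cardinalBSpline
              ((d + Pi.single i.castSucc 1 : Fin (n + 1) → ℕ) j.castSucc) (x j - t)
              = ∏ j ∈ Finset.univ.erase i, cardinalBSpline (d j.castSucc) (x j - t) := by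
              refine Finset.prod_congr rfl fun j hj => ?_
              simp [Finset.ne_of_mem_erase hj]
            rw [e1]
            simp only [Pi.add_apply, Pi.single_eq_same, hi0, zero_add,
              Pi.single_eq_of_ne (Fin.castSucc_lt_last i).ne', add_zero, cardinalBSpline]
            by_cases ht : t ∈ Ioc (x i - 1) (x i)
            · rw [indicator_of_mem ht, indicator_of_mem (by
                constructor <;> linarith [ht.1, ht.2])]
              simp
            · rw [indicator_of_notMem ht, indicator_of_notMem (by
                intro h; apply ht; constructor <;> linarith [h.1, h.2])]
              simp
          simp_rw [h1]
          rw [integral_indicator measurableSet_Ioc,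
            ← intervalIntegral.integral_of_le (by linarith)]
          have h3 := intervalIntegral.integral_comp_sub_left (a := 0) (b := 1)
            (fun t => cardinalBSpline (d (Fin.last n)) t *
                ∏ j ∈ Finset.univ.erase i, cardinalBSpline (d j.castSucc) (x j - t)) (x i)
          rw [sub_zero] at h3
          rw [← h3]
          refine intervalIntegral.integral_congr fun t _ => ?_
          simp only [boxDirection_castSucc, Pi.sub_apply, Pi.smul_apply, Pi.single_eq_same,
            smul_eq_mul, mul_one]
          congr 1
          refine Finset.prod_congr rfl fun j hj => ?_
          simp [Finset.ne_of_mem_erase hj]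
        · intro j
          induction j using Fin.lastCases with
          | last => simp [hlast]
          | cast j =>
            by_cases hj : j = i
            · simp [hj]
            · simp [hpos j hj]
      · rw [spline_of_castSucc hord (i := i0) (by simp [hi0, Ne.symm hi])]
        have hmem : i ∈ Finset.univ.erase i0 := by simp [hi]
        rw [← Finset.mul_prod_erase _ _ hmem]
        have h2 : ∀ t : ℝ, cardinalBSpline (d (Fin.last n))
            ((x - t • boxDirection n i.castSucc) i0) * ∏ j ∈ Finset.univ.erase i0,
            cardinalBSpline (d j.castSucc) ((x - t • boxDirection n i.castSucc) j -
              (x - t • boxDirection n i.castSucc) i0) =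
            cardinalBSpline (d i.castSucc) (x i - x i0 - t) *
            (cardinalBSpline (d (Fin.last n)) (x i0) * ∏ j ∈ (Finset.univ.erase i0).erase i,
              cardinalBSpline (d j.castSucc) (x j - x i0)) := by
          intro t
          rw [← Finset.mul_prod_erase _ _ hmem, mul_left_comm]
          have e0 : (x - t • boxDirection n i.castSucc) i0 = x i0 := by
            simp [boxDirection_castSucc, Ne.symm hi]
          rw [e0]
          congr 1
          · congr 1
            simp only [boxDirection_castSucc, Pi.sub_apply, Pi.smul_apply, Pi.single_eq_same,
              smul_eq_mul, mul_one]
            ring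
          · congr 1
            refine Finset.prod_congr rfl fun j hj => ?_
            simp [boxDirection_castSucc, Finset.ne_of_mem_erase hj]
        simp_rw [h2]
        rw [intervalIntegral.integral_mul_const, mul_left_comm]
        congr 1
        · simp only [Pi.add_apply, Pi.single_eq_same]
          exact cardinalBSpline_succ (Nat.pos_of_ne_zero (hpos i hi)) _
        · congr 1
          · simp [(Fin.castSucc_lt_last _).ne']
          · refine Finset.prod_congr rfl fun j hj => ?_
            simp [Finset.ne_of_mem_erase hj]
  · have hpos : ∀ j, d j ≠ 0 := by
      intro j
      induction j using Fin.lastCases with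
      | last => exact hlast
      | cast j => exact fun h => hex ⟨j, h⟩
    have hpos' : ∀ j, (d + Pi.single i 1 : Fin (n + 1) → ℕ) j ≠ 0 := fun j => by
      simp [hpos j]
    simp_rw [spline_of_pos hpos, spline_of_pos hpos']
    induction i using Fin.lastCases with
    | last =>
      have e1 : ∀ j : Fin n, (d + Pi.single (Fin.last n) 1 : Fin (n + 1) → ℕ) j.castSucc
          = d j.castSucc := fun j => by simp [(Fin.castSucc_lt_last j).ne]
      have e2 : (d + Pi.single (Fin.last n) 1 : Fin (n + 1) → ℕ) (Fin.last n)
        = d (Fin.last n) + 1 := by simp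
      simp_rw [e1, e2, cardinalBSpline_succ (Nat.pos_of_ne_zero hlast),
        ← intervalIntegral.integral_mul_const]
      have h3 : ∀ u : ℝ, ∫ t, cardinalBSpline (d (Fin.last n)) t * ∏ j : Fin n,
          cardinalBSpline (d j.castSucc) ((x - u • boxDirection n (Fin.last n)) j - t) =
          ∫ t, cardinalBSpline (d (Fin.last n)) (t - u) * ∏ j : Fin n,
          cardinalBSpline (d j.castSucc) (x j - t) := by
        intro u
        rw [← integral_sub_right_eq_self _ u]
        congr 1 with t
        congr 1
        refine Finset.prod_congr rfl fun j _ => ?_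
        congr 1
        simp [boxDirection_last]
      simp_rw [h3]
      symm
      have hmeas : Measurable (Function.uncurry fun u t : ℝ =>
          cardinalBSpline (d (Fin.last n)) (t - u) * ∏ j : Fin n,
          cardinalBSpline (d j.castSucc) (x j - t)) :=
        ((measurable_cardinalBSpline _).comp (measurable_snd.sub measurable_fst)).mul
          (measurable_prod_cardinalBSpline _ _ fun i => measurable_const.sub measurable_snd)
      -- A single factor serves as integrable majorant in `t`; its existence requires `n ≥ 1`.
      have i0 : Fin n := 0
      refine unitIntegral_integral_swap (g := fun t => cardinalBSpline (d i0.castSucc) (x i0 - t))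
        ((integrable_cardinalBSpline _).comp_sub_left _) hmeas ?_
      intro u t
      rw [← Finset.mul_prod_erase _ _ (Finset.mem_univ i0)]
      have m1 := cardinalBSpline_mem_Icc (d (Fin.last n)) (t - u)
      have m2 := cardinalBSpline_mem_Icc (d i0.castSucc) (x i0 - t)
      have m3 := prod_mem_Icc (Finset.univ.erase i0)
        (fun j => cardinalBSpline_mem_Icc (d j.castSucc) (x j - t))
      have m4 := mul_mem_Icc m1 m3
      rw [mul_left_comm, abs_of_nonneg (mul_nonneg m2.1 m4.1)]
      exact mul_le_of_le_one_right m2.1 m4.2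
    | cast i =>
      have e2 : (d + Pi.single i.castSucc 1 : Fin (n + 1) → ℕ) (Fin.last n)
        = d (Fin.last n) := by simp [(Fin.castSucc_lt_last i).ne']
      rw [e2]
      have e1 : ∀ t : ℝ, ∏ j : Fin n, cardinalBSpline
          ((d + Pi.single i.castSucc 1 : Fin (n + 1) → ℕ) j.castSucc) (x j - t) =
          ∫ u in (0 : ℝ)..1, ∏ j : Fin n, cardinalBSpline (d j.castSucc)
            ((x - u • boxDirection n i.castSucc) j - t) := by
        intro t
        have h2 : ∀ u : ℝ, ∏ j : Fin n, cardinalBSpline (d j.castSucc)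
            ((x - u • boxDirection n i.castSucc) j - t) =
            cardinalBSpline (d i.castSucc) (x i - t - u) *
            ∏ j ∈ Finset.univ.erase i, cardinalBSpline (d j.castSucc) (x j - t) := by
          intro u
          rw [← Finset.mul_prod_erase _ _ (Finset.mem_univ i)]
          congr 1
          · simp only [boxDirection_castSucc, Pi.sub_apply, Pi.smul_apply, Pi.single_eq_same,
              smul_eq_mul, mul_one]
            congr 1
            ring
          · refine Finset.prod_congr rfl fun j hj => ?_
            simp [boxDirection_castSucc, Finset.ne_of_mem_erase hj]
        simp_rw [h2]
        rw [intervalIntegral.integral_mul_const, ← Finset.mul_prod_erase _ _ (Finset.mem_univ i)]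
        congr 1
        · simp only [Pi.add_apply, Pi.single_eq_same]
          exact cardinalBSpline_succ (Nat.pos_of_ne_zero (hpos _)) _
        · refine Finset.prod_congr rfl fun j hj => ?_
          simp [Finset.ne_of_mem_erase hj]
      simp_rw [e1, ← intervalIntegral.integral_const_mul]
      symm
      refine unitIntegral_integral_swap (integrable_cardinalBSpline (d (Fin.last n))) ?_ ?_
      · refine ((measurable_cardinalBSpline _).comp measurable_snd).mul
          (measurable_prod_cardinalBSpline _ _ fun j => ?_)
        simp only [Pi.sub_apply, Pi.smul_apply, smul_eq_mul]
        fun_prop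
      · intro u t
        have m1 := cardinalBSpline_mem_Icc (d (Fin.last n)) t
        have m3 := prod_mem_Icc Finset.univ
          (fun j => cardinalBSpline_mem_Icc (d j.castSucc)
            ((x - u • boxDirection n i.castSucc) j - t))
        rw [abs_of_nonneg (mul_nonneg m1.1 m3.1)]
        exact mul_le_of_le_one_right m1.1 m3.2

/-! ### Lattice points -/

/-- A lattice point as a point of `ℝⁿ`. -/
def latticePoint (ν : Fin n → ℤ) : Fin n → ℝ := fun i => (ν i : ℝ)

@[simp] lemma latticePoint_apply (ν : Fin n → ℤ) (i : Fin n) : latticePoint ν i = ν i := rfl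

lemma latticePoint_add (μ ν : Fin n → ℤ) :
    latticePoint (μ + ν) = latticePoint μ + latticePoint ν := by
  ext; simp

lemma latticePoint_sub (μ ν : Fin n → ℤ) :
    latticePoint (μ - ν) = latticePoint μ - latticePoint ν := by
  ext; simp

/-- The lattice points with all coordinates in `[-M, M]`. -/
def latticeBox (n M : ℕ) : Finset (Fin n → ℤ) := Finset.Icc (fun _ => -(M : ℤ)) (fun _ => (M : ℤ))

lemma mem_latticeBox {M : ℕ} {ν : Fin n → ℤ} : ν ∈ latticeBox n M ↔ ∀ i, |ν i| ≤ M := by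
  simp [latticeBox, Finset.mem_Icc, Pi.le_def, abs_le, forall_and]

lemma mem_latticeBox_of_norm_le {M : ℕ} {ν : Fin n → ℤ} (h : ‖latticePoint ν‖ ≤ M) :
    ν ∈ latticeBox n M := by
  rw [mem_latticeBox]
  intro i
  have := (norm_le_pi_norm (latticePoint ν) i).trans h
  rw [latticePoint_apply, Real.norm_eq_abs] at this
  exact_mod_cast this

/-- The integer version of `boxDirection`. -/
def latticeDirection (n : ℕ) (i : Fin (n + 1)) : Fin n → ℤ :=
  Fin.lastCases (motive := fun _ => Fin n → ℤ) (fun _ => 1) (fun j => Pi.single j 1) i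

lemma latticeDirection_last : latticeDirection n (Fin.last n) = fun _ => 1 := by
  simp [latticeDirection]

lemma latticeDirection_castSucc (j : Fin n) :
    latticeDirection n j.castSucc = Pi.single j 1 := by
  simp [latticeDirection]

lemma latticePoint_direction (i : Fin (n + 1)) :
    latticePoint (latticeDirection n i) = boxDirection n i := by
  induction i using Fin.lastCases with
  | last => ext; simp [latticeDirection_last, boxDirection_last]
  | cast j =>
    ext l
    rw [latticePoint_apply, latticeDirection_castSucc, boxDirection_castSucc]
    by_cases h : l = j
    · subst h; simp
    · simp [h]

/-! ### Induction on the multiplicities -/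

/-- The multiplicities of the basis consisting of all directions except the `i`-th one. -/
def baseMult (i : Fin (n + 1)) : Fin (n + 1) → ℕ := fun j => if j = i then 0 else 1

lemma HasOrder.mono {d e : Fin (n + 1) → ℕ} {k : ℕ} (hd : HasOrder d k) (h : d ≤ e) :
    HasOrder e k := fun i j hij => (hd i j hij).trans (add_le_add (h i) (h j))

lemma HasOrder.of_le {d : Fin (n + 1) → ℕ} {k l : ℕ} (hd : HasOrder d k) (h : l ≤ k) :
    HasOrder d l := fun i j hij => h.trans (hd i j hij)

/-- The two indices of a pair are different, so removing one vector lowers the sum of their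
multiplicities by at most one. -/
lemma HasOrder.of_add_single {d : Fin (n + 1) → ℕ} {k : ℕ} {i : Fin (n + 1)}
    (hd : HasOrder (d + Pi.single i 1) (k + 1)) : HasOrder d k := by
  intro a b hab
  have := hd a b hab
  by_cases ha : a = i <;> by_cases hb : b = i <;> simp_all <;> omega

lemma hasOrder_baseMult (i : Fin (n + 1)) : HasOrder (baseMult i) 1 := by
  intro a b hab
  by_cases ha : a = i <;> by_cases hb : b = i <;> simp_all [baseMult]

lemma HasOrder.exists_baseMult_le {d : Fin (n + 1) → ℕ} (hd : HasOrder d 1) :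
    ∃ i, baseMult i ≤ d := by
  by_cases h : ∃ i, d i = 0
  · obtain ⟨i, hi⟩ := h
    refine ⟨i, fun j => ?_⟩
    by_cases hj : j = i
    · simp [baseMult, hj]
    · have := hd j i hj
      simp [baseMult, hj]
      omega
  · push Not at h
    refine ⟨0, fun j => ?_⟩
    have := h j
    simp only [baseMult]
    split_ifs <;> omega

/-- Every admissible family contains one of the `n + 1` bases; the other vectors are added one at a
time, and no intermediate family loses `HasOrder _ 1`. -/
lemma HasOrder.induction {motive : ∀ d : Fin (n + 1) → ℕ, HasOrder d 1 → Prop}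
    (base : ∀ i, motive (baseMult i) (hasOrder_baseMult i))
    (step : ∀ d i (hd : HasOrder d 1), motive d hd →
      motive (d + Pi.single i 1) (hd.mono le_self_add))
    (d : Fin (n + 1) → ℕ) (hd : HasOrder d 1) : motive d hd := by
  obtain ⟨i, hi⟩ := hd.exists_baseMult_le
  obtain ⟨e, rfl⟩ := le_iff_exists_add.1 hi
  clear hi
  induction hN : ∑ j, e j generalizing e with
  | zero =>
    have : e = 0 := by
      ext j
      exact Finset.sum_eq_zero_iff.1 hN j (Finset.mem_univ j)
    simpa [this] using base i
  | succ N ih =>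
    have hex : ∃ j, e j ≠ 0 := by
      by_contra h
      push Not at h
      simp [h] at hN
    obtain ⟨j, hj⟩ := hex
    have he : e = e - Pi.single j 1 + Pi.single j 1 := by
      ext l
      by_cases hl : l = j
      · subst hl; simp; omega
      · simp [hl]
    have key : ∀ e' : Fin (n + 1) → ℕ, e = e' + Pi.single j 1 →
        motive (baseMult i + e') ((hasOrder_baseMult i).mono le_self_add) → motive _ hd := by
      rintro e' rfl h
      have := step _ j _ h
      simpa only [add_assoc] using this
    · refine key _ he (ih _ _ ?_)
      rw [he] at hN
      simp only [Pi.add_apply, Finset.sum_add_distrib, Finset.sum_pi_single', Finset.mem_univ,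
        if_true, add_left_inj] at hN
      simpa using hN

/-! ### Coordinates with respect to a basis of box directions -/

/-- The position in the family of directions of the `j`-th vector of the basis that leaves out
the `i`-th direction. -/
def baseIndex (i : Fin (n + 1)) (j : Fin n) : Fin (n + 1) :=
  if j.castSucc = i then Fin.last n else j.castSucc

/-- The vector with coordinates `y` with respect to the directions `baseIndex i`. -/
def ofCoord {R : Type*} [CommRing R] (i : Fin (n + 1)) (y : Fin n → R) : Fin n → R :=
  Fin.lastCases (motive := fun _ => Fin n → R) y
    (fun l => fun j => if j = l then y l else y j + y l) i

/-- The coordinates with respect to the directions `baseIndex i`. -/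
def toCoord {R : Type*} [CommRing R] (i : Fin (n + 1)) (x : Fin n → R) : Fin n → R :=
  Fin.lastCases (motive := fun _ => Fin n → R) x
    (fun l => fun j => if j = l then x l else x j - x l) i

lemma toCoord_last {R : Type*} [CommRing R] (x : Fin n → R) : toCoord (Fin.last n) x = x := by
  simp [toCoord]

lemma toCoord_castSucc {R : Type*} [CommRing R] (l : Fin n) (x : Fin n → R) :
    toCoord l.castSucc x = fun j => if j = l then x l else x j - x l := by
  simp [toCoord]

lemma ofCoord_last {R : Type*} [CommRing R] (x : Fin n → R) : ofCoord (Fin.last n) x = x := by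
  simp [ofCoord]

lemma ofCoord_castSucc {R : Type*} [CommRing R] (l : Fin n) (x : Fin n → R) :
    ofCoord l.castSucc x = fun j => if j = l then x l else x j + x l := by
  simp [ofCoord]

/-- The linear change of coordinates `toCoord`. -/
def coordEquiv (R : Type*) [CommRing R] (i : Fin (n + 1)) : (Fin n → R) ≃ₗ[R] (Fin n → R) where
  toFun := toCoord i
  invFun := ofCoord i
  map_add' x y := by
    induction i using Fin.lastCases with
    | last => simp [toCoord_last]
    | cast l =>
      ext j
      simp only [toCoord_castSucc, Pi.add_apply]
      split_ifs <;> ring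
  map_smul' c x := by
    induction i using Fin.lastCases with
    | last => simp [toCoord_last]
    | cast l =>
      ext j
      simp only [toCoord_castSucc, Pi.smul_apply, smul_eq_mul, RingHom.id_apply]
      split_ifs <;> ring
  left_inv x := by
    induction i using Fin.lastCases with
    | last => simp [toCoord_last, ofCoord_last]
    | cast l =>
      ext j
      by_cases h : j = l
      · simp [toCoord_castSucc, ofCoord_castSucc, h]
      · simp [toCoord_castSucc, ofCoord_castSucc, h]
  right_inv x := by
    induction i using Fin.lastCases with
    | last => simp [toCoord_last, ofCoord_last]
    | cast l =>
      ext j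
      by_cases h : j = l
      · simp [toCoord_castSucc, ofCoord_castSucc, h]
      · simp [toCoord_castSucc, ofCoord_castSucc, h]

/-- The change of basis is given by the same integral formula over `ℤ` and `ℝ` and is invertible
over both, so sums over the lattice can be reindexed by it. -/
lemma coordEquiv_latticePoint (i : Fin (n + 1)) (ν : Fin n → ℤ) :
    coordEquiv ℝ i (latticePoint ν) = latticePoint (coordEquiv ℤ i ν) := by
  change toCoord i (latticePoint ν) = latticePoint (toCoord i ν)
  induction i using Fin.lastCases with
  | last => simp [toCoord_last]
  | cast l =>
    ext j
    simp only [toCoord_castSucc, latticePoint_apply]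
    split_ifs <;> simp

lemma coordEquiv_symm_single (i : Fin (n + 1)) (j : Fin n) :
    (coordEquiv ℤ i).symm (Pi.single j 1) = latticeDirection n (baseIndex i j) := by
  change ofCoord i (Pi.single j 1) = latticeDirection n (baseIndex i j)
  induction i using Fin.lastCases with
  | last => simp [ofCoord_last, baseIndex, (Fin.castSucc_lt_last j).ne, latticeDirection_castSucc]
  | cast l =>
    by_cases h : j = l
    · subst h
      simp only [ofCoord_castSucc, baseIndex, if_true, latticeDirection_last, Pi.single_eq_same]
      ext m
      by_cases hm : m = j <;> simp [hm]
    · simp only [ofCoord_castSucc, baseIndex, Fin.castSucc_inj, h, if_false,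
        latticeDirection_castSucc, Pi.single_eq_of_ne (Ne.symm h)]
      ext m
      by_cases hm : m = l
      · subst hm; simp [Pi.single_eq_of_ne (Ne.symm h)]
      · simp [hm]

lemma latticePoint_coordEquiv_symm (i : Fin (n + 1)) (ν : Fin n → ℤ) :
    latticePoint ((coordEquiv ℤ i).symm ν) = (coordEquiv ℝ i).symm (latticePoint ν) := by
  rw [LinearEquiv.eq_symm_apply, coordEquiv_latticePoint, LinearEquiv.apply_symm_apply]

lemma coordEquiv_symm_single_real (i : Fin (n + 1)) (j : Fin n) :
    (coordEquiv ℝ i).symm (Pi.single j 1) = boxDirection n (baseIndex i j) := by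
  rw [← latticePoint_direction, ← coordEquiv_symm_single, latticePoint_coordEquiv_symm]
  congr 1
  ext l
  by_cases h : l = j
  · subst h; simp
  · simp [h]

lemma baseIndex_ne (i : Fin (n + 1)) (j : Fin n) : baseIndex i j ≠ i := by
  unfold baseIndex
  split_ifs with h
  · rw [← h]; exact (Fin.castSucc_lt_last j).ne'
  · exact h

lemma norm_coordEquiv_le (i : Fin (n + 1)) (x : Fin n → ℝ) :
    ‖coordEquiv ℝ i x‖ ≤ 2 * ‖x‖ := by
  change ‖toCoord i x‖ ≤ _
  have h0 := norm_nonneg x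
  induction i using Fin.lastCases with
  | last => rw [toCoord_last]; linarith
  | cast l =>
    rw [toCoord_castSucc, pi_norm_le_iff_of_nonneg (by positivity)]
    intro j
    have h1 := norm_le_pi_norm x l
    have h2 := norm_le_pi_norm x j
    split_ifs
    · linarith
    · exact (norm_sub_le _ _).trans (by linarith)

lemma norm_coordEquiv_symm_le (i : Fin (n + 1)) (x : Fin n → ℝ) :
    ‖(coordEquiv ℝ i).symm x‖ ≤ 2 * ‖x‖ := by
  change ‖ofCoord i x‖ ≤ _
  have h0 := norm_nonneg x
  induction i using Fin.lastCases with
  | last => rw [ofCoord_last]; linarith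
  | cast l =>
    rw [ofCoord_castSucc, pi_norm_le_iff_of_nonneg (by positivity)]
    intro j
    have h1 := norm_le_pi_norm x l
    have h2 := norm_le_pi_norm x j
    split_ifs
    · linarith
    · exact (norm_add_le _ _).trans (by linarith)

/-- The base case of all inductions: a half-open parallelepiped whose lattice translates tile space
without overlaps. -/
lemma spline_baseMult (i : Fin (n + 1)) (x : Fin n → ℝ) :
    spline (baseMult i) x = ∏ j, indicator (Ico (0 : ℝ) 1) 1 (coordEquiv ℝ i x j) := by
  change _ = ∏ j, indicator (Ico (0 : ℝ) 1) 1 (toCoord i x j)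
  induction i using Fin.lastCases with
  | last =>
    rw [spline_of_last (by simp [baseMult]), toCoord_last]
    refine Finset.prod_congr rfl fun j _ => ?_
    simp [baseMult, (Fin.castSucc_lt_last j).ne, cardinalBSpline]
  | cast l =>
    rw [spline_of_castSucc (hasOrder_baseMult _) (i := l) (by simp [baseMult]), toCoord_castSucc,
      ← Finset.mul_prod_erase _ _ (Finset.mem_univ l)]
    congr 1
    · simp [baseMult, (Fin.castSucc_lt_last l).ne', cardinalBSpline]
    · refine Finset.prod_congr rfl fun j hj => ?_
      simp [baseMult, Finset.ne_of_mem_erase hj, cardinalBSpline]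

/-! ### Basic properties of the splines -/

lemma measurable_spline [NeZero n] {d : Fin (n + 1) → ℕ} (hd : HasOrder d 1) :
    Measurable (spline d) := by
  induction d, hd using HasOrder.induction with
  | base i =>
    rw [funext (spline_baseMult i)]
    refine Finset.measurable_prod _ fun j _ => ?_
    refine (measurable_one.indicator measurableSet_Ico).comp ?_
    exact (measurable_pi_apply j).comp
      (coordEquiv ℝ i).toLinearMap.continuous_of_finiteDimensional.measurable
  | step d i hd ih =>
    rw [funext (spline_add_single hd i)]
    refine measurable_unitIntegral
      (f := fun x t => spline d (x - t • boxDirection n i)) ?_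
    exact ih.comp (by fun_prop)

lemma spline_mem_Icc [NeZero n] {d : Fin (n + 1) → ℕ} (hd : HasOrder d 1) (x : Fin n → ℝ) :
    spline d x ∈ Icc (0 : ℝ) 1 := by
  induction d, hd using HasOrder.induction generalizing x with
  | base i =>
    rw [spline_baseMult i]
    refine prod_mem_Icc _ fun j => ?_
    by_cases h : coordEquiv ℝ i x j ∈ Ico (0 : ℝ) 1 <;> simp [h]
  | step d i hd ih =>
    rw [spline_add_single hd i]
    exact unitIntegral_mem_Icc fun t => ih _

lemma norm_boxDirection_le (i : Fin (n + 1)) : ‖boxDirection n i‖ ≤ 1 := by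
  rw [pi_norm_le_iff_of_nonneg zero_le_one]
  intro l
  induction i using Fin.lastCases with
  | last => simp [boxDirection_last]
  | cast j =>
    by_cases h : l = j
    · subst h; simp [boxDirection_castSucc]
    · simp [boxDirection_castSucc, h]

/-- A bound for the size of the support of `spline d`. -/
def splineRadius (d : Fin (n + 1) → ℕ) : ℕ := 2 + ∑ i, d i

lemma splineRadius_add_single (d : Fin (n + 1) → ℕ) (i : Fin (n + 1)) :
    splineRadius (d + Pi.single i 1) = splineRadius d + 1 := by
  simp [splineRadius, Finset.sum_add_distrib, add_assoc]

lemma spline_eq_zero [NeZero n] {d : Fin (n + 1) → ℕ} (hd : HasOrder d 1) {x : Fin n → ℝ}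
    (hx : splineRadius d < ‖x‖) : spline d x = 0 := by
  induction d, hd using HasOrder.induction generalizing x with
  | base i =>
    rw [spline_baseMult i]
    by_contra h
    have h := Finset.prod_ne_zero_iff.1 h
    have h1 : ‖coordEquiv ℝ i x‖ ≤ 1 := by
      rw [pi_norm_le_iff_of_nonneg zero_le_one]
      intro j
      have h2 := mem_of_indicator_ne_zero (h j (Finset.mem_univ j))
      rw [Real.norm_eq_abs, abs_le]
      constructor <;> linarith [h2.1, h2.2]
    have h2 := norm_coordEquiv_symm_le i (coordEquiv ℝ i x)
    rw [LinearEquiv.symm_apply_apply] at h2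
    -- The summand `2` of `splineRadius` is the bound for the inverse change of coordinates.
    have h3 : (2 : ℝ) ≤ splineRadius (baseMult i) := by
      simp only [splineRadius]; push_cast
      have : (0 : ℝ) ≤ ∑ j, ((baseMult i j : ℕ) : ℝ) := Finset.sum_nonneg fun _ _ => by positivity
      linarith
    linarith
  | step d i hd ih =>
    rw [spline_add_single hd i, intervalIntegral.integral_congr (g := fun _ => (0 : ℝ))]
    · simp
    · intro t ht
      rw [uIcc_of_le zero_le_one] at ht
      apply ih
      rw [splineRadius_add_single] at hx
      push_cast at hx
      have h1 : ‖t • boxDirection n i‖ ≤ 1 := by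
        rw [norm_smul, Real.norm_eq_abs, abs_of_nonneg ht.1]
        exact mul_le_one₀ ht.2 (norm_nonneg _) (norm_boxDirection_le i)
      have h2 := norm_sub_norm_le x (t • boxDirection n i)
      linarith

/-! ### Series of integer shifts of a spline -/

/-- The series `∑_ν b(ν) spline d (x - ν)`. -/
def splineSeries (d : Fin (n + 1) → ℕ) (b : (Fin n → ℤ) → ℂ) (x : Fin n → ℝ) : ℂ :=
  ∑' ν, b ν * (spline d (x - latticePoint ν) : ℂ)

lemma spline_sub_latticePoint_eq_zero [NeZero n] {d : Fin (n + 1) → ℕ} (hd : HasOrder d 1)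
    {x : Fin n → ℝ} {M : ℕ} (hM : ‖x‖ + splineRadius d ≤ M) {ν : Fin n → ℤ}
    (hν : ν ∉ latticeBox n M) : spline d (x - latticePoint ν) = 0 := by
  apply spline_eq_zero hd
  by_contra h
  push Not at h
  apply hν
  apply mem_latticeBox_of_norm_le
  have := norm_sub_norm_le (latticePoint ν) x
  rw [norm_sub_rev] at this
  linarith

/-- One finite index set works for all points of a ball, so the coefficients may be arbitrary and no
summability is needed. -/
lemma splineSeries_eq_sum [NeZero n] {d : Fin (n + 1) → ℕ} (hd : HasOrder d 1)
    (b : (Fin n → ℤ) → ℂ) {x : Fin n → ℝ} {M : ℕ} (hM : ‖x‖ + splineRadius d ≤ M) :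
    splineSeries d b x = ∑ ν ∈ latticeBox n M, b ν * (spline d (x - latticePoint ν) : ℂ) := by
  apply tsum_eq_sum
  intro ν hν
  rw [spline_sub_latticePoint_eq_zero hd hM hν]
  simp

lemma splineSeries_shift (d : Fin (n + 1) → ℕ) (b : (Fin n → ℤ) → ℂ) (x : Fin n → ℝ)
    (μ : Fin n → ℤ) :
    splineSeries d b (x - latticePoint μ) = splineSeries d (fun ν => b (ν - μ)) x := by
  unfold splineSeries
  rw [← (Equiv.subRight μ).tsum_eq]
  refine tsum_congr fun ν => ?_
  rw [Equiv.subRight_apply, latticePoint_sub, show x - latticePoint μ -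
    (latticePoint ν - latticePoint μ) = x - latticePoint ν by abel]

lemma splineSeries_const_mul (d : Fin (n + 1) → ℕ) (c : ℂ)
    (b : (Fin n → ℤ) → ℂ) (x : Fin n → ℝ) :
    splineSeries d (fun ν => c * b ν) x = c * splineSeries d b x := by
  simp_rw [splineSeries, mul_assoc, tsum_mul_left]

lemma splineSeries_sub [NeZero n] {d : Fin (n + 1) → ℕ} (hd : HasOrder d 1)
    (b b' : (Fin n → ℤ) → ℂ) (x : Fin n → ℝ) :
    splineSeries d (fun ν => b ν - b' ν) x = splineSeries d b x - splineSeries d b' x := by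
  obtain ⟨M, hM⟩ := exists_nat_ge (‖x‖ + splineRadius d)
  simp_rw [splineSeries_eq_sum hd _ hM, sub_mul, Finset.sum_sub_distrib]

lemma splineSeries_sum [NeZero n] {d : Fin (n + 1) → ℕ} (hd : HasOrder d 1) {ι : Type*}
    (s : Finset ι) (b : ι → (Fin n → ℤ) → ℂ) (x : Fin n → ℝ) :
    splineSeries d (fun ν => ∑ i ∈ s, b i ν) x = ∑ i ∈ s, splineSeries d (b i) x := by
  obtain ⟨M, hM⟩ := exists_nat_ge (‖x‖ + splineRadius d)
  simp_rw [splineSeries_eq_sum hd _ hM, Finset.sum_mul]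
  exact Finset.sum_comm

lemma measurable_splineSeries [NeZero n] {d : Fin (n + 1) → ℕ} (hd : HasOrder d 1)
    (b : (Fin n → ℤ) → ℂ) : Measurable (splineSeries d b) := by
  apply Measurable.tsum
  intro ν
  refine measurable_const.mul (Complex.measurable_ofReal.comp ((measurable_spline hd).comp ?_))
  exact measurable_id.sub_const _

lemma norm_spline_le_one [NeZero n] {d : Fin (n + 1) → ℕ} (hd : HasOrder d 1) (x : Fin n → ℝ) :
    ‖(spline d x : ℂ)‖ ≤ 1 := by
  rw [Complex.norm_real, Real.norm_eq_abs, abs_of_nonneg (spline_mem_Icc hd x).1]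
  exact (spline_mem_Icc hd x).2

lemma intervalIntegrable_spline [NeZero n] {d : Fin (n + 1) → ℕ} (hd : HasOrder d 1)
    {g : ℝ → Fin n → ℝ} (hg : Measurable g) (a b : ℝ) :
    IntervalIntegrable (fun t => (spline d (g t) : ℂ)) volume a b := by
  have := intervalIntegrable_of_mem_Icc ((measurable_spline hd).comp hg)
    (fun t => spline_mem_Icc hd (g t)) a b
  exact ⟨this.1.ofReal, this.2.ofReal⟩

lemma splineSeries_line_eq_sum [NeZero n] {d : Fin (n + 1) → ℕ} (hd : HasOrder d 1)
    (b : (Fin n → ℤ) → ℂ) (x v : Fin n → ℝ) (r : ℝ) :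
    ∃ M : ℕ, ∀ t, |t| ≤ r → splineSeries d b (x + t • v) =
      ∑ ν ∈ latticeBox n M, b ν * (spline d (x + t • v - latticePoint ν) : ℂ) := by
  obtain ⟨M, hM⟩ := exists_nat_ge (‖x‖ + r * ‖v‖ + splineRadius d)
  refine ⟨M, fun t ht => splineSeries_eq_sum hd b ?_⟩
  have h1 := norm_add_le x (t • v)
  rw [norm_smul, Real.norm_eq_abs] at h1
  have h2 := mul_le_mul_of_nonneg_right ht (norm_nonneg v)
  linarith

lemma intervalIntegrable_splineSeries [NeZero n] {d : Fin (n + 1) → ℕ} (hd : HasOrder d 1)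
    (b : (Fin n → ℤ) → ℂ) (x v : Fin n → ℝ) (a c : ℝ) :
    IntervalIntegrable (fun t : ℝ => splineSeries d b (x + t • v)) volume a c := by
  obtain ⟨M, hM⟩ := splineSeries_line_eq_sum hd b x v (|a| + |c|)
  have h : IntervalIntegrable (fun t : ℝ => ∑ ν ∈ latticeBox n M,
      b ν * (spline d (x + t • v - latticePoint ν) : ℂ)) volume a c := by
    have := IntervalIntegrable.sum (latticeBox n M) (μ := volume) (a := a) (b := c)
      (f := fun ν (t : ℝ) => b ν * (spline d (x + t • v - latticePoint ν) : ℂ)) ?_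
    · exact this.congr fun t _ => by simp only [Finset.sum_apply]
    intro ν _
    exact (intervalIntegrable_spline hd (by fun_prop) a c).const_mul _
  refine h.congr_uIoo fun t ht => (hM t ?_).symm
  rcases le_total a c with h' | h'
  · rw [uIoo_of_le h'] at ht
    rw [abs_le]
    have := neg_abs_le a; have := le_abs_self c
    have := abs_nonneg a; have := abs_nonneg c
    constructor <;> linarith [ht.1, ht.2]
  · rw [uIoo_of_ge h'] at ht
    rw [abs_le]
    have := neg_abs_le c; have := le_abs_self a
    have := abs_nonneg a; have := abs_nonneg c
    constructor <;> linarith [ht.1, ht.2]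

/-- The recursion passes to series term by term and leaves the coefficients alone. Partition of
unity, refinement and differentiation of series all rest on this. -/
lemma unitIntegral_splineSeries [NeZero n] {d : Fin (n + 1) → ℕ} (hd : HasOrder d 1)
    (i : Fin (n + 1)) (b : (Fin n → ℤ) → ℂ) (x : Fin n → ℝ) :
    ∫ t in (0 : ℝ)..1, splineSeries d b (x - t • boxDirection n i) =
      splineSeries (d + Pi.single i 1) b x := by
  have hd' : HasOrder (d + Pi.single i 1) 1 := hd.mono le_self_add
  obtain ⟨M, hM⟩ := exists_nat_ge (‖x‖ + 1 + splineRadius d)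
  have hM' : ‖x‖ + splineRadius (d + Pi.single i 1) ≤ M := by
    rw [splineRadius_add_single]; push_cast; linarith
  rw [splineSeries_eq_sum hd' b hM']
  have h1 : ∀ t ∈ uIcc (0 : ℝ) 1, splineSeries d b (x - t • boxDirection n i) =
      ∑ ν ∈ latticeBox n M, b ν *
        (spline d (x - latticePoint ν - t • boxDirection n i) : ℂ) := by
    intro t ht
    rw [uIcc_of_le zero_le_one] at ht
    have h1 : ‖t • boxDirection n i‖ ≤ 1 := by
      rw [norm_smul, Real.norm_eq_abs, abs_of_nonneg ht.1]
      exact mul_le_one₀ ht.2 (norm_nonneg _) (norm_boxDirection_le i)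
    rw [splineSeries_eq_sum hd b (M := M) (by linarith [norm_sub_le x (t • boxDirection n i)])]
    simp_rw [sub_right_comm x]
  rw [intervalIntegral.integral_congr h1, intervalIntegral.integral_finsetSum]
  · refine Finset.sum_congr rfl fun ν _ => ?_
    rw [intervalIntegral.integral_const_mul, intervalIntegral.integral_ofReal,
      spline_add_single hd]
  · intro ν _
    exact (intervalIntegrable_spline hd (by fun_prop) 0 1).const_mul _

/-! ### Partition of unity -/

/-- Each point lies in exactly one translate of the half-open parallelepiped, and averaging
preserves the constant one. -/
lemma splineSeries_one [NeZero n] {d : Fin (n + 1) → ℕ} (hd : HasOrder d 1) (x : Fin n → ℝ) :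
    splineSeries d (fun _ => 1) x = 1 := by
  induction d, hd using HasOrder.induction generalizing x with
  | base i =>
    unfold splineSeries
    simp_rw [one_mul, spline_baseMult, map_sub, coordEquiv_latticePoint]
    rw [← (coordEquiv ℤ i).symm.toEquiv.tsum_eq]
    set y := coordEquiv ℝ i x
    rw [tsum_eq_single (fun j => ⌊y j⌋)]
    · simp [indicator, Int.fract_nonneg, Int.fract_lt_one]
    · intro ν hν
      rw [Complex.ofReal_eq_zero]
      obtain ⟨j, hj⟩ := Function.ne_iff.1 hν
      refine Finset.prod_eq_zero (Finset.mem_univ j) ?_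
      apply indicator_of_notMem
      intro h
      apply hj
      simp only [LinearEquiv.coe_toEquiv, LinearEquiv.apply_symm_apply, Pi.sub_apply,
        latticePoint_apply, mem_Ico] at h
      symm
      rw [Int.floor_eq_iff]
      constructor <;> linarith [h.1, h.2]
  | step d i hd ih =>
    rw [← unitIntegral_splineSeries hd]
    simp [ih]

/-! ### The refinement equation -/

/-- The algebra of finitely supported sequences on the lattice, with convolution. -/
abbrev LatticeAlgebra (n : ℕ) := AddMonoidAlgebra ℂ (Fin n → ℤ)

/-- The mean of `N` consecutive shifts in the `i`-th direction. -/
def meanMask (N : ℕ) (i : Fin (n + 1)) : LatticeAlgebra n :=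
  (N : ℂ)⁻¹ • ∑ s ∈ Finset.range N, AddMonoidAlgebra.single (s • latticeDirection n i) 1

/-- The mask of the refinement equation for the dilation factor `N`. -/
def splineMask (N : ℕ) (d : Fin (n + 1) → ℕ) : LatticeAlgebra n :=
  (N : ℂ) ^ n • ∏ i, meanMask N i ^ d i

lemma splineMask_add_single (N : ℕ) (d : Fin (n + 1) → ℕ) (i : Fin (n + 1)) :
    splineMask N (d + Pi.single i 1) = meanMask N i * splineMask N d := by
  have h : ∏ j, meanMask N j ^ (d + Pi.single i 1 : Fin (n + 1) → ℕ) j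
      = meanMask N i * ∏ j, meanMask N j ^ d j := by
    simp_rw [Pi.add_apply, pow_add, Finset.prod_mul_distrib]
    rw [mul_comm]
    congr 1
    rw [Finset.prod_eq_single i]
    · simp
    · intro j _ hj; simp [hj]
    · simp
  rw [splineMask, h, splineMask, mul_smul_comm]

lemma prod_baseIndex (i : Fin (n + 1)) {R : Type*} [CommMonoid R] (f : Fin (n + 1) → R) :
    ∏ j, f (baseIndex i j) = ∏ l ∈ Finset.univ.erase i, f l := by
  refine Finset.prod_bij (fun j _ => baseIndex i j) ?_ ?_ ?_ ?_
  · intro j _; simp [baseIndex_ne]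
  · intro a _ b _ h
    unfold baseIndex at h
    split_ifs at h with h1 h2 h2
    · exact Fin.castSucc_injective n (h1.trans h2.symm)
    · exact absurd h.symm (Fin.castSucc_lt_last b).ne
    · exact absurd h (Fin.castSucc_lt_last a).ne
    · exact Fin.castSucc_injective n h
  · intro l hl
    have hl' : l ≠ i := Finset.ne_of_mem_erase hl
    induction l using Fin.lastCases with
    | last =>
      induction i using Fin.lastCases with
      | last => exact absurd rfl hl'
      | cast j => exact ⟨j, Finset.mem_univ _, by simp [baseIndex]⟩
    | cast j => exact ⟨j, Finset.mem_univ _, by simp [baseIndex, hl']⟩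
  · intros; rfl

/-- The factor `N ^ n` cancels the normalization of the `n` means. What remains is the subdivision
of the parallelepiped into `N ^ n` copies scaled by `1 / N`. -/
lemma splineMask_baseMult {N : ℕ} (hN : N ≠ 0) (i : Fin (n + 1)) :
    splineMask N (baseMult i) = ∑ s ∈ Fintype.piFinset (fun _ : Fin n => Finset.range N),
      AddMonoidAlgebra.single ((coordEquiv ℤ i).symm (fun j => (s j : ℤ))) 1 := by
  have h1 : ∏ l, meanMask N l ^ baseMult i l = ∏ j, meanMask N (baseIndex i j) := by
    rw [prod_baseIndex, ← Finset.mul_prod_erase _ _ (Finset.mem_univ i)]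
    simp only [baseMult, if_true, pow_zero, one_mul]
    refine Finset.prod_congr rfl fun l hl => ?_
    simp [Finset.ne_of_mem_erase hl]
  rw [splineMask, h1]
  simp_rw [meanMask]
  rw [Finset.prod_smul, Finset.prod_const, Finset.card_univ, Fintype.card_fin, smul_smul,
    ← mul_pow, mul_inv_cancel₀ (by exact_mod_cast hN), one_pow, one_smul, Finset.prod_univ_sum]
  refine Finset.sum_congr rfl fun s _ => ?_
  rw [AddMonoidAlgebra.prod_single]
  congr 1
  · have : (fun j => (s j : ℤ)) = ∑ j, s j • (Pi.single j (1 : ℤ) : Fin n → ℤ) := by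
      ext l
      simp [Finset.sum_apply, Pi.single_apply]
    rw [this, map_sum]
    exact Finset.sum_congr rfl fun j _ => by rw [map_nsmul, coordEquiv_symm_single]
  · simp

lemma splineSeries_coeff_single (d : Fin (n + 1) → ℕ) (μ : Fin n → ℤ) (x : Fin n → ℝ) :
    splineSeries d (AddMonoidAlgebra.single μ (1 : ℂ)).coeff x
      = (spline d (x - latticePoint μ) : ℂ) := by
  unfold splineSeries
  rw [tsum_eq_single μ]
  · simp
  · intro ν hν
    simp [hν.symm]

lemma indicator_Ico_refine {N : ℕ} (hN : N ≠ 0) (y : ℝ) :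
    (indicator (Ico (0 : ℝ) 1) 1 y : ℝ) =
      ∑ s ∈ Finset.range N, indicator (Ico (0 : ℝ) 1) (1 : ℝ → ℝ) (N * y - s) := by
  have hN' : (0 : ℝ) < N := by positivity
  by_cases hy : y ∈ Ico (0 : ℝ) 1
  · rw [indicator_of_mem hy]
    have hfl : (0 : ℝ) ≤ N * y := mul_nonneg hN'.le hy.1
    rw [Finset.sum_eq_single ⌊N * y⌋₊]
    · rw [indicator_of_mem]
      · rfl
      · constructor
        · linarith [Nat.floor_le hfl]
        · linarith [Nat.lt_floor_add_one (N * y)]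
    · intro s _ hs
      apply indicator_of_notMem
      intro h
      apply hs
      symm
      rw [Nat.floor_eq_iff hfl]
      constructor <;> linarith [h.1, h.2]
    · intro h
      exfalso
      apply h
      rw [Finset.mem_range, Nat.floor_lt hfl]
      nlinarith [hy.2]
  · rw [indicator_of_notMem hy, Finset.sum_eq_zero]
    intro s hs
    apply indicator_of_notMem
    intro h
    apply hy
    rw [Finset.mem_range] at hs
    have hs' : (s : ℝ) + 1 ≤ N := by exact_mod_cast hs
    have hs0 : (0 : ℝ) ≤ s := by positivity
    constructor
    · by_contra h'
      push Not at h'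
      nlinarith [h.1]
    · by_contra h'
      push Not at h'
      nlinarith [h.2]

lemma coeff_meanMask_mul (N : ℕ) (i : Fin (n + 1)) (a : LatticeAlgebra n) (ν : Fin n → ℤ) :
    (meanMask N i * a).coeff ν =
      (N : ℂ)⁻¹ * ∑ s ∈ Finset.range N, a.coeff (ν - s • latticeDirection n i) := by
  rw [meanMask, smul_mul_assoc, Finset.sum_mul, AddMonoidAlgebra.coeff_smul,
    AddMonoidAlgebra.coeff_sum, Finsupp.smul_apply, Finsupp.finsetSum_apply, smul_eq_mul]
  congr 1
  refine Finset.sum_congr rfl fun s _ => ?_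
  rw [AddMonoidAlgebra.coeff_single_mul_apply, one_mul, neg_add_eq_sub]

/-- The refinement equation with dilation factor `N`. -/
lemma spline_refinement [NeZero n] {d : Fin (n + 1) → ℕ} (hd : HasOrder d 1) {N : ℕ}
    (hN : N ≠ 0) (x : Fin n → ℝ) :
    (spline d x : ℂ) = splineSeries d (splineMask N d).coeff ((N : ℝ) • x) := by
  induction d, hd using HasOrder.induction generalizing x with
  | base i =>
    rw [splineMask_baseMult hN, AddMonoidAlgebra.coeff_sum]
    have h0 : splineSeries (baseMult i) (⇑(∑ s ∈ Fintype.piFinset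
        (fun _ : Fin n => Finset.range N), (AddMonoidAlgebra.single
          ((coordEquiv ℤ i).symm (fun j => (s j : ℤ))) (1 : ℂ)).coeff)) ((N : ℝ) • x) =
        splineSeries (baseMult i) (fun ν => ∑ s ∈ Fintype.piFinset
        (fun _ : Fin n => Finset.range N), (AddMonoidAlgebra.single
          ((coordEquiv ℤ i).symm (fun j => (s j : ℤ))) (1 : ℂ)).coeff ν) ((N : ℝ) • x) := by
      congr 1
      ext ν
      rw [Finsupp.finsetSum_apply]
    rw [h0, splineSeries_sum (hasOrder_baseMult i)]
    simp_rw [splineSeries_coeff_single, spline_baseMult, map_sub, latticePoint_coordEquiv_symm,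
      LinearEquiv.apply_symm_apply, map_smul]
    simp_rw [indicator_Ico_refine hN (coordEquiv ℝ i x _)]
    rw [Finset.prod_univ_sum]
    push_cast
    rfl
  | step d i hd ih =>
    have hN' : (N : ℝ) ≠ 0 := by exact_mod_cast hN
    have hd' : HasOrder (d + Pi.single i 1) 1 := hd.mono le_self_add
    rw [spline_add_single hd, ← intervalIntegral.integral_ofReal, splineMask_add_single]
    simp_rw [ih]
    set a := splineMask N d
    -- After `u = N t`, the average over a unit segment is the mean of the integrals over `N`
    -- consecutive unit intervals. Each of them raises the order and shifts the coefficients, and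
    -- the mean of these shifts is multiplication by `meanMask N i`.
    have h1 : ∀ t : ℝ, splineSeries d a.coeff ((N : ℝ) • (x - t • boxDirection n i)) =
        (fun u => splineSeries d a.coeff ((N : ℝ) • x + u • -boxDirection n i)) (N * t) := by
      intro t
      dsimp only
      congr 1
      rw [smul_sub, smul_smul, smul_neg, sub_eq_add_neg]
    simp_rw [h1]
    rw [intervalIntegral.integral_comp_mul_left (f := fun u =>
      splineSeries d a.coeff ((N : ℝ) • x + u • -boxDirection n i)) hN', mul_zero, mul_one]
    have h2 := intervalIntegral.sum_integral_adjacent_intervals (n := N)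
      (a := fun k => (k : ℝ)) (μ := volume)
      (f := fun u => splineSeries d a.coeff ((N : ℝ) • x + u • -boxDirection n i))
      (fun k _ => intervalIntegrable_splineSeries hd _ _ _ _ _)
    simp only [Nat.cast_zero] at h2
    rw [← h2]
    have h3 : ∀ s : ℕ, ∫ u in (s : ℝ)..((s + 1 : ℕ) : ℝ),
        splineSeries d a.coeff ((N : ℝ) • x + u • -boxDirection n i) =
        splineSeries (d + Pi.single i 1)
          (fun ν => a.coeff (ν - s • latticeDirection n i)) ((N : ℝ) • x) := by
      intro s
      rw [← splineSeries_shift, ← unitIntegral_splineSeries hd]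
      have h4 := intervalIntegral.integral_comp_add_right (a := 0) (b := 1) (f := fun u =>
        splineSeries d a.coeff ((N : ℝ) • x + u • -boxDirection n i)) (s : ℝ)
      rw [zero_add, add_comm (1 : ℝ)] at h4
      push_cast
      rw [← h4]
      refine intervalIntegral.integral_congr fun t _ => ?_
      congr 1
      have : latticePoint (s • latticeDirection n i) = (s : ℝ) • boxDirection n i := by
        rw [← latticePoint_direction]; ext; simp
      rw [this, add_smul, smul_neg, smul_neg]
      abel
    simp_rw [h3]
    rw [← splineSeries_sum hd']
    have h5 : (⇑(meanMask N i * a).coeff) = fun ν => (N : ℂ)⁻¹ *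
        ∑ s ∈ Finset.range N, a.coeff (ν - s • latticeDirection n i) :=
      funext fun ν => coeff_meanMask_mul N i a ν
    rw [h5, splineSeries_const_mul, Complex.real_smul]
    push_cast
    rfl

/-! ### Norms of differences of the refinement mask -/

/-- The `ℓ^p` norm of a finitely supported sequence. -/
def maskNorm (p : ℝ≥0∞) (a : LatticeAlgebra n) : ℝ≥0∞ :=
  eLpNorm (fun ν => a.coeff ν) p Measure.count

lemma maskNorm_add_le {p : ℝ≥0∞} (hp : 1 ≤ p) (a b : LatticeAlgebra n) :
    maskNorm p (a + b) ≤ maskNorm p a + maskNorm p b := by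
  have := eLpNorm_add_le (μ := Measure.count) (f := fun ν => a.coeff ν) (g := fun ν => b.coeff ν)
    AEStronglyMeasurable.of_discrete AEStronglyMeasurable.of_discrete hp
  refine le_trans (le_of_eq ?_) this
  rfl

lemma maskNorm_smul (p : ℝ≥0∞) (c : ℂ) (a : LatticeAlgebra n) :
    maskNorm p (c • a) = ‖c‖ₑ * maskNorm p a := by
  have := eLpNorm_const_smul c (fun ν => a.coeff ν) p (Measure.count : Measure (Fin n → ℤ))
  rw [maskNorm, maskNorm, ← this]
  rfl

lemma maskNorm_neg (p : ℝ≥0∞) (a : LatticeAlgebra n) : maskNorm p (-a) = maskNorm p a := by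
  have := maskNorm_smul p (-1) a
  simpa using this

lemma maskNorm_sub_le {p : ℝ≥0∞} (hp : 1 ≤ p) (a b : LatticeAlgebra n) :
    maskNorm p (a - b) ≤ maskNorm p a + maskNorm p b := by
  rw [sub_eq_add_neg, ← maskNorm_neg p b]
  exact maskNorm_add_le hp a (-b)

lemma maskNorm_zero (p : ℝ≥0∞) : maskNorm p (0 : LatticeAlgebra n) = 0 := by
  have := maskNorm_smul p 0 (0 : LatticeAlgebra n)
  simpa using this

lemma maskNorm_sum_le {p : ℝ≥0∞} (hp : 1 ≤ p) {ι : Type*} (s : Finset ι)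
    (f : ι → LatticeAlgebra n) : maskNorm p (∑ i ∈ s, f i) ≤ ∑ i ∈ s, maskNorm p (f i) := by
  classical
  induction s using Finset.induction_on with
  | empty => simp [maskNorm_zero]
  | insert i s hi ih =>
    rw [Finset.sum_insert hi, Finset.sum_insert hi]
    exact (maskNorm_add_le hp _ _).trans (add_le_add le_rfl ih)

lemma maskNorm_single_mul (p : ℝ≥0∞) (μ : Fin n → ℤ) (a : LatticeAlgebra n) :
    maskNorm p (AddMonoidAlgebra.single μ 1 * a) = maskNorm p a := by
  have := eLpNorm_comp_measurePreserving (p := p) (g := fun ν => a.coeff ν)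
    AEStronglyMeasurable.of_discrete
    (measurePreserving_add_left (Measure.count : Measure (Fin n → ℤ)) (-μ))
  rw [maskNorm, maskNorm, ← this]
  congr 1
  ext ν
  simp

/-- The difference operator with step `μ`, as an element of the convolution algebra. -/
def diffMask (μ : Fin n → ℤ) : LatticeAlgebra n := 1 - AddMonoidAlgebra.single μ 1

lemma maskNorm_diffMask_mul_le {p : ℝ≥0∞} (hp : 1 ≤ p) (μ : Fin n → ℤ) (a : LatticeAlgebra n) :
    maskNorm p (diffMask μ * a) ≤ 2 * maskNorm p a := by
  rw [diffMask, sub_mul, one_mul, two_mul]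
  refine (maskNorm_sub_le hp _ _).trans ?_
  rw [maskNorm_single_mul]

/-- In multiplicative notation, `1 - z^{μ+ν} = (1 - z^μ) + z^μ (1 - z^ν)`. -/
lemma maskNorm_diffMask_add_le {p : ℝ≥0∞} (hp : 1 ≤ p) (μ ν : Fin n → ℤ) (a : LatticeAlgebra n) :
    maskNorm p (diffMask (μ + ν) * a) ≤
      maskNorm p (diffMask μ * a) + maskNorm p (diffMask ν * a) := by
  have h : diffMask (μ + ν) * a =
      diffMask μ * a + AddMonoidAlgebra.single μ 1 * (diffMask ν * a) := by
    have : (AddMonoidAlgebra.single (μ + ν) 1 : LatticeAlgebra n) =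
        AddMonoidAlgebra.single μ 1 * AddMonoidAlgebra.single ν 1 := by
      rw [AddMonoidAlgebra.single_mul_single, one_mul]
    rw [diffMask, this, diffMask, diffMask]
    ring
  rw [h]
  refine (maskNorm_add_le hp _ _).trans ?_
  rw [maskNorm_single_mul]

lemma diffMask_zero : diffMask (0 : Fin n → ℤ) = 0 := by
  rw [diffMask, AddMonoidAlgebra.one_def, sub_self]

lemma maskNorm_diffMask_neg (p : ℝ≥0∞) (μ : Fin n → ℤ) (a : LatticeAlgebra n) :
    maskNorm p (diffMask (-μ) * a) = maskNorm p (diffMask μ * a) := by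
  have h : diffMask μ * a = -(AddMonoidAlgebra.single μ 1 * (diffMask (-μ) * a)) := by
    have : (AddMonoidAlgebra.single μ 1 : LatticeAlgebra n) * AddMonoidAlgebra.single (-μ) 1
        = 1 := by
      rw [AddMonoidAlgebra.single_mul_single, one_mul, add_neg_cancel, AddMonoidAlgebra.one_def]
    rw [diffMask, diffMask, ← mul_assoc, mul_sub, this]
    ring
  rw [h, maskNorm_neg, maskNorm_single_mul]

lemma maskNorm_diffMask_sum_le {p : ℝ≥0∞} (hp : 1 ≤ p) {ι : Type*} (s : Finset ι)
    (f : ι → Fin n → ℤ) (a : LatticeAlgebra n) :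
    maskNorm p (diffMask (∑ i ∈ s, f i) * a) ≤ ∑ i ∈ s, maskNorm p (diffMask (f i) * a) := by
  classical
  induction s using Finset.induction_on with
  | empty => simp [diffMask_zero, maskNorm_zero]
  | insert i s hi ih =>
    rw [Finset.sum_insert hi, Finset.sum_insert hi]
    exact (maskNorm_diffMask_add_le hp _ _ _).trans (add_le_add le_rfl ih)

lemma sum_latticeDirection : ∑ j : Fin n, latticeDirection n j.castSucc =
    latticeDirection n (Fin.last n) := by
  ext l
  simp [latticeDirection_last, latticeDirection_castSucc, Finset.sum_apply, Pi.single_apply]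

/-- Differences in one direction are controlled by the differences in all others. -/
lemma maskNorm_diffMask_direction_le {p : ℝ≥0∞} (hp : 1 ≤ p) (i : Fin (n + 1))
    (a : LatticeAlgebra n) : maskNorm p (diffMask (latticeDirection n i) * a) ≤
      ∑ l ∈ Finset.univ.erase i, maskNorm p (diffMask (latticeDirection n l) * a) := by
  induction i using Fin.lastCases with
  | last =>
    rw [← sum_latticeDirection]
    refine (maskNorm_diffMask_sum_le hp _ _ _).trans (le_of_eq ?_)
    have h1 := Fin.sum_univ_castSucc fun l => maskNorm p (diffMask (latticeDirection n l) * a)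
    refine Finset.sum_bij (fun j _ => j.castSucc) ?_ ?_ ?_ ?_
    · intro j _; simp [(Fin.castSucc_lt_last j).ne]
    · intro a _ b _ h; exact Fin.castSucc_injective n h
    · intro l hl
      induction l using Fin.lastCases with
      | last => simp at hl
      | cast j => exact ⟨j, Finset.mem_univ _, rfl⟩
    · intros; rfl
  | cast j =>
    have h1 : latticeDirection n j.castSucc = latticeDirection n (Fin.last n) +
        -∑ l ∈ Finset.univ.erase j, latticeDirection n l.castSucc := by
      rw [← sum_latticeDirection, ← Finset.add_sum_erase _ _ (Finset.mem_univ j)]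
      abel
    conv_lhs => rw [h1]
    refine (maskNorm_diffMask_add_le hp _ _ _).trans ?_
    rw [maskNorm_diffMask_neg]
    have hmem : Fin.last n ∈ Finset.univ.erase j.castSucc := by
      simp [(Fin.castSucc_lt_last j).ne']
    rw [← Finset.add_sum_erase _ _ hmem]
    refine add_le_add le_rfl ((maskNorm_diffMask_sum_le hp _ _ _).trans (le_of_eq ?_))
    refine Finset.sum_bij (fun j _ => j.castSucc) ?_ ?_ ?_ ?_
    · intro l hl; simp [(Fin.castSucc_lt_last l).ne, Finset.ne_of_mem_erase hl]
    · intro a _ b _ h; exact Fin.castSucc_injective n h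
    · intro l hl
      induction l using Fin.lastCases with
      | last => simp at hl
      | cast l => exact ⟨l, by simpa [(Fin.castSucc_lt_last l).ne] using hl, rfl⟩
    · intros; rfl

lemma maskNorm_meanMask_mul_le {p : ℝ≥0∞} (hp : 1 ≤ p) {N : ℕ} (hN : N ≠ 0) (i : Fin (n + 1))
    (a : LatticeAlgebra n) : maskNorm p (meanMask N i * a) ≤ maskNorm p a := by
  rw [meanMask, smul_mul_assoc, maskNorm_smul, Finset.sum_mul]
  have h := maskNorm_sum_le hp (Finset.range N)
    fun s => AddMonoidAlgebra.single (s • latticeDirection n i) 1 * a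
  simp_rw [maskNorm_single_mul, Finset.sum_const, Finset.card_range, nsmul_eq_mul] at h
  refine (mul_le_mul_right h _).trans (le_of_eq ?_)
  rw [← mul_assoc, enorm_inv (by exact_mod_cast hN)]
  have : ‖(N : ℂ)‖ₑ = N := by
    rw [← ofReal_norm, Complex.norm_natCast, ENNReal.ofReal_natCast]
  rw [this, ENNReal.inv_mul_cancel (by exact_mod_cast hN) (by simp), one_mul]

/-- The geometric sum `(1 - z)(1 + z + ⋯ + z^{N-1}) = 1 - z^N`. All gains of `N⁻¹` come from this
identity. -/
lemma diffMask_mul_meanMask (N : ℕ) (i : Fin (n + 1)) :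
    diffMask (latticeDirection n i) * meanMask N i =
      (N : ℂ)⁻¹ • diffMask (N • latticeDirection n i) := by
  rw [meanMask, mul_smul_comm]
  congr 1
  set v := latticeDirection n i
  have hpow : ∀ s : ℕ, (AddMonoidAlgebra.single (s • v) 1 : LatticeAlgebra n) =
      AddMonoidAlgebra.single v 1 ^ s := by
    intro s
    rw [AddMonoidAlgebra.single_pow, one_pow]
  simp_rw [diffMask, hpow]
  exact mul_neg_geom_sum _ _

lemma maskNorm_diffMask_splineMask_le {p : ℝ≥0∞} (hp : 1 ≤ p) {N : ℕ} (hN : N ≠ 0)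
    (i : Fin (n + 1)) (d : Fin (n + 1) → ℕ) (b : LatticeAlgebra n) :
    maskNorm p (diffMask (latticeDirection n i) * (b * splineMask N (d + Pi.single i 1))) ≤
      2 * (N : ℝ≥0∞)⁻¹ * maskNorm p (b * splineMask N d) := by
  have h : diffMask (latticeDirection n i) * (b * splineMask N (d + Pi.single i 1)) =
      (N : ℂ)⁻¹ • (diffMask (N • latticeDirection n i) * (b * splineMask N d)) := by
    rw [splineMask_add_single, ← smul_mul_assoc, ← diffMask_mul_meanMask]
    ring
  rw [h, maskNorm_smul]
  refine (mul_le_mul_right (maskNorm_diffMask_mul_le hp _ _) _).trans (le_of_eq ?_)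
  rw [enorm_inv (by exact_mod_cast hN)]
  have : ‖(N : ℂ)‖ₑ = N := by
    rw [← ofReal_norm, Complex.norm_natCast, ENNReal.ofReal_natCast]
  rw [this]
  ring

/-- The product of the difference operators in the directions `w`. -/
def wordMask (w : List (Fin (n + 1))) : LatticeAlgebra n :=
  (w.map fun i => diffMask (latticeDirection n i)).prod

lemma wordMask_cons (i : Fin (n + 1)) (w : List (Fin (n + 1))) :
    wordMask (i :: w) = diffMask (latticeDirection n i) * wordMask w := by
  simp [wordMask]

lemma exists_eq_add_single {d : Fin (n + 1) → ℕ} {i : Fin (n + 1)} (h : d i ≠ 0) :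
    ∃ e : Fin (n + 1) → ℕ, d = e + Pi.single i 1 := by
  refine ⟨d - Pi.single i 1, ?_⟩
  ext l
  by_cases hl : l = i
  · subst hl; simp; omega
  · simp [hl]

/-- Each difference uses up a mean in its direction, which gains `N⁻¹` and costs one unit of order.
If the direction does not occur in `d`, the difference is estimated by those in the other
directions, all of which then occur. The number `e` is the order that must be left for the initial
bound `hB`: `0` in `ℓ^1` and `1` in `ℓ^∞`. -/
lemma maskNorm_wordMask_splineMask_le {p : ℝ≥0∞} (hp : 1 ≤ p) {N : ℕ} (hN : N ≠ 0) {e : ℕ}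
    {B : ℝ≥0∞} (hB : ∀ d : Fin (n + 1) → ℕ, HasOrder d e → maskNorm p (splineMask N d) ≤ B)
    (w : List (Fin (n + 1))) (d : Fin (n + 1) → ℕ) (hd : HasOrder d (e + w.length)) :
    maskNorm p (wordMask w * splineMask N d) ≤
      ((2 * (n + 1 : ℕ)) * (N : ℝ≥0∞)⁻¹) ^ w.length * B := by
  induction w generalizing d with
  | nil => simpa [wordMask] using hB d hd
  | cons i w ih =>
    rw [wordMask_cons, mul_assoc, List.length_cons, pow_succ']
    set K := ((2 * (n + 1 : ℕ)) * (N : ℝ≥0∞)⁻¹) ^ w.length * B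
    have h1 : ∀ l, d l ≠ 0 → maskNorm p (diffMask (latticeDirection n l) *
        (wordMask w * splineMask N d)) ≤ 2 * (N : ℝ≥0∞)⁻¹ * K := by
      intro l hl
      obtain ⟨d', rfl⟩ := exists_eq_add_single hl
      refine (maskNorm_diffMask_splineMask_le hp hN l d' _).trans ?_
      gcongr
      exact ih d' (HasOrder.of_add_single (by simpa [add_assoc] using hd))
    have h2 : ((2 * (n + 1 : ℕ)) * (N : ℝ≥0∞)⁻¹) * ((2 * (n + 1 : ℕ)) * (N : ℝ≥0∞)⁻¹) ^ w.length * B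
      = (n + 1 : ℕ) * (2 * (N : ℝ≥0∞)⁻¹ * K) := by ring
    rw [h2]
    by_cases hi : d i = 0
    · refine (maskNorm_diffMask_direction_le hp i _).trans ?_
      have h3 : ∀ l ∈ Finset.univ.erase i, maskNorm p (diffMask (latticeDirection n l) *
          (wordMask w * splineMask N d)) ≤ 2 * (N : ℝ≥0∞)⁻¹ * K := by
        intro l hl
        apply h1
        have := hd l i (Finset.ne_of_mem_erase hl)
        simp only [List.length_cons] at this
        omega
      refine (Finset.sum_le_sum h3).trans ?_
      rw [Finset.sum_const, nsmul_eq_mul]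
      gcongr
      refine (Finset.card_le_univ _).trans ?_
      simp
    · refine (h1 i hi).trans ?_
      refine le_mul_of_one_le_left zero_le ?_
      exact_mod_cast Nat.succ_pos n

lemma maskNorm_one_one : maskNorm 1 (1 : LatticeAlgebra n) = 1 := by
  rw [maskNorm, eLpNorm_one_eq_lintegral_enorm, lintegral_count, tsum_eq_single 0]
  · simp [AddMonoidAlgebra.one_def]
  · intro ν hν
    simp [AddMonoidAlgebra.one_def, hν.symm]

lemma maskNorm_one_splineMask_le {N : ℕ} (hN : N ≠ 0) (d : Fin (n + 1) → ℕ) :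
    maskNorm 1 (splineMask N d) ≤ (N : ℝ≥0∞) ^ n := by
  rw [splineMask, maskNorm_smul, enorm_pow]
  have : ‖(N : ℂ)‖ₑ = N := by
    rw [← ofReal_norm, Complex.norm_natCast, ENNReal.ofReal_natCast]
  rw [this]
  refine mul_le_of_le_one_right zero_le ?_
  have h : ∀ (i : Fin (n + 1)) (m : ℕ) (a : LatticeAlgebra n),
      maskNorm 1 (meanMask N i ^ m * a) ≤ maskNorm 1 a := by
    intro i m a
    induction m with
    | zero => simp
    | succ m ih =>
      rw [pow_succ', mul_assoc]
      exact (maskNorm_meanMask_mul_le le_rfl hN i _).trans ih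
  have h2 : ∀ s : Finset (Fin (n + 1)), maskNorm 1 (∏ i ∈ s, meanMask N i ^ d i) ≤ 1 := by
    intro s
    induction s using Finset.induction_on with
    | empty => simp [maskNorm_one_one]
    | insert i s hi ih =>
      rw [Finset.prod_insert hi]
      exact (h _ _ _).trans ih
  exact h2 _

/-- For a basis the coefficients are `0` or `1`, since the `N ^ n` shifts are distinct lattice
points. Further means do not increase the supremum. -/
lemma maskNorm_top_splineMask_le {N : ℕ} (hN : N ≠ 0) (d : Fin (n + 1) → ℕ)
    (hd : HasOrder d 1) : maskNorm ∞ (splineMask N d) ≤ 1 := by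
  induction d, hd using HasOrder.induction with
  | base i =>
    rw [splineMask_baseMult hN, maskNorm, eLpNorm_exponent_top]
    refine eLpNormEssSup_le_of_ae_enorm_bound (Filter.Eventually.of_forall fun ν => ?_)
    rw [AddMonoidAlgebra.coeff_sum, Finsupp.finsetSum_apply]
    simp_rw [AddMonoidAlgebra.coeff_single, Finsupp.single_apply]
    rw [Finset.sum_ite, Finset.sum_const_zero, add_zero, Finset.sum_const, nsmul_eq_mul, mul_one]
    have hc : (Finset.filter (fun s : Fin n → ℕ => (coordEquiv ℤ i).symm (fun j => (s j : ℤ)) = ν)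
        (Fintype.piFinset fun _ : Fin n => Finset.range N)).card ≤ 1 := by
      rw [Finset.card_le_one]
      intro s hs t ht
      rw [Finset.mem_filter] at hs ht
      have := (coordEquiv ℤ i).symm.injective (hs.2.trans ht.2.symm)
      ext j
      exact_mod_cast congrFun this j
    rw [← ofReal_norm, Complex.norm_natCast, ENNReal.ofReal_natCast]
    exact_mod_cast hc
  | step d i hd ih =>
    rw [splineMask_add_single]
    exact (maskNorm_meanMask_mul_le le_top hN i _).trans ih

lemma eLpNorm_interpolation {α : Type*} [MeasurableSpace α] {μ : Measure α} {f : α → ℂ}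
    {p : ℝ≥0∞} (hp : 1 ≤ p) (hf : AEStronglyMeasurable f μ) :
    eLpNorm f p μ ≤
      eLpNorm f 1 μ ^ (p⁻¹).toReal * eLpNorm f ∞ μ ^ (1 - (p⁻¹).toReal) := by
  rcases eq_or_ne p ∞ with rfl | hp'
  · simp
  have hp0 : p ≠ 0 := (zero_lt_one.trans_le hp).ne'
  have hpr : 1 ≤ p.toReal := by
    rw [← ENNReal.toReal_one]
    exact ENNReal.toReal_mono hp' hp
  rw [eLpNorm_eq_lintegral_rpow_enorm_toReal hp0 hp', ENNReal.toReal_inv,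
    eLpNorm_one_eq_lintegral_enorm, eLpNorm_exponent_top]
  set M := eLpNormEssSup f μ
  -- Almost everywhere `|f|^p ≤ |f| · M^{p-1}`, with `M` the essential supremum.
  have h1 : ∫⁻ x, ‖f x‖ₑ ^ p.toReal ∂μ ≤ (∫⁻ x, ‖f x‖ₑ ∂μ) * M ^ (p.toReal - 1) := by
    rw [← lintegral_mul_const'' _ hf.enorm]
    apply lintegral_mono_ae
    filter_upwards [ae_le_eLpNormEssSup (f := f) (μ := μ)] with x hx
    calc ‖f x‖ₑ ^ p.toReal = ‖f x‖ₑ ^ (1 : ℝ) * ‖f x‖ₑ ^ (p.toReal - 1) := by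
          rw [← ENNReal.rpow_add_of_nonneg _ _ zero_le_one (by linarith)]
          congr 1
          ring
      _ ≤ _ := by
          rw [ENNReal.rpow_one]
          gcongr
  calc _ ≤ ((∫⁻ x, ‖f x‖ₑ ∂μ) * M ^ (p.toReal - 1)) ^ (1 / p.toReal) := by gcongr
    _ = _ := by
      rw [ENNReal.mul_rpow_of_nonneg _ _ (by positivity), ← ENNReal.rpow_mul, one_div]
      congr 2
      field_simp

/-- Bounds for the `ℓ^p` norms of the differences of the refinement mask. -/
lemma maskNorm_wordMask_le {p : ℝ≥0∞} (hp : 1 ≤ p) {k : ℕ} (hk : 1 ≤ k) {d : Fin (n + 1) → ℕ}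
    (hd : HasOrder d k) {w : List (Fin (n + 1))} (hw : w.length ≤ k) {N : ℕ} (hN : N ≠ 0) :
    maskNorm p (wordMask w * splineMask N d) ≤ (2 * (n + 1 : ℕ)) ^ w.length *
      (N : ℝ≥0∞) ^ ((n : ℝ) * (p⁻¹).toReal - (w.length * (p⁻¹).toReal +
        (min w.length (k - 1) : ℕ) * (1 - (p⁻¹).toReal))) := by
  set θ := (p⁻¹).toReal
  have hθ0 : 0 ≤ θ := ENNReal.toReal_nonneg
  have hθ1 : θ ≤ 1 := by
    rw [← ENNReal.toReal_one]
    exact ENNReal.toReal_mono (by simp) (ENNReal.inv_le_one.2 hp)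
  set c : ℝ≥0∞ := 2 * (n + 1 : ℕ)
  have hc1 : 1 ≤ c := by
    refine one_le_mul_of_one_le_of_one_le (by norm_num) ?_
    exact_mod_cast Nat.succ_pos n
  have hN0 : (N : ℝ≥0∞) ≠ 0 := by exact_mod_cast hN
  have hNt : (N : ℝ≥0∞) ≠ ∞ := by simp
  have h1 : maskNorm 1 (wordMask w * splineMask N d) ≤
      c ^ w.length * (N : ℝ≥0∞) ^ ((n : ℝ) - w.length) := by
    refine (maskNorm_wordMask_splineMask_le le_rfl hN (e := 0)
      (fun d _ => maskNorm_one_splineMask_le hN d) w d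
      (hd.of_le (by simpa using hw))).trans (le_of_eq ?_)
    rw [mul_pow, mul_assoc, sub_eq_neg_add, ENNReal.rpow_add _ _ hN0 hNt, ENNReal.rpow_neg,
      ENNReal.rpow_natCast, ENNReal.rpow_natCast, ENNReal.inv_pow]
  -- In `ℓ^∞` one unit of order is reserved for boundedness, so at most `k - 1` differences gain
  -- `N⁻¹`; a `k`-th one is bounded by the factor `2`. This loss against `ℓ^1` produces `k - 1 +
  -- 1/p` instead of `k`.
  have h2 : maskNorm ∞ (wordMask w * splineMask N d) ≤
      c ^ w.length * (N : ℝ≥0∞) ^ (-((min w.length (k - 1) : ℕ) : ℝ)) := by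
    rcases hw.lt_or_eq with hw | hw
    · refine (maskNorm_wordMask_splineMask_le le_top hN (e := 1)
        (maskNorm_top_splineMask_le hN) w d (hd.of_le (by omega))).trans (le_of_eq ?_)
      rw [min_eq_left (by omega), mul_pow, mul_one, ENNReal.rpow_neg, ENNReal.rpow_natCast,
        ENNReal.inv_pow]
    · cases w with
      | nil => simp at hw; omega
      | cons i w =>
        simp only [List.length_cons] at hw ⊢
        rw [wordMask_cons, mul_assoc]
        refine (maskNorm_diffMask_mul_le le_top _ _).trans ?_
        have := maskNorm_wordMask_splineMask_le le_top hN (e := 1)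
          (maskNorm_top_splineMask_le hN) w d (hd.of_le (by omega))
        refine (mul_le_mul_right this 2).trans ?_
        rw [min_eq_right (by omega), mul_pow, mul_one, ENNReal.rpow_neg, ENNReal.rpow_natCast,
          ENNReal.inv_pow, show k - 1 = w.length by omega, ← mul_assoc, pow_succ']
        gcongr
        refine le_mul_of_one_le_right zero_le ?_
        exact_mod_cast Nat.succ_pos n
  refine (eLpNorm_interpolation hp AEStronglyMeasurable.of_discrete).trans ?_
  calc _ ≤ (c ^ w.length * (N : ℝ≥0∞) ^ ((n : ℝ) - w.length)) ^ θ *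
        (c ^ w.length * (N : ℝ≥0∞) ^ (-((min w.length (k - 1) : ℕ) : ℝ))) ^ (1 - θ) := by
        gcongr
        · exact h1
        · exact h2
    _ = _ := by
      have hct : c ≠ ∞ := ENNReal.mul_ne_top (by simp) (by simp)
      rw [ENNReal.mul_rpow_of_nonneg _ _ hθ0, ENNReal.mul_rpow_of_nonneg _ _ (by linarith),
        mul_mul_mul_comm, ← ENNReal.rpow_add _ _ (by positivity) (ENNReal.pow_ne_top hct),
        ← ENNReal.rpow_mul, ← ENNReal.rpow_mul, ← ENNReal.rpow_add _ _ hN0 hNt,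
        add_sub_cancel, ENNReal.rpow_one]
      congr 2
      ring

/-! ### Polynomial functions -/

/-- The function on `ℝⁿ` given by a complex polynomial. -/
def polyFun (P : MvPolynomial (Fin n) ℂ) (x : Fin n → ℝ) : ℂ :=
  MvPolynomial.eval (fun i => (x i : ℂ)) P

/-- `f` is a polynomial function of degree at most `r`. -/
def IsPoly (r : ℕ) (f : (Fin n → ℝ) → ℂ) : Prop :=
  ∃ P : MvPolynomial (Fin n) ℂ, P.totalDegree ≤ r ∧ ∀ x, polyFun P x = f x

lemma isPoly_polyFun {r : ℕ} {P : MvPolynomial (Fin n) ℂ} (hP : P.totalDegree ≤ r) :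
    IsPoly r (polyFun P) := ⟨P, hP, fun _ => rfl⟩

lemma IsPoly.mono {r s : ℕ} {f : (Fin n → ℝ) → ℂ} (hf : IsPoly r f) (h : r ≤ s) : IsPoly s f := by
  obtain ⟨P, hP, hf⟩ := hf
  exact ⟨P, hP.trans h, hf⟩

lemma isPoly_const (r : ℕ) (c : ℂ) : IsPoly r (fun _ : Fin n → ℝ => c) :=
  ⟨MvPolynomial.C c, by simp, fun x => by simp [polyFun]⟩

lemma isPoly_coord (i : Fin n) : IsPoly 1 (fun x : Fin n → ℝ => (x i : ℂ)) :=
  ⟨MvPolynomial.X i, by simp, fun x => by simp [polyFun]⟩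

lemma IsPoly.add {r : ℕ} {f g : (Fin n → ℝ) → ℂ} (hf : IsPoly r f) (hg : IsPoly r g) :
    IsPoly r (fun x => f x + g x) := by
  obtain ⟨P, hP, hf⟩ := hf
  obtain ⟨Q, hQ, hg⟩ := hg
  exact ⟨P + Q, (MvPolynomial.totalDegree_add _ _).trans (max_le hP hQ), fun x => by
    simp [← hf, ← hg, polyFun]⟩

lemma IsPoly.mul {r s : ℕ} {f g : (Fin n → ℝ) → ℂ} (hf : IsPoly r f) (hg : IsPoly s g) :
    IsPoly (r + s) (fun x => f x * g x) := by
  obtain ⟨P, hP, hf⟩ := hf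
  obtain ⟨Q, hQ, hg⟩ := hg
  exact ⟨P * Q, (MvPolynomial.totalDegree_mul _ _).trans (add_le_add hP hQ), fun x => by
    simp [← hf, ← hg, polyFun]⟩

lemma IsPoly.const_mul {r : ℕ} {f : (Fin n → ℝ) → ℂ} (hf : IsPoly r f) (c : ℂ) :
    IsPoly r (fun x => c * f x) := by
  simpa using (isPoly_const 0 c).mul hf

lemma IsPoly.sum {r : ℕ} {ι : Type*} (s : Finset ι) {f : ι → (Fin n → ℝ) → ℂ}
    (hf : ∀ i ∈ s, IsPoly r (f i)) : IsPoly r (fun x => ∑ i ∈ s, f i x) := by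
  classical
  induction s using Finset.induction_on with
  | empty => simpa using isPoly_const r 0
  | insert i s hi ih =>
    simp_rw [Finset.sum_insert hi]
    exact (hf i (Finset.mem_insert_self _ _)).add
      (ih fun j hj => hf j (Finset.mem_insert_of_mem hj))

lemma IsPoly.pow {r : ℕ} {f : (Fin n → ℝ) → ℂ} (hf : IsPoly r f) (m : ℕ) :
    IsPoly (m * r) (fun x => f x ^ m) := by
  induction m with
  | zero => simpa using isPoly_const 0 1
  | succ m ih =>
    simp_rw [pow_succ]
    rw [add_mul, one_mul]
    exact ih.mul hf

lemma IsPoly.prod {ι : Type*} (s : Finset ι) {r : ι → ℕ} {f : ι → (Fin n → ℝ) → ℂ}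
    (hf : ∀ i ∈ s, IsPoly (r i) (f i)) : IsPoly (∑ i ∈ s, r i) (fun x => ∏ i ∈ s, f i x) := by
  classical
  induction s using Finset.induction_on with
  | empty => simpa using isPoly_const 0 1
  | insert i s hi ih =>
    simp_rw [Finset.prod_insert hi]
    rw [Finset.sum_insert hi]
    exact (hf i (Finset.mem_insert_self _ _)).mul
      (ih fun j hj => hf j (Finset.mem_insert_of_mem hj))

lemma polyFun_eq_sum (P : MvPolynomial (Fin n) ℂ) (x : Fin n → ℝ) :
    polyFun P x = ∑ s ∈ P.support, P.coeff s * ∏ i, (x i : ℂ) ^ s i := by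
  rw [polyFun, MvPolynomial.eval_eq']

lemma sum_le_totalDegree {P : MvPolynomial (Fin n) ℂ} {s : Fin n →₀ ℕ} (hs : s ∈ P.support) :
    ∑ i, s i ≤ P.totalDegree := by
  have := MvPolynomial.le_totalDegree hs
  rwa [Finsupp.sum_fintype _ _ (fun _ => rfl)] at this

/-- Substitution of functions of degree at most one into a polynomial. -/
lemma IsPoly.comp {r : ℕ} {f : (Fin n → ℝ) → ℂ} (hf : IsPoly r f)
    {g : (Fin n → ℝ) → Fin n → ℝ} (hg : ∀ i, IsPoly 1 (fun x => (g x i : ℂ))) :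
    IsPoly r (fun x => f (g x)) := by
  obtain ⟨P, hP, hf⟩ := hf
  simp_rw [← hf, polyFun_eq_sum]
  refine IsPoly.sum _ fun s hs => IsPoly.const_mul ?_ _
  refine IsPoly.mono (r := ∑ i, s i * 1) ?_ ?_
  · exact IsPoly.prod _ fun i _ => (hg i).pow _
  · simpa using (sum_le_totalDegree hs).trans hP

lemma IsPoly.comp_linear {r : ℕ} {f : (Fin n → ℝ) → ℂ} (hf : IsPoly r f)
    (L : (Fin n → ℝ) →ₗ[ℝ] (Fin n → ℝ)) : IsPoly r (fun x => f (L x)) := by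
  refine hf.comp fun i => ?_
  have h : ∀ x : Fin n → ℝ, ((L x i : ℝ) : ℂ) = ∑ j, (L (Pi.single j 1) i : ℂ) * (x j : ℂ) := by
    intro x
    have h1 : x = ∑ j, x j • (Pi.single j (1 : ℝ) : Fin n → ℝ) := by
      ext l
      simp [Finset.sum_apply, Pi.single_apply]
    conv_lhs => rw [h1]
    simp only [map_sum, map_smul, Finset.sum_apply, Pi.smul_apply, smul_eq_mul]
    push_cast
    exact Finset.sum_congr rfl fun j _ => mul_comm _ _
  rw [funext h]
  exact IsPoly.sum _ fun j _ => (isPoly_coord j).const_mul _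

lemma IsPoly.comp_affine {r : ℕ} {f : (Fin n → ℝ) → ℂ} (hf : IsPoly r f) (c : ℝ)
    (b : Fin n → ℝ) : IsPoly r (fun x => f (c • x + b)) := by
  refine hf.comp fun i => ?_
  have := ((isPoly_coord i).const_mul c).add (isPoly_const 1 (b i : ℂ))
  simpa using this

lemma IsPoly.continuous {r : ℕ} {f : (Fin n → ℝ) → ℂ} (hf : IsPoly r f) : Continuous f := by
  obtain ⟨P, -, hf⟩ := hf
  rw [← funext hf, funext (polyFun_eq_sum P)]
  fun_prop

/-- The first `m` coordinates of `x`, completed by zeros. -/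
def truncPoint (m : ℕ) (x : Fin n → ℝ) : Fin n → ℝ := fun j => if (j : ℕ) < m then x j else 0

lemma truncPoint_succ (i : Fin n) (x : Fin n → ℝ) :
    truncPoint (i + 1) x = truncPoint i x + x i • Pi.single i 1 := by
  ext j
  simp only [truncPoint, Pi.add_apply, Pi.smul_apply, smul_eq_mul]
  rcases lt_trichotomy (j : ℕ) i with h | h | h
  · have : j ≠ i := fun e => by simp [e] at h
    simp [h, this, Nat.lt_succ_of_lt h]
  · have : j = i := Fin.ext h
    simp [this]
  · have h1 : j ≠ i := fun e => by simp [e] at h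
    have h2 : ¬ (j : ℕ) < i + 1 := by omega
    have h3 : ¬ (j : ℕ) < i := by omega
    simp only [h2, h3, if_false, Pi.single_eq_of_ne h1]
    simp

/-- Primitives of polynomials along the edges of a staircase are polynomials. -/
lemma IsPoly.staircase {r : ℕ} {f : (Fin n → ℝ) → ℂ} (hf : IsPoly r f) (i : Fin n) :
    IsPoly (r + 1) fun x => ∫ t in (0 : ℝ)..x i, f (truncPoint i x + t • Pi.single i 1) := by
  obtain ⟨P, hP, hf⟩ := hf
  simp_rw [← hf, polyFun_eq_sum]
  have hint : ∀ (x : Fin n → ℝ) (s : Fin n →₀ ℕ), IntervalIntegrable (fun t : ℝ =>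
      P.coeff s * ∏ j, ((truncPoint i x + t • Pi.single i 1 : Fin n → ℝ) j : ℂ) ^ s j)
      volume 0 (x i) := by
    intro x s
    have hc : Continuous fun t : ℝ => (truncPoint i x + t • Pi.single i 1 : Fin n → ℝ) := by
      fun_prop
    exact (continuous_const.mul (continuous_finsetProd _ fun j _ =>
      (Complex.continuous_ofReal.comp ((continuous_apply j).comp hc)).pow _)).intervalIntegrable _ _
  have hsum : ∀ x : Fin n → ℝ, (∫ t in (0 : ℝ)..x i, ∑ s ∈ P.support, P.coeff s *
      ∏ j, ((truncPoint i x + t • Pi.single i 1 : Fin n → ℝ) j : ℂ) ^ s j) =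
      ∑ s ∈ P.support, P.coeff s * ∫ t in (0 : ℝ)..x i,
        ∏ j, ((truncPoint i x + t • Pi.single i 1 : Fin n → ℝ) j : ℂ) ^ s j := by
    intro x
    rw [intervalIntegral.integral_finsetSum (fun s _ => hint x s)]
    exact Finset.sum_congr rfl fun s _ => intervalIntegral.integral_const_mul _ _
  rw [funext hsum]
  refine IsPoly.sum _ fun s hs => IsPoly.const_mul ?_ _
  -- On the `i`-th edge all later coordinates vanish, so monomials that contain one of them
  -- contribute nothing.
  by_cases h : ∃ j : Fin n, i < j ∧ s j ≠ 0
  · obtain ⟨j, hij, hj⟩ := h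
    have h0 : ∀ (x : Fin n → ℝ) (t : ℝ), ∏ j,
        ((truncPoint i x + t • Pi.single i 1 : Fin n → ℝ) j : ℂ) ^ s j = 0 := by
      intro x t
      refine Finset.prod_eq_zero (Finset.mem_univ j) ?_
      have h1 : ¬ (j : ℕ) < i := not_lt.2 (le_of_lt hij)
      have : (truncPoint i x + t • Pi.single i 1 : Fin n → ℝ) j = 0 := by
        simp only [truncPoint, Pi.add_apply, Pi.smul_apply, h1, if_false,
          Pi.single_eq_of_ne hij.ne']
        simp
      rw [this, Complex.ofReal_zero, zero_pow hj]
    simp_rw [h0]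
    simpa using isPoly_const (r + 1) 0
  · push Not at h
    have h1 : ∀ (x : Fin n → ℝ) (t : ℝ), ∏ j,
        ((truncPoint i x + t • Pi.single i 1 : Fin n → ℝ) j : ℂ) ^ s j =
        ((t ^ s i : ℝ) : ℂ) * ∏ j ∈ Finset.univ.erase i, (x j : ℂ) ^ s j := by
      intro x t
      rw [← Finset.mul_prod_erase _ _ (Finset.mem_univ i)]
      congr 1
      · simp [truncPoint]
      · refine Finset.prod_congr rfl fun j hj => ?_
        have hj' := Finset.ne_of_mem_erase hj
        rcases lt_or_gt_of_ne hj' with hlt | hgt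
        · simp [truncPoint, hj', hlt]
        · simp [h j hgt]
    simp_rw [h1, intervalIntegral.integral_mul_const, intervalIntegral.integral_ofReal,
      integral_pow]
    have h2 : ∀ x : Fin n → ℝ, (((x i ^ (s i + 1) - 0 ^ (s i + 1)) / ((s i : ℝ) + 1) : ℝ) : ℂ) =
        ((s i : ℂ) + 1)⁻¹ * (x i : ℂ) ^ (s i + 1) := by
      intro x
      push_cast
      rw [zero_pow (Nat.succ_ne_zero _), sub_zero, div_eq_inv_mul]
    simp_rw [h2]
    have h3 := (((isPoly_coord i).pow (s i + 1)).const_mul ((s i : ℂ) + 1)⁻¹).mul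
      (IsPoly.prod (Finset.univ.erase i) fun j _ => (isPoly_coord j).pow (s j))
    refine h3.mono ?_
    have h4 := (sum_le_totalDegree hs).trans hP
    rw [← Finset.add_sum_erase _ _ (Finset.mem_univ i)] at h4
    simp only [mul_one]
    omega

/-! ### Primitives along lines -/

/-- On all lines in the direction `v`, the function `G` is a primitive of `g`. -/
def IsLinePrimitive (v : Fin n → ℝ) (G g : (Fin n → ℝ) → ℂ) : Prop :=
  ∀ (x : Fin n → ℝ) (h : ℝ), G (x + h • v) - G x = ∫ t in (0 : ℝ)..h, g (x + t • v)

/-- Integrability on bounded parts of lines in the direction `v`. -/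
def LineIntegrable (v : Fin n → ℝ) (g : (Fin n → ℝ) → ℂ) : Prop :=
  ∀ (x : Fin n → ℝ) (a b : ℝ), IntervalIntegrable (fun t : ℝ => g (x + t • v)) volume a b

/-- The difference of a sequence in the `i`-th direction. -/
def latticeDiff (i : Fin (n + 1)) (b : (Fin n → ℤ) → ℂ) : (Fin n → ℤ) → ℂ :=
  fun ν => b ν - b (ν - latticeDirection n i)

/-- On a line the series of higher order is `∫_{y-1}^{y} S`, whose derivative is `S(y) - S(y - 1)`;
the shift by a lattice direction moves into the coefficients. The integral form is used because
series of order one are step functions. -/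
lemma isLinePrimitive_splineSeries [NeZero n] {d : Fin (n + 1) → ℕ} (hd : HasOrder d 1)
    (i : Fin (n + 1)) (b : (Fin n → ℤ) → ℂ) :
    IsLinePrimitive (boxDirection n i) (splineSeries (d + Pi.single i 1) b)
      (splineSeries d (latticeDiff i b)) := by
  intro x h
  set v := boxDirection n i
  set S : ℝ → ℂ := fun u => splineSeries d b (x + u • v) with hS
  have hint : ∀ a c : ℝ, IntervalIntegrable S volume a c :=
    fun a c => intervalIntegrable_splineSeries hd b x v a c
  have h1 : ∀ y : ℝ, splineSeries (d + Pi.single i 1) b (x + y • v) = ∫ u in (y - 1)..y, S u := by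
    intro y
    rw [← unitIntegral_splineSeries hd]
    have h2 := intervalIntegral.integral_comp_sub_left (a := 0) (b := 1) S y
    rw [sub_zero] at h2
    rw [← h2]
    refine intervalIntegral.integral_congr fun t _ => ?_
    simp only [hS, sub_smul, add_sub_assoc]
    rfl
  have h0 := h1 0
  rw [zero_smul, add_zero] at h0
  have h2 : ∀ t : ℝ, splineSeries d (latticeDiff i b) (x + t • v) = S t - S (t - 1) := by
    intro t
    unfold latticeDiff
    rw [splineSeries_sub hd, ← splineSeries_shift, latticePoint_direction]
    simp only [hS, sub_smul, one_smul, add_sub_assoc]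
    rfl
  simp_rw [h2]
  rw [h1, h0, intervalIntegral.integral_sub (hint _ _)
    (by simpa using (hint (0 - 1) (h - 1)).comp_sub_right 1),
    intervalIntegral.integral_comp_sub_right]
  have e1 := intervalIntegral.integral_add_adjacent_intervals (hint (0 - 1) 0) (hint 0 h)
  have e2 := intervalIntegral.integral_add_adjacent_intervals (hint (0 - 1) (h - 1)) (hint (h - 1) h)
  rw [← e1] at e2
  linear_combination e2

/-! ### Approximation by polynomials in the supremum norm -/

/-- On the ball of radius `R` about the origin, `G` differs from a polynomial of degree at most
`r` by at most `ε`. -/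
def PolyApprox (r : ℕ) (R ε : ℝ) (G : (Fin n → ℝ) → ℂ) : Prop :=
  ∃ P, IsPoly r P ∧ ∀ x, ‖x‖ ≤ R → ‖G x - P x‖ ≤ ε

lemma PolyApprox.mono {r : ℕ} {R ε R' ε' : ℝ} {G : (Fin n → ℝ) → ℂ} (h : PolyApprox r R ε G)
    (hR : R' ≤ R) (hε : ε ≤ ε') : PolyApprox r R' ε' G := by
  obtain ⟨P, hP, hG⟩ := h
  exact ⟨P, hP, fun x hx => (hG x (hx.trans hR)).trans hε⟩

lemma norm_truncPoint_le (i : Fin n) (x : Fin n → ℝ) {t : ℝ} (ht : |t| ≤ |x i|) :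
    ‖truncPoint i x + t • Pi.single i 1‖ ≤ ‖x‖ := by
  rw [pi_norm_le_iff_of_nonneg (norm_nonneg x)]
  intro j
  simp only [truncPoint, Pi.add_apply, Pi.smul_apply, smul_eq_mul]
  by_cases h : j = i
  · subst h
    simpa using ht.trans (norm_le_pi_norm x j)
  · rw [Pi.single_eq_of_ne h, mul_zero, add_zero]
    split_ifs
    · exact norm_le_pi_norm x j
    · simp

/-- `G` and its approximant are both integrals along the same staircase from `0` to `x`. Since the
path is prescribed, the polynomials that approximate the partial derivatives need not be the
gradient of anything. -/
lemma PolyApprox.of_linePrimitive {r : ℕ} {R ε : ℝ} (hε : 0 ≤ ε)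
    {G : (Fin n → ℝ) → ℂ}
    {g : Fin n → (Fin n → ℝ) → ℂ} (hG : ∀ i, IsLinePrimitive (Pi.single i 1) G (g i))
    (hint : ∀ i, LineIntegrable (Pi.single i 1) (g i)) (h : ∀ i, PolyApprox r R ε (g i)) :
    PolyApprox (r + 1) R (n * (ε * R)) G := by
  choose P hP hPg using h
  refine ⟨fun x => G 0 + ∑ i : Fin n,
    ∫ t in (0 : ℝ)..x i, P i (truncPoint i x + t • Pi.single i 1),
    (isPoly_const _ _).add (IsPoly.sum _ fun i _ => (hP i).staircase i), fun x hx => ?_⟩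
  have h1 : G x - G 0 = ∑ i : Fin n,
      ∫ t in (0 : ℝ)..x i, g i (truncPoint i x + t • Pi.single i 1) := by
    have h2 := Finset.sum_range_sub (fun m => G (truncPoint m x)) n
    have h3 : truncPoint n x = x := by ext j; simp [truncPoint]
    have h4 : truncPoint 0 x = 0 := by ext j; simp [truncPoint]
    rw [h3, h4] at h2
    rw [← h2, Finset.sum_range]
    refine Finset.sum_congr rfl fun i _ => ?_
    rw [truncPoint_succ, hG i]
  rw [← sub_sub, h1, ← Finset.sum_sub_distrib]
  refine (norm_sum_le _ _).trans ?_
  have h5 : ∀ i ∈ (Finset.univ : Finset (Fin n)),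
      ‖(∫ t in (0 : ℝ)..x i, g i (truncPoint i x + t • Pi.single i 1)) -
        ∫ t in (0 : ℝ)..x i, P i (truncPoint i x + t • Pi.single i 1)‖ ≤ ε * R := by
    intro i _
    rw [← intervalIntegral.integral_sub (hint i _ _ _)]
    · refine (intervalIntegral.norm_integral_le_of_norm_le_const (C := ε) fun t ht => ?_).trans ?_
      · apply hPg
        refine (norm_truncPoint_le i x ?_).trans hx
        rcases le_total 0 (x i) with h0 | h0
        · rw [uIoc_of_le h0] at ht
          rw [abs_of_nonneg h0, abs_of_pos ht.1]
          exact ht.2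
        · rw [uIoc_of_ge h0] at ht
          rw [abs_of_nonpos h0, abs_of_nonpos ht.2]
          linarith [ht.1]
      · rw [sub_zero]
        exact mul_le_mul_of_nonneg_left ((norm_le_pi_norm x i).trans hx) hε
    · apply Continuous.intervalIntegrable
      exact (hP i).continuous.comp (by fun_prop)
  refine (Finset.sum_le_sum h5).trans (le_of_eq ?_)
  simp

/-- A linear change of coordinates reduces this to the unit vectors. It and its inverse at most
double norms, whence the radii `2 * R` and `4 * R`. -/
lemma PolyApprox.of_linePrimitive_base {r : ℕ} {R ε : ℝ} (hε : 0 ≤ ε)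
    (i : Fin (n + 1)) {G : (Fin n → ℝ) → ℂ} {g : Fin n → (Fin n → ℝ) → ℂ}
    (hG : ∀ j, IsLinePrimitive (boxDirection n (baseIndex i j)) G (g j))
    (hint : ∀ j, LineIntegrable (boxDirection n (baseIndex i j)) (g j))
    (h : ∀ j, PolyApprox r (4 * R) ε (g j)) :
    PolyApprox (r + 1) R (n * (ε * (2 * R))) G := by
  set L := coordEquiv ℝ i
  have hline : ∀ (y : Fin n → ℝ) (t : ℝ) (j : Fin n), L.symm (y + t • Pi.single j 1) =
      L.symm y + t • boxDirection n (baseIndex i j) := by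
    intro y t j
    rw [map_add, map_smul, coordEquiv_symm_single_real]
  have h1 : PolyApprox (r + 1) (2 * R) (n * (ε * (2 * R))) (fun y => G (L.symm y)) := by
    refine PolyApprox.of_linePrimitive (g := fun j y => g j (L.symm y)) hε ?_ ?_ ?_
    · intro j y t
      simp_rw [hline]
      exact hG j _ _
    · intro j y a b
      simp_rw [hline]
      exact hint j _ _ _
    · intro j
      obtain ⟨P, hP, hg⟩ := h j
      refine ⟨fun y => P (L.symm y), hP.comp_linear L.symm.toLinearMap, fun y hy => hg _ ?_⟩
      exact (norm_coordEquiv_symm_le i y).trans (by linarith)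
  obtain ⟨P, hP, hg⟩ := h1
  refine ⟨fun x => P (L x), hP.comp_linear L.toLinearMap, fun x hx => ?_⟩
  have := hg (L x) ((norm_coordEquiv_le i x).trans (by linarith))
  simpa only [LinearEquiv.symm_apply_apply] using this

/-- The iterated difference of a sequence in the directions `w`. -/
def wordDiff (w : List (Fin (n + 1))) (b : (Fin n → ℤ) → ℂ) : (Fin n → ℤ) → ℂ :=
  w.foldr latticeDiff b

/-- Walk from `ν` to `0` in unit steps that decrease some `|ν j|`; the path has `m` steps and stays
in the box. -/
lemma norm_sub_le_of_latticeDiff {b : (Fin n → ℤ) → ℂ} {ε : ℝ} {M : ℕ}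
    (h : ∀ i, ∀ ν ∈ latticeBox n M, ‖latticeDiff i b ν‖ ≤ ε) (m : ℕ) :
    ∀ ν ∈ latticeBox n M, ∑ j, (ν j).natAbs = m → ‖b ν - b 0‖ ≤ m * ε := by
  induction m with
  | zero =>
    intro ν _ hν
    have : ν = 0 := by
      ext j
      have := Finset.sum_eq_zero_iff.1 hν j (Finset.mem_univ j)
      simpa using this
    simp [this]
  | succ m ih =>
    intro ν hν hsum
    have hex : ∃ j, ν j ≠ 0 := by
      by_contra hall
      push Not at hall
      simp [hall] at hsum
    obtain ⟨j, hj⟩ := hex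
    rw [mem_latticeBox] at hν
    have hsplit : ∀ μ : Fin n → ℤ, (∀ l, l ≠ j → μ l = ν l) →
        (μ j).natAbs + 1 = (ν j).natAbs → ‖b μ - b 0‖ ≤ m * ε := by
      intro μ h1 h2
      apply ih
      · rw [mem_latticeBox]
        intro l
        by_cases hl : l = j
        · subst hl
          have := hν l
          have e1 : |μ l| = ((μ l).natAbs : ℤ) := (Int.natCast_natAbs _).symm
          have e2 : |ν l| = ((ν l).natAbs : ℤ) := (Int.natCast_natAbs _).symm
          omega
        · rw [h1 l hl]; exact hν l
      · rw [← Finset.add_sum_erase _ _ (Finset.mem_univ j)] at hsum ⊢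
        have : ∑ l ∈ Finset.univ.erase j, (μ l).natAbs = ∑ l ∈ Finset.univ.erase j, (ν l).natAbs :=
          Finset.sum_congr rfl fun l hl => by rw [h1 l (Finset.ne_of_mem_erase hl)]
        omega
    rcases lt_or_gt_of_ne hj with hneg | hpos
    · have h1 := hsplit (ν + Pi.single j 1) (fun l hl => by simp [hl]) (by simp; omega)
      have h2 := h j.castSucc (ν + Pi.single j 1) (by
        rw [mem_latticeBox]
        intro l
        by_cases hl : l = j
        · subst hl
          have := hν l
          rw [abs_le] at this ⊢
          simp only [Pi.add_apply, Pi.single_eq_same]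
          constructor <;> omega
        · simpa [hl] using hν l)
      rw [latticeDiff, latticeDirection_castSucc, add_sub_cancel_right] at h2
      rw [norm_sub_rev] at h2
      have h3 := norm_add_le (b ν - b (ν + Pi.single j 1)) (b (ν + Pi.single j 1) - b 0)
      rw [sub_add_sub_cancel] at h3
      push_cast
      linarith
    · have h1 := hsplit (ν - Pi.single j 1) (fun l hl => by simp [hl]) (by simp; omega)
      have h2 := h j.castSucc ν (by rw [mem_latticeBox]; exact hν)
      rw [latticeDiff, latticeDirection_castSucc] at h2
      have h3 := norm_add_le (b ν - b (ν - Pi.single j 1)) (b (ν - Pi.single j 1) - b 0)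
      rw [sub_add_sub_cancel] at h3
      push_cast
      linarith

lemma latticeBox_mono {M M' : ℕ} (h : M ≤ M') : latticeBox n M ⊆ latticeBox n M' := by
  intro ν hν
  rw [mem_latticeBox] at hν ⊢
  exact fun i => (hν i).trans (by exact_mod_cast h)

/-- Spline series are locally close to polynomials if the differences of their coefficients are
small. -/
lemma polyApprox_splineSeries [NeZero n] (r : ℕ) : ∀ (d : Fin (n + 1) → ℕ), HasOrder d (r + 1) →
    ∀ R : ℝ, 0 ≤ R → ∃ (C : ℝ≥0) (M : ℕ), ∀ (b : (Fin n → ℤ) → ℂ) (ε : ℝ), 0 ≤ ε →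
      (∀ w : List (Fin (n + 1)), w.length = r + 1 → ∀ ν ∈ latticeBox n M, ‖wordDiff w b ν‖ ≤ ε) →
      PolyApprox r R (C * ε) (splineSeries d b) := by
  induction r with
  | zero =>
    intro d hd R hR
    obtain ⟨M, hM⟩ := exists_nat_ge (R + splineRadius d)
    -- A point of the box is at most `n * M` steps away from `0`, and the partition of unity carries
    -- the bound for `b ν - b 0` over to the series.
    refine ⟨((n * M : ℕ) : ℝ≥0), M, fun b ε hε h => ⟨fun _ => b 0, isPoly_const _ _, fun x hx => ?_⟩⟩
    have h1 : ∀ ν ∈ latticeBox n M, ‖b ν - b 0‖ ≤ (n * M : ℕ) * ε := by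
      intro ν hν
      refine (norm_sub_le_of_latticeDiff (fun i μ hμ => h [i] rfl μ hμ) _ ν hν rfl).trans ?_
      gcongr
      rw [mem_latticeBox] at hν
      refine (Finset.sum_le_card_nsmul _ _ M fun j _ => ?_).trans (by simp)
      have e2 : |ν j| = ((ν j).natAbs : ℤ) := (Int.natCast_natAbs _).symm
      have := hν j
      omega
    have hM' : ‖x‖ + splineRadius d ≤ M := by linarith
    have h2 : splineSeries d b x - b 0 = splineSeries d (fun ν => b ν - b 0 * 1) x := by
      rw [splineSeries_sub hd, splineSeries_const_mul, splineSeries_one hd, mul_one]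
    rw [h2, splineSeries_eq_sum hd _ hM']
    have h3 := splineSeries_one hd x
    rw [splineSeries_eq_sum hd _ hM'] at h3
    simp_rw [one_mul] at h3
    norm_cast at h3
    refine (norm_sum_le _ _).trans ?_
    have h4 : ∀ ν ∈ latticeBox n M, ‖(b ν - b 0 * 1) * (spline d (x - latticePoint ν) : ℂ)‖ ≤
        (n * M : ℕ) * ε * spline d (x - latticePoint ν) := by
      intro ν hν
      rw [norm_mul, mul_one, Complex.norm_real, Real.norm_eq_abs,
        abs_of_nonneg (spline_mem_Icc hd _).1]
      exact mul_le_mul_of_nonneg_right (h1 ν hν) (spline_mem_Icc hd _).1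
    refine (Finset.sum_le_sum h4).trans (le_of_eq ?_)
    rw [← Finset.mul_sum, h3, mul_one]
    push_cast
    rfl
  | succ r ih =>
    intro d hd R hR
    obtain ⟨i, hi⟩ := (hd.of_le (l := 1) (by omega)).exists_baseMult_le
    have hex : ∀ j : Fin n, ∃ e : Fin (n + 1) → ℕ, d = e + Pi.single (baseIndex i j) 1 := by
      intro j
      apply exists_eq_add_single
      have := hi (baseIndex i j)
      simp only [baseMult, baseIndex_ne, if_false] at this
      omega
    choose e he using hex
    have hord : ∀ j, HasOrder (e j) (r + 1) := fun j =>
      HasOrder.of_add_single (i := baseIndex i j) (by rw [← he j]; exact hd)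
    choose C M hCM using fun j => ih (e j) (hord j) (4 * R) (by linarith)
    refine ⟨n * ((∑ j, C j) * (2 * R.toNNReal)), ∑ j, M j, fun b ε hε h => ?_⟩
    -- The derivatives along a basis are series of one order less whose coefficients are first
    -- differences of `b`, so the induction hypothesis applies to them.
    have h1 := PolyApprox.of_linePrimitive_base (r := r) (R := R) (ε := (∑ j, C j : ℝ≥0) * ε)
      (by positivity) i (G := splineSeries d b)
      (g := fun j => splineSeries (e j) (latticeDiff (baseIndex i j) b)) ?_ ?_ ?_
    · refine h1.mono le_rfl (le_of_eq ?_)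
      push_cast
      rw [Real.coe_toNNReal _ hR]
      ring
    · intro j
      conv_lhs => rw [he j]
      exact isLinePrimitive_splineSeries ((hord j).of_le (by omega)) _ _
    · intro j x a c
      exact intervalIntegrable_splineSeries ((hord j).of_le (by omega)) _ _ _ _ _
    · intro j
      refine (hCM j _ ε hε ?_).mono le_rfl ?_
      · intro w hw ν hν
        -- `wordDiff` folds from the right, so the last letter acts first.
        have h2 := h (w ++ [baseIndex i j]) (by simp [hw]) ν
          (latticeBox_mono (Finset.single_le_sum (fun _ _ => Nat.zero_le _) (Finset.mem_univ j)) hν)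
        simpa [wordDiff] using h2
      · gcongr
        exact Finset.single_le_sum (fun _ _ => zero_le) (Finset.mem_univ j)

lemma coeff_wordMask_mul (w : List (Fin (n + 1))) (a : LatticeAlgebra n) :
    ⇑(wordMask w * a).coeff = wordDiff w a.coeff := by
  induction w with
  | nil => simp [wordMask, wordDiff]
  | cons i w ih =>
    rw [wordMask_cons, mul_assoc]
    change _ = latticeDiff i (wordDiff w a.coeff)
    rw [← ih]
    ext ν
    simp [diffMask, sub_mul, latticeDiff, neg_add_eq_sub]

lemma wordDiff_shift (w : List (Fin (n + 1))) (b : (Fin n → ℤ) → ℂ) (κ ν : Fin n → ℤ) :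
    wordDiff w (fun μ => b (μ + κ)) ν = wordDiff w b (ν + κ) := by
  induction w generalizing ν with
  | nil => rfl
  | cons i w ih =>
    change latticeDiff i (wordDiff w _) ν = latticeDiff i (wordDiff w b) (ν + κ)
    simp only [latticeDiff, ih]
    rw [sub_add_eq_add_sub]

/-! ### Norms of sequences -/

lemma eLpNorm_le_of_restrict_range {q : ℝ≥0∞} (hq : 1 ≤ q) {f : ℕ → ℝ≥0∞} {B : ℝ≥0∞}
    (h : ∀ M, eLpNorm (indicator (Iio M) f) q Measure.count ≤ B) :
    eLpNorm f q Measure.count ≤ B := by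
  have hq0 : q ≠ 0 := (zero_lt_one.trans_le hq).ne'
  rcases eq_or_ne q ∞ with rfl | hq'
  · simp only [eLpNorm_exponent_top, eLpNormEssSup_count, enorm_eq_self, iSup_le_iff] at h ⊢
    intro m
    have := h (m + 1) m
    rwa [indicator_of_mem (by simp)] at this
  have hqr : 0 < q.toReal := ENNReal.toReal_pos hq0 hq'
  simp only [eLpNorm_eq_lintegral_rpow_enorm_toReal hq0 hq', lintegral_count, enorm_eq_self,
    one_div] at h ⊢
  rw [ENNReal.rpow_inv_le_iff hqr, ENNReal.tsum_eq_iSup_nat]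
  refine iSup_le fun M => ?_
  have h1 := (ENNReal.rpow_inv_le_iff hqr).1 (h M)
  refine le_trans ?_ h1
  refine le_trans (Finset.sum_le_sum fun m hm => ?_) (ENNReal.sum_le_tsum (Finset.range M))
  rw [indicator_of_mem (by simpa using hm)]

/-- Minkowski's inequality for infinite sums of sequences. -/
lemma eLpNorm_tsum_le {q : ℝ≥0∞} (hq : 1 ≤ q) (u : ℕ → ℕ → ℝ≥0∞) (hu : ∀ i m, m < i → u i m = 0) :
    eLpNorm (fun m => ∑' i, u i m) q Measure.count ≤ ∑' i, eLpNorm (u i) q Measure.count := by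
  refine eLpNorm_le_of_restrict_range hq fun M => ?_
  -- Below `M` only the first `M` sequences contribute, by `hu`, so the finite Minkowski inequality
  -- suffices.
  have h1 : eLpNorm (indicator (Iio M) fun m => ∑' i, u i m) q Measure.count ≤
      eLpNorm (∑ i ∈ Finset.range M, u i) q Measure.count := by
    refine eLpNorm_mono_enorm fun m => ?_
    by_cases hm : m < M
    · rw [indicator_of_mem (show m ∈ Iio M from hm), tsum_eq_sum (s := Finset.range M), Finset.sum_apply]
      intro i hi
      apply hu
      simp at hi
      omega
    · rw [indicator_of_notMem (by simpa using hm)]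
      simp
  refine h1.trans ((eLpNorm_sum_le (fun i _ => AEStronglyMeasurable.of_discrete) hq).trans ?_)
  exact ENNReal.sum_le_tsum _

lemma eLpNorm_ennreal_const_mul_le {ι : Type*} [MeasurableSpace ι] (q : ℝ≥0∞)
    (c : ℝ≥0∞) (f : ι → ℝ≥0∞) (μ : Measure ι) (hc : c ≠ ∞) :
    eLpNorm (fun i => c * f i) q μ ≤ c * eLpNorm f q μ := by
  have := eLpNorm_le_nnreal_smul_eLpNorm_of_ae_le_mul' (f := fun i => c * f i) (g := f)
    (c := c.toNNReal) (μ := μ) (Filter.Eventually.of_forall fun i => by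
      simp [ENNReal.coe_toNNReal hc]) q
  rwa [ENNReal.smul_def, ENNReal.coe_toNNReal hc, smul_eq_mul] at this

lemma weightedNorm_mono {s : ℝ} {q : ℝ≥0∞} {a b : ℕ → ℝ≥0∞} (h : ∀ l, a l ≤ b l) :
    weightedNorm s q a ≤ weightedNorm s q b :=
  eLpNorm_mono_enorm fun l => by simpa using mul_le_mul_right (h l) _

lemma weightedNorm_add_le {s : ℝ} {q : ℝ≥0∞} (hq : 1 ≤ q) (a b : ℕ → ℝ≥0∞) :
    weightedNorm s q (fun l => a l + b l) ≤ weightedNorm s q a + weightedNorm s q b := by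
  refine le_trans (le_of_eq ?_) (eLpNorm_add_le AEStronglyMeasurable.of_discrete
    AEStronglyMeasurable.of_discrete hq)
  rw [weightedNorm]
  congr 1
  ext l
  simp [mul_add]

lemma weightedNorm_const_mul_le {s : ℝ} {q : ℝ≥0∞} {c : ℝ≥0∞} (hc : c ≠ ∞) (a : ℕ → ℝ≥0∞) :
    weightedNorm s q (fun l => c * a l) ≤ c * weightedNorm s q a := by
  refine le_trans (le_of_eq ?_) (eLpNorm_ennreal_const_mul_le q c _ _ hc)
  rw [weightedNorm]
  congr 1
  ext l
  ring

/-- The sequence `a`, shifted by `i` places to the right. -/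
def shiftSeq (i : ℕ) (a : ℕ → ℝ≥0∞) (m : ℕ) : ℝ≥0∞ := if i ≤ m then a (m - i) else 0

lemma eLpNorm_shiftSeq_le {q : ℝ≥0∞} (hq : 1 ≤ q) (i : ℕ) (a : ℕ → ℝ≥0∞) :
    eLpNorm (shiftSeq i a) q Measure.count ≤ eLpNorm a q Measure.count := by
  have hq0 : q ≠ 0 := (zero_lt_one.trans_le hq).ne'
  rcases eq_or_ne q ∞ with rfl | hq'
  · simp only [eLpNorm_exponent_top, eLpNormEssSup_count, enorm_eq_self, iSup_le_iff]
    intro m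
    unfold shiftSeq
    split_ifs
    · exact le_iSup a (m - i)
    · simp
  have hqr : 0 < q.toReal := ENNReal.toReal_pos hq0 hq'
  simp only [eLpNorm_eq_lintegral_rpow_enorm_toReal hq0 hq', lintegral_count, enorm_eq_self]
  refine ENNReal.rpow_le_rpow ?_ (by positivity)
  have h2 : ∀ m, shiftSeq i a m ^ q.toReal = if i ≤ m then a (m - i) ^ q.toReal else 0 := by
    intro m
    unfold shiftSeq
    split_ifs
    · rfl
    · exact ENNReal.zero_rpow_of_pos hqr
  simp_rw [h2]
  rw [← (add_left_injective i).tsum_eq]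
  · exact (tsum_congr fun m => by rw [if_pos (Nat.le_add_left i m), Nat.add_sub_cancel]).le
  · intro m hm
    rw [Function.mem_support] at hm
    refine ⟨m - i, Nat.sub_add_cancel ?_⟩
    by_contra h
    exact hm (if_neg h)

lemma weightedNorm_shiftSeq_le {s : ℝ} {q : ℝ≥0∞} (hq : 1 ≤ q) (i : ℕ) (a : ℕ → ℝ≥0∞) :
    weightedNorm s q (shiftSeq i a) ≤ (2 : ℝ≥0∞) ^ ((i : ℝ) * s) * weightedNorm s q a := by
  have h1 : (fun l : ℕ => (2 : ℝ≥0∞) ^ ((l : ℝ) * s) * shiftSeq i a l) = fun l =>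
      (2 : ℝ≥0∞) ^ ((i : ℝ) * s) * shiftSeq i (fun l => (2 : ℝ≥0∞) ^ ((l : ℝ) * s) * a l) l := by
    ext l
    unfold shiftSeq
    split_ifs with h
    · rw [← mul_assoc, ← ENNReal.rpow_add _ _ (by simp) (by simp), ← add_mul, Nat.cast_sub h]
      congr 3
      ring
    · simp
  rw [weightedNorm, h1]
  refine (eLpNorm_ennreal_const_mul_le q _ _ _ (by simp)).trans ?_
  gcongr
  exact eLpNorm_shiftSeq_le hq i _

/-- The sum of a geometric series with ratio `2 ^ (-β)`. -/
def geomConst (β : ℝ) : ℝ≥0∞ := ∑' i : ℕ, (2 : ℝ≥0∞) ^ (-((i : ℝ) * β))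

lemma geomConst_ne_top {β : ℝ} (hβ : 0 < β) : geomConst β ≠ ∞ := by
  have h : ∀ i : ℕ, (2 : ℝ≥0∞) ^ (-((i : ℝ) * β)) = ((2 : ℝ≥0∞) ^ (-β)) ^ i := by
    intro i
    rw [← ENNReal.rpow_natCast, ← ENNReal.rpow_mul]
    congr 1
    ring
  unfold geomConst
  simp_rw [h]
  rw [ENNReal.tsum_geometric]
  simp only [ne_eq, ENNReal.inv_eq_top, tsub_eq_zero_iff_le, not_le]
  exact ENNReal.rpow_lt_one_of_one_lt_of_neg (by norm_num) (by linarith)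

/-- Hardy's inequality. -/
lemma weightedNorm_hardy_le {s α : ℝ} {q : ℝ≥0∞} (hq : 1 ≤ q)
    (a : ℕ → ℝ≥0∞) : weightedNorm s q (fun m => ∑ j ∈ Finset.range (m + 1),
      (2 : ℝ≥0∞) ^ (-(((m - j : ℕ) : ℝ) * α)) * a j) ≤ geomConst (α - s) * weightedNorm s q a := by
  -- In terms of the distance `i = m - j` this is a superposition of shifts of `a`. The `i`-th shift
  -- carries the factor `2^{-iα}` and costs `2^{is}`. For `α ≤ s` the constant is infinite and the
  -- claim is harmless.
  have h1 : ∀ m, ∑ j ∈ Finset.range (m + 1), (2 : ℝ≥0∞) ^ (-(((m - j : ℕ) : ℝ) * α)) * a j =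
      ∑' i : ℕ, (2 : ℝ≥0∞) ^ (-((i : ℝ) * α)) * shiftSeq i a m := by
    intro m
    rw [tsum_eq_sum (s := Finset.range (m + 1)), ← Finset.sum_range_reflect]
    · refine Finset.sum_congr rfl fun i hi => ?_
      have hi' : i ≤ m := by simpa [Nat.lt_succ_iff] using hi
      rw [shiftSeq, if_pos hi', show m + 1 - 1 - i = m - i by omega,
        show m - (m - i) = i by omega]
    · intro i hi
      rw [shiftSeq, if_neg (by simp at hi; omega), mul_zero]
  simp_rw [h1]
  have h2 := eLpNorm_tsum_le hq (fun i m : ℕ => (2 : ℝ≥0∞) ^ ((m : ℝ) * s) *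
    ((2 : ℝ≥0∞) ^ (-((i : ℝ) * α)) * shiftSeq i a m)) (by
      intro i m him
      rw [shiftSeq, if_neg (by omega), mul_zero, mul_zero])
  simp_rw [ENNReal.tsum_mul_left] at h2
  refine h2.trans ?_
  rw [geomConst, ← ENNReal.tsum_mul_right]
  refine ENNReal.tsum_le_tsum fun (i : ℕ) => ?_
  refine (weightedNorm_const_mul_le (s := s) (q := q) (by simp) (shiftSeq i a)).trans ?_
  refine (mul_le_mul_right (weightedNorm_shiftSeq_le hq i a) _).trans (le_of_eq ?_)
  rw [← mul_assoc, ← ENNReal.rpow_add _ _ (by simp) (by simp)]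
  congr 2
  ring

/-- Hardy's inequality for the sequence that is `A` at `0` and vanishes elsewhere. -/
lemma weightedNorm_geom_le {s α : ℝ} {q : ℝ≥0∞} (hq : 1 ≤ q) (A : ℝ≥0∞) :
    weightedNorm s q (fun m => (2 : ℝ≥0∞) ^ (-((m : ℝ) * α)) * A) ≤ geomConst (α - s) * A := by
  have h := weightedNorm_hardy_le (s := s) (α := α) hq (fun j => if j = 0 then A else 0)
  refine le_trans (weightedNorm_mono fun m => ?_) (h.trans ?_)
  · rw [Finset.sum_eq_single 0]
    · simp
    · intro j _ hj; simp [hj]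
    · simp
  · gcongr
    have hq0 : q ≠ 0 := (zero_lt_one.trans_le hq).ne'
    rw [weightedNorm]
    rcases eq_or_ne q ∞ with rfl | hq'
    · simp only [eLpNorm_exponent_top, eLpNormEssSup_count, enorm_eq_self, iSup_le_iff]
      intro m
      by_cases hm : m = 0 <;> simp [hm]
    have hqr : 0 < q.toReal := ENNReal.toReal_pos hq0 hq'
    rw [eLpNorm_eq_lintegral_rpow_enorm_toReal hq0 hq', lintegral_count, tsum_eq_single 0]
    · simp only [enorm_eq_self, if_true, Nat.cast_zero, zero_mul, ENNReal.rpow_zero, one_mul]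
      rw [← ENNReal.rpow_mul, mul_one_div_cancel hqr.ne', ENNReal.rpow_one]
    · intro m hm
      simp [hm, hqr]

/-! ### Decomposition of norms into cells -/

/-- The coordinatewise integer part. -/
def floorPoint (x : Fin n → ℝ) : Fin n → ℤ := fun i => ⌊x i⌋

/-- The half-open unit cube with lower vertex `ν`. -/
def unitCell (ν : Fin n → ℤ) : Set (Fin n → ℝ) := floorPoint ⁻¹' {ν}

lemma measurable_floorPoint : Measurable (floorPoint : (Fin n → ℝ) → _) :=
  measurable_pi_lambda _ fun i => Int.measurable_floor.comp (measurable_pi_apply i)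

lemma measurableSet_unitCell (ν : Fin n → ℤ) : MeasurableSet (unitCell ν) :=
  measurable_floorPoint (measurableSet_singleton ν)

lemma unitCell_eq (ν : Fin n → ℤ) :
    unitCell ν = Set.pi univ fun i => Ico (ν i : ℝ) (ν i + 1) := by
  ext x
  simp only [unitCell, floorPoint, mem_preimage, mem_singleton_iff, funext_iff, mem_pi, mem_univ,
    true_implies, mem_Ico, Int.floor_eq_iff]

lemma volume_unitCell (ν : Fin n → ℤ) : volume (unitCell ν) = 1 := by
  rw [unitCell_eq, Real.volume_pi_Ico]
  simp

instance (ν : Fin n → ℤ) : IsProbabilityMeasure (volume.restrict (unitCell ν)) :=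
  ⟨by rw [Measure.restrict_apply_univ, volume_unitCell]⟩

lemma norm_sub_floorPoint_le (x : Fin n → ℝ) : ‖x - latticePoint (floorPoint x)‖ ≤ 1 := by
  rw [pi_norm_le_iff_of_nonneg zero_le_one]
  intro i
  rw [Pi.sub_apply, latticePoint_apply, floorPoint, Int.self_sub_floor, Real.norm_eq_abs,
    abs_of_nonneg (Int.fract_nonneg _)]
  exact (Int.fract_lt_one _).le

lemma restrict_sum_cells (μ : Measure (Fin n → ℝ)) :
    μ = Measure.sum fun ν => μ.restrict (unitCell ν) := by
  rw [← Measure.restrict_iUnion]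
  · have : ⋃ ν, unitCell ν = (univ : Set (Fin n → ℝ)) := by
      ext x
      simp [unitCell]
    rw [this, Measure.restrict_univ]
  · intro μ ν h
    refine Set.disjoint_left.2 fun x hx hx' => h ?_
    rw [unitCell, mem_preimage, mem_singleton_iff] at hx hx'
    rw [← hx, ← hx']
  · exact measurableSet_unitCell

/-- The `p`-th powers of the local norms add up over the tiling. The codomain is general because
complex functions and `ℝ≥0∞`-valued step functions both occur. -/
lemma eLpNorm_eq_cells {ε : Type*} [TopologicalSpace ε] [ContinuousENorm ε] (p : ℝ≥0∞) (F : (Fin n → ℝ) → ε)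
    (μ : Measure (Fin n → ℝ)) :
    eLpNorm F p μ = eLpNorm (fun ν => eLpNorm F p (μ.restrict (unitCell ν))) p Measure.count := by
  rcases eq_or_ne p 0 with rfl | hp0
  · simp
  rcases eq_or_ne p ∞ with rfl | hp'
  · simp only [eLpNorm_exponent_top, eLpNormEssSup_count, enorm_eq_self]
    apply le_antisymm
    · refine essSup_le_of_ae_le _ ?_
      rw [Filter.EventuallyLE]
      conv in ae μ => rw [restrict_sum_cells μ]
      rw [Measure.ae_sum_iff]
      intro ν
      filter_upwards [enorm_ae_le_eLpNormEssSup F (μ.restrict (unitCell ν))] with x hx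
      exact hx.trans (le_iSup (fun ν => eLpNormEssSup F (μ.restrict (unitCell ν))) ν)
    · exact iSup_le fun ν => by
        simpa only [eLpNorm_exponent_top] using
          eLpNorm_mono_measure (p := ∞) F (Measure.restrict_le_self (μ := μ) (s := unitCell ν))
  · have hpr : 0 < p.toReal := ENNReal.toReal_pos hp0 hp'
    simp only [eLpNorm_eq_lintegral_rpow_enorm_toReal hp0 hp', lintegral_count, enorm_eq_self]
    congr 1
    conv_lhs => rw [restrict_sum_cells μ]
    rw [lintegral_sum_measure]
    refine tsum_congr fun ν => ?_
    rw [← ENNReal.rpow_mul, one_div_mul_cancel hpr.ne', ENNReal.rpow_one]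

lemma eLpNorm_count_shift (p : ℝ≥0∞) (u : (Fin n → ℤ) → ℝ≥0∞) (μ : Fin n → ℤ) :
    eLpNorm (fun ν => u (ν + μ)) p Measure.count = eLpNorm u p Measure.count :=
  eLpNorm_comp_measurePreserving (g := u) AEStronglyMeasurable.of_discrete
    (measurePreserving_add_right Measure.count μ)

lemma eLpNorm_count_sum_shift_le {p : ℝ≥0∞} (hp : 1 ≤ p) (s : Finset (Fin n → ℤ))
    (u : (Fin n → ℤ) → ℝ≥0∞) :
    eLpNorm (fun ν => ∑ μ ∈ s, u (ν + μ)) p Measure.count ≤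
      s.card * eLpNorm u p Measure.count := by
  have h := eLpNorm_sum_le (p := p) (μ := Measure.count) (s := s)
    (f := fun μ (ν : Fin n → ℤ) => u (ν + μ)) (fun _ _ => AEStronglyMeasurable.of_discrete) hp
  simp_rw [eLpNorm_count_shift, Finset.sum_const, nsmul_eq_mul] at h
  refine le_trans (le_of_eq ?_) h
  congr 1
  ext ν
  simp

/-- The norm over a ball is at most the sum of the norms over the cells that it meets. -/
lemma eLpNorm_closedBall_le_sum {ε : Type*} [TopologicalSpace ε] [ContinuousENorm ε] {p : ℝ≥0∞} (hp : 1 ≤ p)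
    (F : (Fin n → ℝ) → ε) {R : ℝ} {M : ℕ} (hM : R + 1 ≤ M) (ν : Fin n → ℤ) :
    eLpNorm F p (volume.restrict (Metric.closedBall (latticePoint ν) R)) ≤
      ∑ μ ∈ latticeBox n M, eLpNorm F p (volume.restrict (unitCell (ν + μ))) := by
  have hp0 : p ≠ 0 := (zero_lt_one.trans_le hp).ne'
  set B := Metric.closedBall (latticePoint ν) R
  set u : (Fin n → ℤ) → ℝ≥0∞ := fun μ => eLpNorm F p (volume.restrict (unitCell (ν + μ)))
  rw [eLpNorm_eq_cells]
  have h1 : eLpNorm (fun μ => eLpNorm F p ((volume.restrict B).restrict (unitCell μ))) p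
      Measure.count ≤ eLpNorm (∑ κ ∈ latticeBox n M,
        indicator {ν + κ} (fun _ => u κ)) p Measure.count := by
    refine eLpNorm_mono_enorm fun μ => ?_
    rw [enorm_eq_self, enorm_eq_self, Finset.sum_apply]
    by_cases hμ : μ - ν ∈ latticeBox n M
    · rw [Finset.sum_eq_single (μ - ν)]
      · rw [indicator_of_mem (by simp)]
        simp only [u, add_sub_cancel]
        exact eLpNorm_mono_measure _ (Measure.restrict_mono_measure Measure.restrict_le_self _)
      · intro κ _ hκ
        apply indicator_of_notMem
        intro h
        apply hκ
        rw [mem_singleton_iff] at h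
        rw [h, add_sub_cancel_left]
      · exact fun h => absurd hμ h
    · have h2 : (volume.restrict B).restrict (unitCell μ) = 0 := by
        rw [Measure.restrict_restrict (measurableSet_unitCell μ)]
        have : unitCell μ ∩ B = ∅ := by
          rw [Set.eq_empty_iff_forall_notMem]
          rintro x ⟨hx, hxB⟩
          apply hμ
          apply mem_latticeBox_of_norm_le
          have h3 := norm_sub_floorPoint_le x
          rw [unitCell, mem_preimage, mem_singleton_iff] at hx
          rw [hx] at h3
          rw [Metric.mem_closedBall, dist_eq_norm] at hxB
          have h4 := norm_sub_le (x - latticePoint ν) (x - latticePoint μ)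
          rw [sub_sub_sub_cancel_left, ← latticePoint_sub] at h4
          linarith
        rw [this, Measure.restrict_empty]
      rw [h2]
      simp
  refine h1.trans ((eLpNorm_sum_le (fun _ _ => AEStronglyMeasurable.of_discrete) hp).trans ?_)
  refine Finset.sum_le_sum fun κ _ => ?_
  rw [eLpNorm_indicator_eq_eLpNorm_restrict (measurableSet_singleton _)]
  rw [Measure.restrict_singleton, Measure.count_singleton, one_smul, eLpNorm_dirac _ _ hp0,
    enorm_eq_self]

/-- Bounded overlap: each ball is covered by the same finite pattern of cells, shifted with its
center. -/
lemma eLpNorm_closedBalls_le {ε : Type*} [TopologicalSpace ε] [ContinuousENorm ε] {p : ℝ≥0∞} (hp : 1 ≤ p)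
    (F : (Fin n → ℝ) → ε) {R : ℝ} {M : ℕ} (hM : R + 1 ≤ M) :
    eLpNorm (fun ν => eLpNorm F p (volume.restrict (Metric.closedBall (latticePoint ν) R)))
      p Measure.count ≤ (latticeBox n M).card * eLpNorm F p volume := by
  refine le_trans (eLpNorm_mono_enorm fun ν => ?_)
    ((eLpNorm_count_sum_shift_le hp (latticeBox n M)
      (fun ν => eLpNorm F p (volume.restrict (unitCell ν)))).trans (le_of_eq ?_))
  · simpa only [enorm_eq_self] using eLpNorm_closedBall_le_sum hp F hM ν
  · rw [← eLpNorm_eq_cells]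

/-- Local estimates on the cells imply global ones. -/
lemma eLpNorm_le_of_cells {ε ε' : Type*} [TopologicalSpace ε] [ContinuousENorm ε]
    [TopologicalSpace ε'] [ContinuousENorm ε'] {p : ℝ≥0∞} (hp : 1 ≤ p)
    {F : (Fin n → ℝ) → ε} {G : (Fin n → ℝ) → ε'} {R : ℝ} {M : ℕ} (hM : R + 1 ≤ M) {C : ℝ≥0∞}
    (hC : C ≠ ∞)
    (h : ∀ ν, eLpNorm F p (volume.restrict (unitCell ν)) ≤
      C * eLpNorm G p (volume.restrict (Metric.closedBall (latticePoint ν) R))) :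
    eLpNorm F p volume ≤ C * (latticeBox n M).card * eLpNorm G p volume := by
  rw [eLpNorm_eq_cells]
  refine le_trans (eLpNorm_mono_enorm (g := fun ν =>
    C * eLpNorm G p (volume.restrict (Metric.closedBall (latticePoint ν) R))) fun ν => by
      simpa only [enorm_eq_self] using h ν) ?_
  refine (eLpNorm_ennreal_const_mul_le p C _ _ hC).trans ?_
  rw [mul_assoc]
  gcongr
  exact eLpNorm_closedBalls_le hp G hM

/-! ### Dilations and translations -/

/-- The power `c ^ (n / p)`. -/
def dilationFactor (n : ℕ) (p : ℝ≥0∞) (c : ℝ) : ℝ≥0∞ :=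
  ENNReal.ofReal c ^ ((n : ℝ) * (p⁻¹).toReal)

lemma dilationFactor_ne_zero {c : ℝ} (hc : 0 < c) (p : ℝ≥0∞) : dilationFactor n p c ≠ 0 := by
  rw [dilationFactor]
  exact (ENNReal.rpow_pos (by simpa using hc) (by simp)).ne'

lemma dilationFactor_ne_top {c : ℝ} (p : ℝ≥0∞) : dilationFactor n p c ≠ ∞ :=
  ENNReal.rpow_ne_top_of_nonneg (by positivity) (by simp)

lemma dilationFactor_mul {c c' : ℝ} (hc : 0 ≤ c) (p : ℝ≥0∞) :
    dilationFactor n p (c * c') = dilationFactor n p c * dilationFactor n p c' := by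
  rw [dilationFactor, ENNReal.ofReal_mul hc, ENNReal.mul_rpow_of_nonneg _ _ (by positivity)]
  rfl

lemma dilationFactor_one (p : ℝ≥0∞) : dilationFactor n p 1 = 1 := by
  simp [dilationFactor]

/-- The affine map is a measurable embedding, so `F` need not be measurable; this permits the
application to `osc`. -/
lemma eLpNorm_comp_affine {ε : Type*} [TopologicalSpace ε] [ContinuousENorm ε] (p : ℝ≥0∞)
    (F : (Fin n → ℝ) → ε)
    {c : ℝ} (hc : 0 < c) (b : Fin n → ℝ) (B : Set (Fin n → ℝ)) :
    eLpNorm F p (volume.restrict B) = dilationFactor n p c *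
      eLpNorm (fun x => F (c • x + b)) p (volume.restrict ((fun x => c • x + b) ⁻¹' B)) := by
  have hemb : MeasurableEmbedding fun x : Fin n → ℝ => c • x + b :=
    (measurableEmbedding_addRight b).comp (measurableEmbedding_const_smul₀ hc.ne')
  have hmap : Measure.map (fun x : Fin n → ℝ => c • x + b) volume =
      (ENNReal.ofReal c ^ n)⁻¹ • volume := by
    have h1 := Measure.map_addHaar_smul (volume : Measure (Fin n → ℝ)) hc.ne'
    have h2 : (fun x : Fin n → ℝ => c • x + b) = (fun x => x + b) ∘ (fun x => c • x) := rfl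
    rw [h2, ← Measure.map_map (by fun_prop) (by fun_prop), h1, Measure.map_smul,
      map_add_right_eq_self]
    congr 1
    rw [Module.finrank_fin_fun, abs_of_nonneg (by positivity),
      ENNReal.ofReal_inv_of_pos (by positivity), ENNReal.ofReal_pow hc.le]
  have h3 := hemb.eLpNorm_map_measure (μ := volume.restrict ((fun x => c • x + b) ⁻¹' B)) (g := F)
    (p := p)
  rw [← hemb.restrict_map, hmap, Measure.restrict_smul, eLpNorm_smul_measure_of_ne_zero
    (by simp)] at h3
  change _ = dilationFactor n p c * eLpNorm (F ∘ _) p _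
  rw [← h3, smul_eq_mul, ← mul_assoc]
  have h4 : dilationFactor n p c * (ENNReal.ofReal c ^ n)⁻¹ ^ (1 / p).toReal = 1 := by
    rw [dilationFactor, one_div, ENNReal.inv_rpow, ← ENNReal.rpow_natCast, ← ENNReal.rpow_mul]
    apply ENNReal.mul_inv_cancel
    · exact (ENNReal.rpow_pos (by simpa using hc) (by simp)).ne'
    · exact ENNReal.rpow_ne_top_of_nonneg (by positivity) (by simp)
  rw [h4, one_mul]

lemma eLpNorm_comp_affine_univ {ε : Type*} [TopologicalSpace ε] [ContinuousENorm ε] (p : ℝ≥0∞)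
    (F : (Fin n → ℝ) → ε) {c : ℝ} (hc : 0 < c) (b : Fin n → ℝ) :
    eLpNorm F p volume = dilationFactor n p c * eLpNorm (fun x => F (c • x + b)) p volume := by
  simpa using eLpNorm_comp_affine p F hc b univ

lemma preimage_affine_closedBall {c : ℝ} (hc : 0 < c) (b y : Fin n → ℝ) (ρ : ℝ) :
    (fun x => c • x + b) ⁻¹' Metric.closedBall (c • y + b) (c * ρ) = Metric.closedBall y ρ := by
  ext x
  simp only [mem_preimage, Metric.mem_closedBall, dist_eq_norm, add_sub_add_right_eq_sub]
  rw [← smul_sub, norm_smul, Real.norm_eq_abs, abs_of_pos hc]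
  exact mul_le_mul_iff_right₀ hc

/-! ### Local polynomial approximation -/

/-- The error of the best approximation of `f` by polynomials of degree at most `r` in the norm of
`L^p` over the ball with center `y` and radius `ρ`. -/
def localError (r : ℕ) (p : ℝ≥0∞) (f : (Fin n → ℝ) → ℂ) (y : Fin n → ℝ) (ρ : ℝ) : ℝ≥0∞ :=
  ⨅ (P : (Fin n → ℝ) → ℂ) (_ : IsPoly r P),
    eLpNorm (fun x => f x - P x) p (volume.restrict (Metric.closedBall y ρ))

lemma localError_le {r : ℕ} (p : ℝ≥0∞) (f : (Fin n → ℝ) → ℂ) (y : Fin n → ℝ) (ρ : ℝ)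
    {P : (Fin n → ℝ) → ℂ} (hP : IsPoly r P) : localError r p f y ρ ≤
      eLpNorm (fun x => f x - P x) p (volume.restrict (Metric.closedBall y ρ)) :=
  iInf₂_le P hP

lemma localError_le_eLpNorm (r : ℕ) (p : ℝ≥0∞) (f : (Fin n → ℝ) → ℂ) (y : Fin n → ℝ) (ρ : ℝ) :
    localError r p f y ρ ≤ eLpNorm f p (volume.restrict (Metric.closedBall y ρ)) := by
  simpa using localError_le p f y ρ (isPoly_const r 0)

lemma localError_congr_ae {r : ℕ} {p : ℝ≥0∞} {f g : (Fin n → ℝ) → ℂ} {y : Fin n → ℝ} {ρ : ℝ}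
    (h : f =ᵐ[volume.restrict (Metric.closedBall y ρ)] g) :
    localError r p f y ρ = localError r p g y ρ := by
  unfold localError
  have h1 : ∀ P : (Fin n → ℝ) → ℂ,
      eLpNorm (fun x => f x - P x) p (volume.restrict (Metric.closedBall y ρ)) =
      eLpNorm (fun x => g x - P x) p (volume.restrict (Metric.closedBall y ρ)) := by
    intro P
    refine eLpNorm_congr_ae ?_
    filter_upwards [h] with x hx
    rw [hx]
  simp_rw [h1]

lemma localError_add_le {r : ℕ} {p : ℝ≥0∞} (hp : 1 ≤ p) {f g : (Fin n → ℝ) → ℂ}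
    (hf : AEStronglyMeasurable f volume) (hg : AEStronglyMeasurable g volume)
    (y : Fin n → ℝ) (ρ : ℝ) :
    localError r p (fun x => f x + g x) y ρ ≤ localError r p f y ρ + localError r p g y ρ := by
  unfold localError
  rw [ENNReal.iInf₂_add]
  refine le_iInf₂ fun P hP => ?_
  rw [ENNReal.add_iInf₂]
  refine le_iInf₂ fun Q hQ => ?_
  refine (localError_le p _ y ρ (hP.add hQ)).trans ?_
  refine le_trans (le_of_eq ?_) (eLpNorm_add_le
    ((hf.sub hP.continuous.aestronglyMeasurable).restrict)
    ((hg.sub hQ.continuous.aestronglyMeasurable).restrict) hp)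
  congr 1
  ext x
  simp only [Pi.add_apply]
  ring

lemma localError_const_mul_le {r : ℕ} (p : ℝ≥0∞) (c : ℂ) (f : (Fin n → ℝ) → ℂ)
    (y : Fin n → ℝ) (ρ : ℝ) :
    localError r p (fun x => c * f x) y ρ ≤ ‖c‖ₑ * localError r p f y ρ := by
  rcases eq_or_ne c 0 with rfl | hc
  · simpa using localError_le_eLpNorm r p (fun _ => (0 : ℂ)) y ρ
  unfold localError
  simp_rw [ENNReal.mul_iInf_of_ne (enorm_ne_zero.2 hc) enorm_ne_top]
  refine le_iInf₂ fun P hP => ?_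
  refine (localError_le p _ y ρ (hP.const_mul c)).trans (le_of_eq ?_)
  rw [← eLpNorm_const_smul]
  congr 1
  ext x
  simp [mul_sub]

lemma localError_sum_le {r : ℕ} {p : ℝ≥0∞} (hp : 1 ≤ p) {ι : Type*} (s : Finset ι)
    (b : ι → ℂ) {g : ι → (Fin n → ℝ) → ℂ} (hg : ∀ i ∈ s, AEStronglyMeasurable (g i) volume)
    (y : Fin n → ℝ) (ρ : ℝ) : localError r p (fun x => ∑ i ∈ s, b i * g i x) y ρ ≤
      ∑ i ∈ s, ‖b i‖ₑ * localError r p (g i) y ρ := by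
  classical
  induction s using Finset.induction_on with
  | empty => simpa using localError_le_eLpNorm r p (fun _ => (0 : ℂ)) y ρ
  | insert i s hi ih =>
    simp_rw [Finset.sum_insert hi]
    have hgs : ∀ j ∈ s, AEStronglyMeasurable (g j) volume :=
      fun j hj => hg j (Finset.mem_insert_of_mem hj)
    refine (localError_add_le hp ((hg i (Finset.mem_insert_self _ _)).const_mul _)
      (Finset.aestronglyMeasurable_fun_sum _ fun j hj => (hgs j hj).const_mul _) y ρ).trans ?_
    exact add_le_add (localError_const_mul_le p _ _ y ρ) (ih hgs)

lemma localError_comp_affine {r : ℕ} (p : ℝ≥0∞) (f : (Fin n → ℝ) → ℂ) {c : ℝ} (hc : 0 < c)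
    (b y : Fin n → ℝ) (ρ : ℝ) : localError r p f (c • y + b) (c * ρ) =
      dilationFactor n p c * localError r p (fun x => f (c • x + b)) y ρ := by
  apply le_antisymm
  · unfold localError
    simp_rw [ENNReal.mul_iInf_of_ne (dilationFactor_ne_zero hc p) (dilationFactor_ne_top p)]
    refine le_iInf₂ fun P hP => ?_
    have hP' : IsPoly r fun x => P (c⁻¹ • x + (-(c⁻¹ • b))) := hP.comp_affine _ _
    refine (localError_le p f _ _ hP').trans (le_of_eq ?_)
    rw [eLpNorm_comp_affine p _ hc b, preimage_affine_closedBall hc]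
    congr 2
    ext x
    congr 2
    rw [smul_add, smul_smul, inv_mul_cancel₀ hc.ne', one_smul, add_neg_cancel_right]
  · refine le_iInf₂ fun P hP => ?_
    rw [eLpNorm_comp_affine p _ hc b, preimage_affine_closedBall hc]
    gcongr
    exact localError_le p _ _ _ (hP.comp_affine c b)

/-! ### A step function that dominates the oscillation -/

/-- The corner of the dyadic cube of side length `2 ^ (-m)` that contains `x`. -/
def dyadicCorner (m : ℕ) (x : Fin n → ℝ) : Fin n → ℝ :=
  ((2 : ℝ) ^ m)⁻¹ • latticePoint (floorPoint ((2 : ℝ) ^ m • x))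

/-- Normalized local errors on the scale `2 ^ (-m)`, as a step function. -/
def stepError (r : ℕ) (p : ℝ≥0∞) (f : (Fin n → ℝ) → ℂ) (m : ℕ) (x : Fin n → ℝ) : ℝ≥0∞ :=
  dilationFactor n p (2 ^ m) * localError r p f (dyadicCorner m x) (2 / 2 ^ m)

lemma measurable_comp_floorPoint {β : Type*} [MeasurableSpace β] (u : (Fin n → ℤ) → β) (c : ℝ) :
    Measurable fun x : Fin n → ℝ => u (floorPoint (c • x)) :=
  (measurable_from_top (f := u)).comp
    ((measurable_floorPoint.comp (measurable_const_smul c)).mono le_rfl (by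
      intro s _; exact s.to_countable.measurableSet))

/-- Any function of the integer part is measurable. Triangle inequalities are applied to step errors
only; for `osc` monotonicity and scaling of `eLpNorm` are enough, so its measurability in `x` is
never needed. -/
lemma measurable_stepError (r : ℕ) (p : ℝ≥0∞) (f : (Fin n → ℝ) → ℂ) (m : ℕ) :
    Measurable (stepError r p f m) :=
  measurable_comp_floorPoint (fun κ => dilationFactor n p (2 ^ m) *
    localError r p f (((2 : ℝ) ^ m)⁻¹ • latticePoint κ) (2 / 2 ^ m)) (2 ^ m)

lemma norm_sub_dyadicCorner_le (m : ℕ) (x : Fin n → ℝ) :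
    ‖x - dyadicCorner m x‖ ≤ 1 / 2 ^ m := by
  have h := norm_sub_floorPoint_le ((2 : ℝ) ^ m • x)
  have h2 : x - dyadicCorner m x = ((2 : ℝ) ^ m)⁻¹ •
      ((2 : ℝ) ^ m • x - latticePoint (floorPoint ((2 : ℝ) ^ m • x))) := by
    rw [smul_sub, smul_smul, inv_mul_cancel₀ (by positivity), one_smul]
    rfl
  rw [h2, norm_smul, norm_inv, norm_pow, Real.norm_ofNat, one_div]
  exact mul_le_of_le_one_right (by positivity) h

lemma dyadicCube_eq (c : Fin n → ℝ) (l : ℕ) (x : Fin n → ℝ) :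
    dyadicCube c l x = Set.pi univ fun i =>
      Icc (x i + c i / 2 ^ l) (x i + (c i + 1) / 2 ^ l) := by
  ext y
  simp only [dyadicCube, baseCube, Set.mem_ofPred_eq, mem_pi, mem_univ, true_implies, mem_Icc,
    Pi.smul_apply, Pi.sub_apply, smul_eq_mul]
  refine forall_congr' fun i => ?_
  have h : (0 : ℝ) < 2 ^ l := by positivity
  refine and_congr ?_ ?_
  · rw [← le_sub_iff_add_le' (a := x i), div_le_iff₀' h]
  · rw [← sub_le_iff_le_add' (b := x i), le_div_iff₀' h]

lemma volume_dyadicCube (c : Fin n → ℝ) (l : ℕ) (x : Fin n → ℝ) :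
    volume (dyadicCube c l x) = (ENNReal.ofReal (2 ^ l) ^ n)⁻¹ := by
  rw [dyadicCube_eq, Set.pi_univ_Icc, Real.volume_Icc_pi]
  have : ∀ i : Fin n, x i + (c i + 1) / 2 ^ l - (x i + c i / 2 ^ l) = ((2 : ℝ) ^ l)⁻¹ := by
    intro i; field_simp; ring
  simp_rw [this]
  rw [Finset.prod_const, Finset.card_univ, Fintype.card_fin,
    ENNReal.ofReal_inv_of_pos (by positivity), ENNReal.inv_pow]

lemma eLpNorm_dyadicCube (c : Fin n → ℝ) (p : ℝ≥0∞) (g : (Fin n → ℝ) → ℂ) (x : Fin n → ℝ) (l : ℕ) :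
    eLpNorm g p ((volume (dyadicCube c l x))⁻¹ • volume.restrict (dyadicCube c l x)) =
      dilationFactor n p (2 ^ l) * eLpNorm g p (volume.restrict (dyadicCube c l x)) := by
  rw [volume_dyadicCube, inv_inv, eLpNorm_smul_measure_of_ne_zero, smul_eq_mul, one_div,
    dilationFactor, ENNReal.rpow_mul, ENNReal.rpow_natCast]
  exact pow_ne_zero _ (by simp)

lemma corner_le_zero_of_interior {c : Fin n → ℝ} (hc : (0 : Fin n → ℝ) ∈ interior (baseCube c))
    (i : Fin n) : c i ≤ 0 ∧ 0 ≤ c i + 1 := by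
  have := interior_subset hc i
  simpa using this

/-- As `Q₀` contains the origin, points of the cube are at distance at most `2^{-m}` from `x`, and
so is the corner. -/
lemma dyadicCube_subset {c : Fin n → ℝ} (hc : (0 : Fin n → ℝ) ∈ interior (baseCube c)) (m : ℕ)
    (x : Fin n → ℝ) : dyadicCube c m x ⊆ Metric.closedBall (dyadicCorner m x) (2 / 2 ^ m) := by
  intro y hy
  rw [Metric.mem_closedBall, dist_eq_norm]
  have h1 : ‖y - x‖ ≤ 1 / 2 ^ m := by
    rw [pi_norm_le_iff_of_nonneg (by positivity)]
    intro i
    have h2 := hy i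
    have h3 := corner_le_zero_of_interior hc i
    simp only [Pi.smul_apply, Pi.sub_apply, smul_eq_mul] at h2
    have h : (0 : ℝ) < 2 ^ m := by positivity
    rw [Pi.sub_apply, Real.norm_eq_abs, le_div_iff₀ h]
    nth_rw 1 [← abs_of_pos h]
    rw [← abs_mul, mul_comm, abs_le]
    constructor <;> linarith [h2.1, h2.2]
  have h2 := norm_sub_dyadicCorner_le m x
  have h3 := norm_add_le (y - x) (x - dyadicCorner m x)
  rw [sub_add_sub_cancel] at h3
  refine h3.trans ((add_le_add h1 h2).trans (le_of_eq ?_))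
  ring

lemma osc_le_stepError {c : Fin n → ℝ} (hc : (0 : Fin n → ℝ) ∈ interior (baseCube c)) (r : ℕ)
    (p : ℝ≥0∞) (f : (Fin n → ℝ) → ℂ) (x : Fin n → ℝ) (m : ℕ) :
    osc c r p f x m ≤ stepError r p f m x := by
  unfold stepError localError
  simp_rw [ENNReal.mul_iInf_of_ne (dilationFactor_ne_zero (n := n) (c := 2 ^ m) (by positivity) p)
    (dilationFactor_ne_top p)]
  refine le_iInf₂ fun Q ⟨P, hP, hPQ⟩ => ?_
  refine (iInf₂_le P hP).trans ?_
  rw [eLpNorm_dyadicCube]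
  gcongr
  have h : (fun y => f y - Q y) =
      fun y => f y - MvPolynomial.eval (fun i => (y i : ℂ)) P := by
    ext y
    rw [← hPQ y]
    rfl
  rw [h]
  exact eLpNorm_mono_measure _ (Measure.restrict_mono_set _ (dyadicCube_subset hc m x))

lemma stepError_add_le {r : ℕ} {p : ℝ≥0∞} (hp : 1 ≤ p) {f g : (Fin n → ℝ) → ℂ}
    (hf : AEStronglyMeasurable f volume) (hg : AEStronglyMeasurable g volume) (m : ℕ)
    (x : Fin n → ℝ) :
    stepError r p (fun x => f x + g x) m x ≤ stepError r p f m x + stepError r p g m x := by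
  unfold stepError
  rw [← mul_add]
  gcongr
  exact localError_add_le hp hf hg _ _

/-- Dilation of the argument of a step error. -/
lemma stepError_comp_dilation (r : ℕ) (p : ℝ≥0∞) (g : (Fin n → ℝ) → ℂ) {m j : ℕ} (h : j ≤ m)
    (x : Fin n → ℝ) : stepError r p (fun x => g ((2 : ℝ) ^ j • x)) m x =
      stepError r p g (m - j) ((2 : ℝ) ^ j • x) := by
  obtain ⟨i, rfl⟩ := Nat.exists_eq_add_of_le h
  have h2 : (0 : ℝ) < 2 ^ j := by positivity
  rw [stepError, stepError, Nat.add_sub_cancel_left]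
  have h3 := localError_comp_affine (r := r) p g h2 0 (dyadicCorner (j + i) x) (2 / 2 ^ (j + i))
  simp only [add_zero] at h3
  have h4 : (2 : ℝ) ^ j • dyadicCorner (j + i) x = dyadicCorner i ((2 : ℝ) ^ j • x) := by
    unfold dyadicCorner
    rw [smul_smul, smul_smul, pow_add, mul_comm ((2 : ℝ) ^ i)]
    congr 1
    field_simp
  have h5 : (2 : ℝ) ^ j * (2 / 2 ^ (j + i)) = 2 / 2 ^ i := by
    rw [pow_add]; field_simp
  rw [h4, h5] at h3
  rw [h3, pow_add, mul_comm ((2 : ℝ) ^ j), dilationFactor_mul (by positivity), mul_assoc]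

/-- Integer translations of the argument of a step error. -/
lemma stepError_comp_translation (r : ℕ) (p : ℝ≥0∞) (f : (Fin n → ℝ) → ℂ) (m : ℕ)
    (ν : Fin n → ℤ) (x : Fin n → ℝ) :
    stepError r p (fun x => f (x + latticePoint ν)) m x =
      stepError r p f m (x + latticePoint ν) := by
  rw [stepError, stepError]
  have h3 := localError_comp_affine (r := r) p f one_pos (latticePoint ν) (dyadicCorner m x)
    (2 / 2 ^ m)
  simp only [one_smul, one_mul, dilationFactor_one] at h3
  rw [← h3]
  congr 2
  unfold dyadicCorner
  have h4 : floorPoint ((2 : ℝ) ^ m • (x + latticePoint ν)) =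
      floorPoint ((2 : ℝ) ^ m • x) + (2 ^ m : ℤ) • ν := by
    ext i
    simp only [floorPoint, Pi.smul_apply, Pi.add_apply, smul_eq_mul, latticePoint_apply, mul_add]
    rw [← Int.floor_add_intCast]
    push_cast
    rfl
  have h5 : latticePoint ((2 ^ m : ℤ) • ν) = (2 : ℝ) ^ m • latticePoint ν := by
    ext i; simp
  rw [h4, latticePoint_add, h5, smul_add, smul_smul, inv_mul_cancel₀ (by positivity), one_smul]

lemma eLpNorm_comp_floorPoint {p : ℝ≥0∞} (hp : p ≠ 0) (u : (Fin n → ℤ) → ℝ≥0∞) :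
    eLpNorm (fun x : Fin n → ℝ => u (floorPoint x)) p volume = eLpNorm u p Measure.count := by
  rw [eLpNorm_eq_cells]
  congr 1
  ext ν
  have h : (fun x : Fin n → ℝ => u (floorPoint x)) =ᵐ[volume.restrict (unitCell ν)]
      fun _ => u ν := by
    filter_upwards [ae_restrict_mem (measurableSet_unitCell ν)] with x hx
    rw [unitCell, mem_preimage, mem_singleton_iff] at hx
    rw [hx]
  rw [eLpNorm_congr_ae h, eLpNorm_const _ hp (NeZero.ne _)]
  simp

/-- Step errors are bounded by the norm of the function. -/
lemma eLpNorm_stepError_le {p : ℝ≥0∞} (hp : 1 ≤ p) (r : ℕ) (f : (Fin n → ℝ) → ℂ) (m : ℕ) :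
    eLpNorm (stepError r p f m) p volume ≤ (latticeBox n 3).card * eLpNorm f p volume := by
  have hp0 : p ≠ 0 := (zero_lt_one.trans_le hp).ne'
  have hc : (0 : ℝ) < 2 ^ m := by positivity
  -- Rescaling reduces the claim to level `0`, where balls of radius `2` about the lattice points
  -- have bounded overlap.
  set g : (Fin n → ℝ) → ℂ := fun x => f (((2 : ℝ) ^ m)⁻¹ • x) with hg
  have hfg : f = fun x => g ((2 : ℝ) ^ m • x) := by
    ext x
    simp only [hg, smul_smul, inv_mul_cancel₀ hc.ne', one_smul]
  have h0 : eLpNorm (stepError r p g 0) p volume ≤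
      (latticeBox n 3).card * eLpNorm g p volume := by
    refine le_trans ?_ (eLpNorm_closedBalls_le hp g (R := 2) (M := 3) (by norm_num))
    rw [← eLpNorm_comp_floorPoint hp0]
    refine eLpNorm_mono_enorm fun x => ?_
    simp only [enorm_eq_self, stepError, dyadicCorner, pow_zero, dilationFactor_one, one_mul,
      inv_one, one_smul, div_one]
    exact localError_le_eLpNorm _ _ _ _ _
  have h1 : stepError r p f m = fun x => stepError r p g 0 ((2 : ℝ) ^ m • x) := by
    ext x
    rw [hfg, stepError_comp_dilation r p g le_rfl, Nat.sub_self]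
  have h2 := eLpNorm_comp_affine_univ p (stepError r p g 0) hc (0 : Fin n → ℝ)
  have h3 := eLpNorm_comp_affine_univ p g hc (0 : Fin n → ℝ)
  simp only [add_zero] at h2 h3
  rw [← h1] at h2
  rw [← hfg] at h3
  rw [h2, h3, mul_left_comm] at h0
  exact (ENNReal.mul_le_mul_iff_right (dilationFactor_ne_zero hc p) (dilationFactor_ne_top p)).1 h0

/-! ### The step errors of a spline -/

/-- The exponent of smoothness of splines of order `k` that is visible to polynomials of degree
`r`. -/
def smoothExp (p : ℝ≥0∞) (k r : ℕ) : ℝ :=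
  (r + 1 : ℕ) * (p⁻¹).toReal + (min (r + 1) (k - 1) : ℕ) * (1 - (p⁻¹).toReal)

/-- Refinement by `N = 2^m` makes the spline a series on scale `2^{-m}` with the mask as
coefficients. Its local errors are controlled by nearby differences of order `r + 1` of the mask,
which `maskNorm_wordMask_le` bounds in `ℓ^p`. The constant does not depend on the translation `τ`.
-/
lemma eLpNorm_stepError_spline_le [NeZero n] {p : ℝ≥0∞} (hp : 1 ≤ p) {k r : ℕ}
    {d : Fin (n + 1) → ℕ} (hd : HasOrder d k) (hr : r + 1 ≤ k) :
    ∃ C : ℝ≥0∞, C ≠ ∞ ∧ ∀ (m : ℕ) (τ : Fin n → ℝ),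
      eLpNorm (stepError r p (fun x => (spline d (x + τ) : ℂ)) m) p volume ≤
        C * (2 : ℝ≥0∞) ^ (-((m : ℝ) * smoothExp p k r)) := by
  have hp0 : p ≠ 0 := (zero_lt_one.trans_le hp).ne'
  have hd1 : HasOrder d 1 := hd.of_le (by omega)
  -- Radius `3`: the rescaled ball has radius `2`, and the fractional part of `N τ` adds at most
  -- `1`. The `4` below is the side length of the rescaled ball.
  obtain ⟨C₀, M, hCM⟩ := polyApprox_splineSeries r d (hd.of_le hr) 3 (by norm_num)
  set A : ℝ≥0∞ := dilationFactor n p 4 * C₀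
  have hA : A ≠ ∞ := ENNReal.mul_ne_top (dilationFactor_ne_top p) (by simp)
  set D : ℝ≥0∞ := Fintype.card (Fin (r + 1) → Fin (n + 1)) * (2 * (n + 1 : ℕ)) ^ (r + 1)
  have hD : D ≠ ∞ := ENNReal.mul_ne_top (by simp)
    (ENNReal.pow_ne_top (ENNReal.mul_ne_top (by simp) (by simp)))
  refine ⟨A * ((latticeBox n M).card * D), ENNReal.mul_ne_top hA (ENNReal.mul_ne_top (by simp) hD),
    fun m τ => ?_⟩
  set N : ℕ := 2 ^ m
  have hN : N ≠ 0 := by positivity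
  have hNr : (N : ℝ) = 2 ^ m := by simp [N]
  have hN0 : (0 : ℝ) < N := by positivity
  set b : (Fin n → ℤ) → ℂ := fun ν => (splineMask N d).coeff ν with hb
  set u : (Fin n → ℤ) → ℝ≥0∞ := fun ν =>
    ∑ w : Fin (r + 1) → Fin (n + 1), ‖wordDiff (List.ofFn w) b ν‖ₑ
  set κ₀ : Fin n → ℤ := floorPoint ((N : ℝ) • τ)
  have hmain : ∀ x, stepError r p (fun x => (spline d (x + τ) : ℂ)) m x ≤
      A * ∑ ν ∈ latticeBox n M, u (floorPoint ((2 : ℝ) ^ m • x) + κ₀ + ν) := by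
    intro x
    set κ := floorPoint ((2 : ℝ) ^ m • x) with hκ
    set κ' := κ + κ₀ with hκ'
    set ε : ℝ := ∑ ν ∈ latticeBox n M, ∑ w : Fin (r + 1) → Fin (n + 1),
      ‖wordDiff (List.ofFn w) b (κ' + ν)‖ with hε
    have hε0 : 0 ≤ ε := Finset.sum_nonneg fun _ _ => Finset.sum_nonneg fun _ _ => norm_nonneg _
    have hεu : ENNReal.ofReal ε = ∑ ν ∈ latticeBox n M, u (κ' + ν) := by
      rw [hε, ENNReal.ofReal_sum_of_nonneg
        fun _ _ => Finset.sum_nonneg fun _ _ => norm_nonneg _]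
      refine Finset.sum_congr rfl fun ν _ => ?_
      rw [ENNReal.ofReal_sum_of_nonneg fun _ _ => norm_nonneg _]
      exact Finset.sum_congr rfl fun w _ => ofReal_norm _
    obtain ⟨P, hP, happ⟩ := hCM (fun μ => b (μ + κ')) ε hε0 (by
      intro w hw ν hν
      rw [wordDiff_shift, add_comm]
      have h1 : ∃ w' : Fin (r + 1) → Fin (n + 1), List.ofFn w' = w := by
        rw [← hw]
        exact ⟨w.get, List.ofFn_get w⟩
      obtain ⟨w', rfl⟩ := h1
      refine le_trans ?_ (Finset.single_le_sum (f := fun ν => ∑ w : Fin (r + 1) → Fin (n + 1),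
        ‖wordDiff (List.ofFn w) b (κ' + ν)‖)
        (fun _ _ => Finset.sum_nonneg fun _ _ => norm_nonneg _) hν)
      exact Finset.single_le_sum (f := fun w : Fin (r + 1) → Fin (n + 1) =>
        ‖wordDiff (List.ofFn w) b (κ' + ν)‖) (fun _ _ => norm_nonneg _) (Finset.mem_univ w'))
    set β : Fin n → ℝ := (N : ℝ) • τ - latticePoint κ'
    have hβ : IsPoly r fun y => P ((N : ℝ) • y + β) := hP.comp_affine _ _
    have hloc : localError r p (fun x => (spline d (x + τ) : ℂ)) (dyadicCorner m x) (2 / 2 ^ m) ≤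
        dilationFactor n p (4 / 2 ^ m) * ENNReal.ofReal (C₀ * ε) := by
      refine (localError_le p _ _ _ hβ).trans ?_
      have hball : ∀ y ∈ Metric.closedBall (dyadicCorner m x) (2 / 2 ^ m),
          ‖(spline d (y + τ) : ℂ) - P ((N : ℝ) • y + β)‖ ≤ C₀ * ε := by
        intro y hy
        have h1 : (spline d (y + τ) : ℂ) =
            splineSeries d (fun μ => b (μ + κ')) ((N : ℝ) • y + β) := by
          have h2 := splineSeries_shift d b ((N : ℝ) • y + β) (-κ')
          simp only [sub_neg_eq_add] at h2
          rw [spline_refinement hd1 hN, ← h2]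
          congr 1
          have h3 : latticePoint (-κ') = -latticePoint κ' := by ext; simp
          rw [h3, smul_add]
          simp only [β]
          abel
        rw [h1]
        apply happ
        have h4 : (N : ℝ) • y + β = ((N : ℝ) • (y - dyadicCorner m x)) +
            ((N : ℝ) • τ - latticePoint κ₀) := by
          have h5 : (N : ℝ) • dyadicCorner m x = latticePoint κ := by
            rw [hNr, dyadicCorner, smul_smul, mul_inv_cancel₀ (by positivity), one_smul]
          rw [smul_sub, h5]
          simp only [β, hκ', latticePoint_add]
          abel
        rw [h4]
        refine (norm_add_le _ _).trans ?_
        rw [norm_smul, Real.norm_eq_abs, abs_of_pos hN0]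
        rw [Metric.mem_closedBall, dist_eq_norm] at hy
        have h6 := norm_sub_floorPoint_le ((N : ℝ) • τ)
        have h7 : (N : ℝ) * ‖y - dyadicCorner m x‖ ≤ 2 := by
          calc (N : ℝ) * ‖y - dyadicCorner m x‖ ≤ N * (2 / 2 ^ m) := by gcongr
            _ = 2 := by rw [hNr]; field_simp
        linarith
      refine (eLpNorm_le_of_ae_bound (C := C₀ * ε) ?_).trans ?_
      · filter_upwards [ae_restrict_mem Metric.isClosed_closedBall.measurableSet] with y hy
        exact hball y hy
      · rw [Measure.restrict_apply_univ, Real.volume_pi_closedBall _ (by positivity),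
          Fintype.card_fin]
        refine le_of_eq ?_
        congr 1
        rw [dilationFactor, ENNReal.toReal_inv, ENNReal.rpow_mul, ENNReal.rpow_natCast,
          ← ENNReal.ofReal_pow (by positivity)]
        congr 3
        ring
    rw [stepError]
    calc _ ≤ dilationFactor n p (2 ^ m) * (dilationFactor n p (4 / 2 ^ m) *
          ENNReal.ofReal (C₀ * ε)) := by gcongr
      _ = _ := by
        rw [← mul_assoc, ← dilationFactor_mul (by positivity), mul_div_cancel₀ _ (by positivity),
          ENNReal.ofReal_mul (by positivity), ENNReal.ofReal_coe_nnreal, hεu, mul_assoc]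
  have hu : eLpNorm u p Measure.count ≤
      D * (N : ℝ≥0∞) ^ ((n : ℝ) * (p⁻¹).toReal - smoothExp p k r) := by
    have h1 := eLpNorm_sum_le (p := p) (μ := Measure.count)
      (s := (Finset.univ : Finset (Fin (r + 1) → Fin (n + 1))))
      (f := fun w ν => ‖wordDiff (List.ofFn w) b ν‖ₑ)
      (fun _ _ => AEStronglyMeasurable.of_discrete) hp
    have h2 : u = ∑ w : Fin (r + 1) → Fin (n + 1), fun ν => ‖wordDiff (List.ofFn w) b ν‖ₑ := by
      ext ν
      simp [u]
    rw [← h2] at h1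
    refine h1.trans ?_
    have h3 : ∀ w ∈ (Finset.univ : Finset (Fin (r + 1) → Fin (n + 1))),
        eLpNorm (fun ν => ‖wordDiff (List.ofFn w) b ν‖ₑ) p Measure.count ≤
        (2 * (n + 1 : ℕ)) ^ (r + 1) *
          (N : ℝ≥0∞) ^ ((n : ℝ) * (p⁻¹).toReal - smoothExp p k r) := by
      intro w _
      have h4 := maskNorm_wordMask_le hp (by omega) hd (w := List.ofFn w) (by simpa using hr) hN
      rw [maskNorm, coeff_wordMask_mul, List.length_ofFn] at h4
      exact (le_of_eq (eLpNorm_enorm _)).trans h4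
    refine (Finset.sum_le_sum h3).trans (le_of_eq ?_)
    rw [Finset.sum_const, nsmul_eq_mul, Finset.card_univ, mul_assoc]
  have hsum : eLpNorm (fun κ => A * ∑ ν ∈ latticeBox n M, u (κ + κ₀ + ν)) p Measure.count ≤
      A * ((latticeBox n M).card * eLpNorm u p Measure.count) := by
    refine (eLpNorm_ennreal_const_mul_le p A _ _ hA).trans ?_
    gcongr
    have h1 := eLpNorm_count_sum_shift_le hp (latticeBox n M) u
    rwa [← eLpNorm_count_shift p (fun κ => ∑ ν ∈ latticeBox n M, u (κ + ν)) κ₀] at h1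
  have hscale := eLpNorm_comp_affine_univ p (fun x : Fin n → ℝ =>
    A * ∑ ν ∈ latticeBox n M, u (floorPoint x + κ₀ + ν)) hN0 0
  rw [eLpNorm_comp_floorPoint hp0 fun κ => A * ∑ ν ∈ latticeBox n M, u (κ + κ₀ + ν)] at hscale
  simp only [add_zero] at hscale
  have hdil : dilationFactor n p N = (N : ℝ≥0∞) ^ ((n : ℝ) * (p⁻¹).toReal) := by
    rw [dilationFactor, ENNReal.ofReal_natCast]
  -- Multiplied by `N^{n/p}`, the `L^p` norm of a step function on scale `1/N` becomes the `ℓ^p`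
  -- norm of its values. The same power in the bound for the mask then cancels.
  rw [← ENNReal.mul_le_mul_iff_right (dilationFactor_ne_zero (n := n) hN0 p)
    (dilationFactor_ne_top p)]
  calc _ ≤ dilationFactor n p N * eLpNorm (fun x : Fin n → ℝ =>
        A * ∑ ν ∈ latticeBox n M, u (floorPoint ((N : ℝ) • x) + κ₀ + ν)) p volume := by
        gcongr
        refine eLpNorm_mono_enorm fun x => ?_
        rw [enorm_eq_self, enorm_eq_self, hNr]
        exact hmain x
    _ ≤ A * ((latticeBox n M).card *
        (D * (N : ℝ≥0∞) ^ ((n : ℝ) * (p⁻¹).toReal - smoothExp p k r))) := by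
        rw [← hscale]
        refine hsum.trans ?_
        gcongr
    _ = _ := by
        have h6 : (N : ℝ≥0∞) ^ (-smoothExp p k r) =
            (2 : ℝ≥0∞) ^ (-((m : ℝ) * smoothExp p k r)) := by
          rw [neg_mul_eq_mul_neg, ENNReal.rpow_mul, ENNReal.rpow_natCast]
          simp [N]
        rw [hdil, sub_eq_add_neg, ENNReal.rpow_add _ _ (by exact_mod_cast hN) (by simp), h6]
        ring

/-! ### The Bernstein inequality -/

/-- The elements of the span of finitely many `L^p` functions have representations with
coefficients that are bounded by the norm. -/
lemma exists_coeff_bound {Ω ι : Type*} [MeasurableSpace Ω] [Fintype ι] {μ : Measure Ω}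
    {p : ℝ≥0∞} (hp : 1 ≤ p) {g : ι → Ω → ℂ} (hg : ∀ i, MemLp (g i) p μ) :
    ∃ C : ℝ≥0∞, C ≠ ∞ ∧ ∀ b : ι → ℂ, ∃ b' : ι → ℂ,
      (fun x => ∑ i, b i * g i x) =ᵐ[μ] (fun x => ∑ i, b' i * g i x) ∧
      ∀ i, ‖b' i‖ₑ ≤ C * eLpNorm (fun x => ∑ i, b i * g i x) p μ := by
  have : Fact (1 ≤ p) := ⟨hp⟩
  let L : (ι → ℂ) →ₗ[ℂ] Lp ℂ p μ := Fintype.linearCombination ℂ (fun i => (hg i).toLp (g i))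
  have hL : ∀ b, (fun x => ∑ i, b i * g i x) =ᵐ[μ] L b := by
    intro b
    have h1 : L b = ∑ i, b i • (hg i).toLp (g i) := Fintype.linearCombination_apply ..
    have h2 : MemLp (fun x => ∑ i, b i * g i x) p μ :=
      memLp_finsetSum _ fun i _ => (hg i).const_mul (b i)
    have h3 : L b = h2.toLp _ := by
      rw [h1]
      have h4 : ∀ i, b i • (hg i).toLp (g i) = ((hg i).const_smul (b i)).toLp _ := fun i =>
        (MemLp.toLp_const_smul _ _).symm
      simp_rw [h4]
      apply Lp.ext
      refine (Lp.coeFn_finsetSum _ _).trans ?_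
      have h5 : ∀ᵐ x ∂μ, ∀ i, (((hg i).const_smul (b i)).toLp _ : Ω → ℂ) x = b i * g i x := by
        rw [ae_all_iff]
        intro i
        exact ((hg i).const_smul (b i)).coeFn_toLp
      filter_upwards [h5, h2.coeFn_toLp] with x hx hx2
      rw [hx2, Finset.sum_apply]
      exact Finset.sum_congr rfl fun i _ => hx i
    rw [h3]
    exact h2.coeFn_toLp.symm
  -- A linear right inverse on the finite-dimensional range is automatically bounded, so the
  -- functions `g i` may be linearly dependent.
  obtain ⟨s, hs⟩ := L.rangeRestrict.exists_rightInverse_of_surjective L.range_rangeRestrict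
  let s' : L.range →L[ℂ] (ι → ℂ) := LinearMap.toContinuousLinearMap s
  refine ⟨‖s'‖ₑ, enorm_ne_top, fun b => ⟨s (L.rangeRestrict b), ?_, fun i => ?_⟩⟩
  · refine (hL b).trans ?_
    have h1 : L (s (L.rangeRestrict b)) = L b := by
      have h2 := LinearMap.congr_fun hs (L.rangeRestrict b)
      exact congrArg Subtype.val h2
    rw [← h1]
    exact (hL _).symm
  · rw [eLpNorm_congr_ae (hL b), ← Lp.enorm_def]
    have h1 : ‖s' (L.rangeRestrict b)‖ₑ ≤ ‖s'‖ₑ * ‖L.rangeRestrict b‖ₑ :=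
      s'.le_opENorm _
    refine le_trans ?_ h1
    rw [enorm_le_iff_norm_le]
    exact norm_le_pi_norm (s' (L.rangeRestrict b)) i

lemma eLpNorm_unitCell_translate {ε : Type*} [TopologicalSpace ε] [ContinuousENorm ε] (p : ℝ≥0∞)
    (F : (Fin n → ℝ) → ε) (ν : Fin n → ℤ) :
    eLpNorm F p (volume.restrict (unitCell ν)) =
      eLpNorm (fun x => F (x + latticePoint ν)) p (volume.restrict (unitCell 0)) := by
  have h := eLpNorm_comp_affine p F one_pos (latticePoint ν) (unitCell ν)
  simp only [one_smul, dilationFactor_one, one_mul] at h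
  rw [h]
  congr 2
  ext x
  simp [unitCell, floorPoint, funext_iff]

lemma eLpNorm_closedBall_translate {ε : Type*} [TopologicalSpace ε] [ContinuousENorm ε]
    (p : ℝ≥0∞) (F : (Fin n → ℝ) → ε) (ν : Fin n → ℤ) (R : ℝ) :
    eLpNorm F p (volume.restrict (Metric.closedBall (latticePoint ν) R)) =
      eLpNorm (fun x => F (x + latticePoint ν)) p (volume.restrict (Metric.closedBall 0 R)) := by
  have h := eLpNorm_comp_affine p F one_pos (latticePoint ν) (Metric.closedBall (latticePoint ν) R)
  have h2 := preimage_affine_closedBall one_pos (latticePoint ν) 0 R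
  simp only [one_smul, dilationFactor_one, one_mul, zero_add] at h h2
  rw [h, h2]

lemma closedBall_dyadicCorner_subset {x : Fin n → ℝ} (hx : x ∈ unitCell 0) (m : ℕ) :
    Metric.closedBall (dyadicCorner m x) (2 / 2 ^ m) ⊆ Metric.closedBall 0 4 := by
  intro y hy
  rw [Metric.mem_closedBall, dist_eq_norm] at hy ⊢
  have h1 := norm_sub_dyadicCorner_le m x
  have h2 := norm_sub_floorPoint_le x
  rw [show floorPoint x = 0 from hx] at h2
  have h3 : latticePoint (0 : Fin n → ℤ) = 0 := by ext; simp
  rw [h3] at h2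
  have h4 : y - 0 = (y - dyadicCorner m x) - (x - dyadicCorner m x) + (x - 0) := by abel
  have h5 : (1 : ℝ) ≤ 2 ^ m := one_le_pow₀ (by norm_num)
  have h6 : (1 : ℝ) / 2 ^ m ≤ 1 := by rw [div_le_one (by positivity)]; exact h5
  have h7 : (2 : ℝ) / 2 ^ m ≤ 2 := by
    rw [div_le_iff₀ (by positivity)]; linarith
  rw [h4]
  refine (norm_add_le _ _).trans ((add_le_add (norm_sub_le _ _) le_rfl).trans ?_)
  linarith

/-- The sum of a spline series and of a dilated spline series. -/
def twoScaleSum (d : Fin (n + 1) → ℕ) (τ : Fin n → ℝ) (a b : (Fin n → ℤ) → ℂ)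
    (x : Fin n → ℝ) : ℂ :=
  splineSeries d a (x + τ) + splineSeries d b ((2 : ℝ) • x + τ)

lemma twoScaleSum_translate (d : Fin (n + 1) → ℕ) (τ : Fin n → ℝ) (a b : (Fin n → ℤ) → ℂ)
    (ν : Fin n → ℤ) (x : Fin n → ℝ) : twoScaleSum d τ a b (x + latticePoint ν) =
      twoScaleSum d τ (fun μ => a (μ + ν)) (fun μ => b (μ + (2 : ℤ) • ν)) x := by
  have h1 : ∀ (μ : Fin n → ℤ), latticePoint (-μ) = -latticePoint μ := by intro μ; ext; simp
  have h2 : (2 : ℝ) • latticePoint ν = latticePoint ((2 : ℤ) • ν) := by ext; simp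
  rw [twoScaleSum, twoScaleSum]
  congr 1
  · have h3 := splineSeries_shift d a (x + τ) (-ν)
    simp only [sub_neg_eq_add, h1] at h3
    rw [← h3, add_right_comm]
  · have h3 := splineSeries_shift d b ((2 : ℝ) • x + τ) (-((2 : ℤ) • ν))
    simp only [sub_neg_eq_add, h1] at h3
    rw [← h3, smul_add, h2, add_right_comm]

lemma memLp_spline [NeZero n] {d : Fin (n + 1) → ℕ} (hd : HasOrder d 1) (p : ℝ≥0∞) :
    MemLp (fun x => (spline d x : ℂ)) p volume := by
  have h : (fun x => (spline d x : ℂ)) = (Metric.closedBall 0 (splineRadius d)).indicator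
      fun x => (spline d x : ℂ) := by
    ext x
    by_cases hx : x ∈ Metric.closedBall 0 (splineRadius d)
    · rw [indicator_of_mem hx]
    · rw [indicator_of_notMem hx, spline_eq_zero hd, Complex.ofReal_zero]
      simpa using hx
  have hmeas : Measurable fun x => (spline d x : ℂ) :=
    Complex.measurable_ofReal.comp (measurable_spline hd)
  rw [h, memLp_indicator_iff_restrict Metric.isClosed_closedBall.measurableSet]
  have : IsFiniteMeasure (volume.restrict (Metric.closedBall (0 : Fin n → ℝ) (splineRadius d))) :=
    ⟨by rw [Measure.restrict_apply_univ]; exact measure_closedBall_lt_top⟩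
  exact MemLp.of_bound hmeas.aestronglyMeasurable 1
    (Filter.Eventually.of_forall fun x => norm_spline_le_one hd x)

/-- Dilation by `2` turns level `m + 1` into level `m` and costs the constant `E`. At level `0` the
error is bounded by the norm of the function. -/
lemma eLpNorm_stepError_dilated_spline_le [NeZero n] {p : ℝ≥0∞} (hp : 1 ≤ p) {k r : ℕ}
    {d : Fin (n + 1) → ℕ} (hd : HasOrder d k) (hr : r + 1 ≤ k) :
    ∃ C : ℝ≥0∞, C ≠ ∞ ∧ ∀ (m : ℕ) (τ : Fin n → ℝ),
      eLpNorm (stepError r p (fun x => (spline d ((2 : ℝ) • x + τ) : ℂ)) m) p volume ≤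
        C * (2 : ℝ≥0∞) ^ (-((m : ℝ) * smoothExp p k r)) := by
  obtain ⟨C, hC, h⟩ := eLpNorm_stepError_spline_le hp hd hr
  have hd1 : HasOrder d 1 := hd.of_le (by omega)
  set A := (latticeBox n 3).card * eLpNorm (fun x => (spline d x : ℂ)) p volume
  have hA : A ≠ ∞ := ENNReal.mul_ne_top (by simp) (memLp_spline hd1 p).2.ne
  have hδ : (dilationFactor n p 2)⁻¹ ≠ ∞ :=
    ENNReal.inv_ne_top.2 (dilationFactor_ne_zero (by norm_num) p)
  set E := (2 : ℝ≥0∞) ^ smoothExp p k r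
  have hE : E ≠ ∞ := by
    simp only [E, ne_eq, ENNReal.rpow_eq_top_iff]; simp
  refine ⟨(dilationFactor n p 2)⁻¹ * (A + C * E), ENNReal.mul_ne_top hδ (ENNReal.add_ne_top.2
    ⟨hA, ENNReal.mul_ne_top hC hE⟩), fun m τ => ?_⟩
  rw [mul_assoc, ← ENNReal.mul_le_iff_le_inv (dilationFactor_ne_zero (by norm_num) p)
    (dilationFactor_ne_top p)]
  rcases m with _ | m
  · have h1 := eLpNorm_comp_affine_univ p (fun x => (spline d x : ℂ)) two_pos τ
    calc _ ≤ dilationFactor n p 2 * ((latticeBox n 3).card *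
          eLpNorm (fun x => (spline d ((2 : ℝ) • x + τ) : ℂ)) p volume) := by
          gcongr
          exact eLpNorm_stepError_le hp _ _ _
      _ = A := by rw [mul_left_comm, ← h1]
      _ ≤ _ := by simp
  · have h1 : stepError r p (fun x => (spline d ((2 : ℝ) • x + τ) : ℂ)) (m + 1) =
        fun x => stepError r p (fun x => (spline d (x + τ) : ℂ)) m ((2 : ℝ) • x + 0) := by
      ext x
      have h2 := stepError_comp_dilation r p (fun x => (spline d (x + τ) : ℂ))
        (show 1 ≤ m + 1 by omega) x
      simpa only [pow_one, Nat.add_sub_cancel, add_zero] using h2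
    have h2 := eLpNorm_comp_affine_univ p (stepError r p (fun x => (spline d (x + τ) : ℂ)) m)
      two_pos 0
    rw [h1, ← h2]
    refine (h m τ).trans ?_
    have h3 : (2 : ℝ≥0∞) ^ (-((m : ℝ) * smoothExp p k r)) =
        E * (2 : ℝ≥0∞) ^ (-(((m + 1 : ℕ) : ℝ) * smoothExp p k r)) := by
      rw [← ENNReal.rpow_add _ _ (by simp) (by simp)]
      congr 1
      push_cast
      ring
    rw [h3, ← mul_assoc]
    gcongr
    exact le_add_self

/-- Step errors on the unit cell only see the ball `B` of radius `4`, on which finitely many shifts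
are active. Their restrictions to `B` may be dependent, so the given coefficients are not controlled
by the local norm. They are replaced by those of `exists_coeff_bound`, which represent the same
function a.e. on `B`. -/
lemma eLpNorm_stepError_twoScaleSum_unitCell_le [NeZero n] {p : ℝ≥0∞} (hp : 1 ≤ p) {k r : ℕ}
    {d : Fin (n + 1) → ℕ} (hd : HasOrder d k) (hr : r + 1 ≤ k) (τ : Fin n → ℝ) :
    ∃ C : ℝ≥0∞, C ≠ ∞ ∧ ∀ (a b : (Fin n → ℤ) → ℂ) (m : ℕ),
      eLpNorm (stepError r p (twoScaleSum d τ a b) m) p (volume.restrict (unitCell 0)) ≤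
        C * (2 : ℝ≥0∞) ^ (-((m : ℝ) * smoothExp p k r)) *
          eLpNorm (twoScaleSum d τ a b) p (volume.restrict (Metric.closedBall 0 4)) := by
  have hd1 : HasOrder d 1 := hd.of_le (by omega)
  obtain ⟨C₁, hC₁, h₁⟩ := eLpNorm_stepError_spline_le hp hd hr
  obtain ⟨C₂, hC₂, h₂⟩ := eLpNorm_stepError_dilated_spline_le hp hd hr
  -- On `B` the argument `2 x + τ` has norm at most `8 + ‖τ‖`.
  obtain ⟨M, hM⟩ := exists_nat_ge (8 + ‖τ‖ + splineRadius d)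
  let ι := latticeBox n M ⊕ latticeBox n M
  let g : ι → (Fin n → ℝ) → ℂ := Sum.elim
    (fun μ x => (spline d (x + (τ - latticePoint μ.1)) : ℂ))
    (fun μ x => (spline d ((2 : ℝ) • x + (τ - latticePoint μ.1)) : ℂ))
  have hmeas : ∀ i, Measurable (g i) := by
    rintro (μ | μ)
    · exact Complex.measurable_ofReal.comp ((measurable_spline hd1).comp (by fun_prop))
    · exact Complex.measurable_ofReal.comp ((measurable_spline hd1).comp (by fun_prop))
  set B : Set (Fin n → ℝ) := Metric.closedBall 0 4
  have : IsFiniteMeasure (volume.restrict B) :=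
    ⟨by rw [Measure.restrict_apply_univ]; exact measure_closedBall_lt_top⟩
  have hg : ∀ i, MemLp (g i) p (volume.restrict B) := by
    rintro (μ | μ) <;>
    · refine MemLp.of_bound (hmeas _).aestronglyMeasurable 1 (Filter.Eventually.of_forall fun x => ?_)
      exact norm_spline_le_one hd1 _
  obtain ⟨C₃, hC₃, h₃⟩ := exists_coeff_bound hp hg
  have hstep : ∀ i m, eLpNorm (stepError r p (g i) m) p volume ≤
      (C₁ + C₂) * (2 : ℝ≥0∞) ^ (-((m : ℝ) * smoothExp p k r)) := by
    rintro (μ | μ) m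
    · exact (h₁ m _).trans (by gcongr; exact le_self_add)
    · exact (h₂ m _).trans (by gcongr; exact le_add_self)
  refine ⟨Fintype.card ι * (C₃ * (C₁ + C₂)), by finiteness, fun a b m => ?_⟩
  set F := twoScaleSum d τ a b
  have hF : ∀ x ∈ B, F x = ∑ i : ι, Sum.elim (fun μ => a μ.1) (fun μ => b μ.1) i * g i x := by
    intro x hx
    rw [Metric.mem_closedBall, dist_zero_right] at hx
    have h4 : ‖x + τ‖ + splineRadius d ≤ M := by linarith [norm_add_le x τ]
    have h5 : ‖(2 : ℝ) • x + τ‖ + splineRadius d ≤ M := by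
      have h6 := norm_add_le ((2 : ℝ) • x) τ
      rw [norm_smul, Real.norm_ofNat] at h6
      linarith
    rw [Fintype.sum_sum_type]
    simp only [F, twoScaleSum, splineSeries_eq_sum hd1 _ h4, splineSeries_eq_sum hd1 _ h5, g,
      Sum.elim_inl, Sum.elim_inr, add_sub_assoc]
    rw [Finset.sum_coe_sort (latticeBox n M)
        (fun μ => a μ * (spline d (x + (τ - latticePoint μ)) : ℂ)),
      Finset.sum_coe_sort (latticeBox n M)
        (fun μ => b μ * (spline d ((2 : ℝ) • x + (τ - latticePoint μ)) : ℂ))]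
  have hFae : F =ᵐ[volume.restrict B]
      fun x => ∑ i : ι, Sum.elim (fun μ => a μ.1) (fun μ => b μ.1) i * g i x := by
    filter_upwards [ae_restrict_mem Metric.isClosed_closedBall.measurableSet] with x hx
    exact hF x hx
  obtain ⟨b', hb', hbound⟩ := h₃ (Sum.elim (fun μ => a μ.1) (fun μ => b μ.1))
  rw [← eLpNorm_congr_ae hFae] at hbound
  have hpt : ∀ x ∈ unitCell 0, stepError r p F m x ≤ ∑ i, ‖b' i‖ₑ * stepError r p (g i) m x := by
    intro x hx
    have h4 := closedBall_dyadicCorner_subset hx m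
    have h5 := localError_congr_ae (r := r) (p := p)
      (ae_restrict_of_ae_restrict_of_subset h4 (hFae.trans hb'))
    rw [stepError, h5]
    refine (mul_le_mul_right (localError_sum_le hp Finset.univ b'
      (fun i _ => (hmeas i).aestronglyMeasurable) _ _) _).trans (le_of_eq ?_)
    rw [Finset.mul_sum]
    exact Finset.sum_congr rfl fun i _ => mul_left_comm _ _ _
  calc _ ≤ eLpNorm (∑ i, fun x => ‖b' i‖ₑ * stepError r p (g i) m x) p
        (volume.restrict (unitCell 0)) := by
        refine eLpNorm_mono_enorm_ae ?_
        filter_upwards [ae_restrict_mem (measurableSet_unitCell 0)] with x hx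
        simpa only [enorm_eq_self, Finset.sum_apply] using hpt x hx
    _ ≤ ∑ i, eLpNorm (fun x => ‖b' i‖ₑ * stepError r p (g i) m x) p
        (volume.restrict (unitCell 0)) :=
        eLpNorm_sum_le (fun i _ =>
          ((measurable_stepError r p (g i) m).const_mul _).aestronglyMeasurable) hp
    _ ≤ ∑ _i : ι, (C₃ * eLpNorm F p (volume.restrict B)) *
        ((C₁ + C₂) * (2 : ℝ≥0∞) ^ (-((m : ℝ) * smoothExp p k r))) := by
        refine Finset.sum_le_sum fun i _ => ?_
        refine (eLpNorm_mono_measure _ Measure.restrict_le_self).trans ?_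
        refine (eLpNorm_ennreal_const_mul_le p ‖b' i‖ₑ _ _ enorm_ne_top).trans ?_
        gcongr
        · exact hbound i
        · exact hstep i m
    _ = _ := by
        rw [Finset.sum_const, Finset.card_univ, nsmul_eq_mul]
        ring

/-- **Bernstein inequality** for sums of splines of two consecutive levels. -/
lemma eLpNorm_stepError_twoScaleSum_le [NeZero n] {p : ℝ≥0∞} (hp : 1 ≤ p) {k r : ℕ}
    {d : Fin (n + 1) → ℕ} (hd : HasOrder d k) (hr : r + 1 ≤ k) (τ : Fin n → ℝ) :
    ∃ C : ℝ≥0∞, C ≠ ∞ ∧ ∀ (a b : (Fin n → ℤ) → ℂ) (m : ℕ),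
      eLpNorm (stepError r p (twoScaleSum d τ a b) m) p volume ≤
        C * (2 : ℝ≥0∞) ^ (-((m : ℝ) * smoothExp p k r)) *
          eLpNorm (twoScaleSum d τ a b) p volume := by
  obtain ⟨C, hC, h⟩ := eLpNorm_stepError_twoScaleSum_unitCell_le hp hd hr τ
  refine ⟨C * (latticeBox n 5).card, ENNReal.mul_ne_top hC (by simp), fun a b m => ?_⟩
  have hE : C * (2 : ℝ≥0∞) ^ (-((m : ℝ) * smoothExp p k r)) ≠ ∞ := by
    refine ENNReal.mul_ne_top hC ?_
    simp [ENNReal.rpow_eq_top_iff]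
  refine (eLpNorm_le_of_cells (R := 4) (M := 5) hp (by norm_num) hE
    (G := twoScaleSum d τ a b) fun ν => ?_).trans (le_of_eq (by ring))
  rw [eLpNorm_unitCell_translate, eLpNorm_closedBall_translate]
  -- Moving the cell `ν` to the origin only shifts the coefficients, by `ν` and `2 ν`; hence the
  -- local constant is the same for all cells.
  simp_rw [← stepError_comp_translation, twoScaleSum_translate]
  exact h _ _ m

/-! ### Directional derivatives of polynomials -/

lemma totalDegree_pderiv_le {m : ℕ} {P : MvPolynomial (Fin n) ℂ} (hP : P.totalDegree ≤ m + 1)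
    (i : Fin n) : (MvPolynomial.pderiv i P).totalDegree ≤ m := by
  rw [P.as_sum, map_sum]
  refine MvPolynomial.totalDegree_finsetSum_le fun s hs => ?_
  rw [MvPolynomial.pderiv_monomial]
  by_cases h : s i = 0
  · simp [h]
  refine (MvPolynomial.totalDegree_monomial_le _ _).trans ?_
  have h1 := (sum_le_totalDegree hs).trans hP
  have h2 : s - Finsupp.single i 1 + Finsupp.single i 1 = s :=
    tsub_add_cancel_of_le (Finsupp.single_le_iff.2 (Nat.one_le_iff_ne_zero.2 h))
  rw [← h2] at h1
  simp only [Finsupp.add_apply, Finset.sum_add_distrib] at h1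
  rw [Finset.sum_eq_single (f := fun j => Finsupp.single i 1 j) i
    (fun j _ hj => by simp [hj.symm]) (by simp), Finsupp.single_eq_same] at h1
  rw [Finsupp.sum_fintype _ _ fun _ => rfl]
  simp only [id]
  omega

lemma hasDerivAt_polyFun_line (P : MvPolynomial (Fin n) ℂ) (x v : Fin n → ℝ) (t : ℝ) :
    HasDerivAt (fun t : ℝ => polyFun P (x + t • v))
      (∑ i, (v i : ℂ) * polyFun (MvPolynomial.pderiv i P) (x + t • v)) t := by
  induction P using MvPolynomial.induction_on with
  | C a => simpa [polyFun] using hasDerivAt_const t a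
  | add P Q hP hQ =>
    have h : ∀ y, polyFun (P + Q) y = polyFun P y + polyFun Q y := fun y => by simp [polyFun]
    simp_rw [h]
    refine (hP.add hQ).congr_deriv ?_
    simp [polyFun, mul_add, Finset.sum_add_distrib]
  | mul_X P j hP =>
    have h1 : HasDerivAt (fun t : ℝ => ((x j + t * v j : ℝ) : ℂ)) (v j : ℂ) t := by
      have h2 := (((hasDerivAt_id t).mul_const (v j)).const_add (x j)).ofReal_comp
      simpa using h2
    have h3 := hP.mul h1
    have h4 : ∀ t : ℝ, polyFun (P * MvPolynomial.X j) (x + t • v) =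
        polyFun P (x + t • v) * ((x j + t * v j : ℝ) : ℂ) := fun t => by simp [polyFun]
    simp_rw [h4]
    refine h3.congr_deriv ?_
    have h5 : ∀ i, polyFun (MvPolynomial.pderiv i (P * MvPolynomial.X j)) (x + t • v) =
        polyFun (MvPolynomial.pderiv i P) (x + t • v) * ((x j + t * v j : ℝ) : ℂ) +
          polyFun P (x + t • v) * (if j = i then 1 else 0) := by
      intro i
      rw [MvPolynomial.pderiv_mul, MvPolynomial.pderiv_X]
      by_cases h : j = i
      · subst h; simp [polyFun]
      · simp [polyFun, h]
    simp_rw [h5, mul_add, Finset.sum_add_distrib, Finset.sum_mul]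
    congr 1
    · exact Finset.sum_congr rfl fun i _ => by ring
    · simp [mul_comm]

lemma IsPoly.exists_isLinePrimitive {m : ℕ} {f : (Fin n → ℝ) → ℂ} (hf : IsPoly (m + 1) f)
    (v : Fin n → ℝ) : ∃ g, IsPoly m g ∧ IsLinePrimitive v f g := by
  obtain ⟨P, hP, hPf⟩ := hf
  have h1 : IsPoly m fun x => ∑ i, (v i : ℂ) * polyFun (MvPolynomial.pderiv i P) x :=
    IsPoly.sum _ fun i _ => (isPoly_polyFun (totalDegree_pderiv_le hP i)).const_mul _
  refine ⟨_, h1, fun x h => ?_⟩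
  rw [intervalIntegral.integral_eq_sub_of_hasDerivAt
    (fun t _ => hasDerivAt_polyFun_line P x v t)]
  · simp [hPf]
  · exact (h1.continuous.comp (by fun_prop : Continuous fun t : ℝ => x + t • v)).intervalIntegrable
      _ _

lemma IsPoly.exists_eq_const {f : (Fin n → ℝ) → ℂ} (hf : IsPoly 0 f) :
    ∃ c, ∀ x, f x = c := by
  obtain ⟨P, hP, hPf⟩ := hf
  rw [Nat.le_zero, MvPolynomial.totalDegree_eq_zero_iff_eq_C] at hP
  refine ⟨P.coeff 0, fun x => ?_⟩
  rw [← hPf, polyFun, hP]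
  simp

/-! ### Locally bounded measurable functions -/

/-- Measurable functions that are bounded on bounded sets. -/
structure IsTame (f : (Fin n → ℝ) → ℂ) : Prop where
  measurable : Measurable f
  bounded : ∀ R : ℝ, ∃ C : ℝ, ∀ x, ‖x‖ ≤ R → ‖f x‖ ≤ C

lemma IsTame.sub {f g : (Fin n → ℝ) → ℂ} (hf : IsTame f) (hg : IsTame g) :
    IsTame fun x => f x - g x := by
  refine ⟨hf.measurable.sub hg.measurable, fun R => ?_⟩
  obtain ⟨C, hC⟩ := hf.bounded R
  obtain ⟨D, hD⟩ := hg.bounded R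
  exact ⟨C + D, fun x hx => (norm_sub_le _ _).trans (add_le_add (hC x hx) (hD x hx))⟩

lemma IsTame.comp_add {f : (Fin n → ℝ) → ℂ} (hf : IsTame f) (y : Fin n → ℝ) :
    IsTame fun x => f (x + y) := by
  refine ⟨hf.measurable.comp (measurable_add_const y), fun R => ?_⟩
  obtain ⟨C, hC⟩ := hf.bounded (R + ‖y‖)
  exact ⟨C, fun x hx => hC _ ((norm_add_le _ _).trans (by linarith))⟩

lemma isTame_of_continuous {f : (Fin n → ℝ) → ℂ} (hf : Continuous f) : IsTame f := by
  refine ⟨hf.measurable, fun R => ?_⟩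
  obtain ⟨C, hC⟩ := (isCompact_closedBall (0 : Fin n → ℝ) R).exists_bound_of_continuousOn
    hf.continuousOn
  exact ⟨C, fun x hx => hC x (by simpa using hx)⟩

lemma isTame_splineSeries [NeZero n] {d : Fin (n + 1) → ℕ} (hd : HasOrder d 1)
    (b : (Fin n → ℤ) → ℂ) : IsTame (splineSeries d b) := by
  refine ⟨measurable_splineSeries hd b, fun R => ?_⟩
  obtain ⟨M, hM⟩ := exists_nat_ge (R + splineRadius d)
  refine ⟨∑ ν ∈ latticeBox n M, ‖b ν‖, fun x hx => ?_⟩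
  rw [splineSeries_eq_sum hd b (M := M) (by linarith)]
  refine (norm_sum_le _ _).trans (Finset.sum_le_sum fun ν _ => ?_)
  rw [norm_mul]
  exact mul_le_of_le_one_right (norm_nonneg _) (norm_spline_le_one hd _)

lemma IsTame.lineIntegrable {f : (Fin n → ℝ) → ℂ} (hf : IsTame f) (v : Fin n → ℝ) :
    LineIntegrable v f := by
  intro x a b
  obtain ⟨C, hC⟩ := hf.bounded (‖x‖ + (|a| + |b|) * ‖v‖)
  refine (intervalIntegrable_const (c := C)).mono_fun
    (hf.measurable.comp (by fun_prop)).aestronglyMeasurable ?_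
  filter_upwards [ae_restrict_mem measurableSet_uIoc] with t ht
  refine (hC _ ?_).trans (le_abs_self C)
  refine (norm_add_le _ _).trans ?_
  rw [norm_smul, Real.norm_eq_abs]
  gcongr
  rw [abs_le]
  have h1 := neg_abs_le a
  have h2 := le_abs_self a
  have h3 := neg_abs_le b
  have h4 := le_abs_self b
  rw [mem_uIoc] at ht
  constructor <;> rcases ht with ht | ht <;> linarith [ht.1, ht.2, abs_nonneg a, abs_nonneg b]

/-- The mean of `f` over the segment from `x - v` to `x`. -/
def segmentMean (v : Fin n → ℝ) (f : (Fin n → ℝ) → ℂ) (x : Fin n → ℝ) : ℂ :=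
  ∫ t in (0 : ℝ)..1, f (x - t • v)

lemma IsTame.intervalIntegrable_sub {f : (Fin n → ℝ) → ℂ} (hf : IsTame f) (v x : Fin n → ℝ) :
    IntervalIntegrable (fun t : ℝ => f (x - t • v)) volume 0 1 := by
  simpa [sub_eq_add_neg] using hf.lineIntegrable (-v) x 0 1

lemma IsTame.segmentMean {f : (Fin n → ℝ) → ℂ} (hf : IsTame f) (v : Fin n → ℝ) :
    IsTame (segmentMean v f) := by
  constructor
  · have h1 : Measurable fun z : (Fin n → ℝ) × ℝ => f (z.1 - z.2 • v) :=
      hf.measurable.comp (by fun_prop)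
    have h2 := h1.stronglyMeasurable.integral_prod_right' (ν := volume.restrict (Ioc (0 : ℝ) 1))
    unfold DyadicBesov.segmentMean
    simp_rw [intervalIntegral.integral_of_le zero_le_one]
    exact h2.measurable
  · intro R
    obtain ⟨C, hC⟩ := hf.bounded (R + ‖v‖)
    refine ⟨C, fun x hx => ?_⟩
    have h := intervalIntegral.norm_integral_le_of_norm_le_const (a := 0) (b := 1)
      (f := fun t : ℝ => f (x - t • v)) (C := C) (fun t ht => by
        rw [uIoc_of_le zero_le_one] at ht
        refine hC _ ((norm_sub_le _ _).trans ?_)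
        rw [norm_smul, Real.norm_eq_abs, abs_of_pos ht.1]
        exact add_le_add hx (mul_le_of_le_one_left (norm_nonneg _) ht.2))
    simpa [DyadicBesov.segmentMean] using h

/-! ### Quasi-interpolation -/

/-- Means of locally bounded functions: functionals that are compatible with differences and
reproduce constants. -/
structure IsMean (l : ((Fin n → ℝ) → ℂ) → ℂ) : Prop where
  sub : ∀ f g, IsTame f → IsTame g → l (fun x => f x - g x) = l f - l g
  const : ∀ c : ℂ, l (fun _ => c) = c

/-- Differentiating a quasi-interpolant replaces `l` by this composition. The induction on the
degree therefore has to range over a class of means instead of the cell mean alone. -/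
lemma IsMean.comp_segmentMean {l : ((Fin n → ℝ) → ℂ) → ℂ} (hl : IsMean l) (v : Fin n → ℝ) :
    IsMean fun f => l (segmentMean v f) := by
  constructor
  · intro f g hf hg
    rw [← hl.sub _ _ (hf.segmentMean v) (hg.segmentMean v)]
    congr 1
    ext x
    exact intervalIntegral.integral_sub (hf.intervalIntegrable_sub v x)
      (hg.intervalIntegrable_sub v x)
  · intro c
    have h : segmentMean v (fun _ : Fin n → ℝ => c) = fun _ => c := by
      ext x
      simp [segmentMean]
    rw [h, hl.const]

/-- The means of the lattice translates of a function. -/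
def latticeMeans (l : ((Fin n → ℝ) → ℂ) → ℂ) (f : (Fin n → ℝ) → ℂ) (ν : Fin n → ℤ) : ℂ :=
  l fun y => f (y + latticePoint ν)

/-- The error of the approximation of a function by the spline series of its means. -/
def quasiError (d : Fin (n + 1) → ℕ) (l : ((Fin n → ℝ) → ℂ) → ℂ) (f : (Fin n → ℝ) → ℂ)
    (x : Fin n → ℝ) : ℂ :=
  f x - splineSeries d (latticeMeans l f) x

lemma IsTame.quasiError [NeZero n] {d : Fin (n + 1) → ℕ} (hd : HasOrder d 1)
    (l : ((Fin n → ℝ) → ℂ) → ℂ) {f : (Fin n → ℝ) → ℂ} (hf : IsTame f) :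
    IsTame (quasiError d l f) :=
  hf.sub (isTame_splineSeries hd _)

lemma IsTame.iterate_quasiError [NeZero n] {d : Fin (n + 1) → ℕ} (hd : HasOrder d 1)
    (l : ((Fin n → ℝ) → ℂ) → ℂ) {f : (Fin n → ℝ) → ℂ} (hf : IsTame f) (j : ℕ) :
    IsTame ((DyadicBesov.quasiError d l)^[j] f) := by
  induction j with
  | zero => exact hf
  | succ j ih =>
    rw [Function.iterate_succ_apply']
    exact ih.quasiError hd l

lemma latticeDiff_latticeMeans {l : ((Fin n → ℝ) → ℂ) → ℂ} (hl : IsMean l) {i : Fin (n + 1)}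
    {f g : (Fin n → ℝ) → ℂ} (hf : IsTame f)
    (h : IsLinePrimitive (boxDirection n i) f g) :
    latticeDiff i (latticeMeans l f) =
      latticeMeans (fun f => l (segmentMean (boxDirection n i) f)) g := by
  ext ν
  rw [latticeDiff, latticeMeans, latticeMeans, latticeMeans,
    ← hl.sub _ _ (hf.comp_add _) (hf.comp_add _)]
  congr 1
  ext y
  have h1 := h (y + latticePoint (ν - latticeDirection n i)) 1
  have h2 : y + latticePoint (ν - latticeDirection n i) + (1 : ℝ) • boxDirection n i =
      y + latticePoint ν := by
    rw [latticePoint_sub, latticePoint_direction, one_smul]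
    abel
  rw [h2] at h1
  rw [h1, segmentMean]
  have h3 := intervalIntegral.integral_comp_sub_left (a := 0) (b := 1)
    (fun t : ℝ => g (y + latticePoint (ν - latticeDirection n i) + t • boxDirection n i)) 1
  rw [sub_self, sub_zero] at h3
  rw [← h3]
  refine intervalIntegral.integral_congr fun t _ => ?_
  congr 1
  rw [latticePoint_sub, latticePoint_direction, sub_smul, one_smul]
  abel

/-- The derivative of the spline series has the differences of the means of `f` as coefficients, and
these are means of `g`. So differentiation maps an error to an error, with lower order and another
mean. -/
lemma IsLinePrimitive.quasiError [NeZero n] {d : Fin (n + 1) → ℕ} (hd : HasOrder d 1)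
    {l : ((Fin n → ℝ) → ℂ) → ℂ} (hl : IsMean l) {i : Fin (n + 1)}
    {f g : (Fin n → ℝ) → ℂ} (hf : IsTame f) (hg : IsTame g)
    (h : IsLinePrimitive (boxDirection n i) f g) :
    IsLinePrimitive (boxDirection n i) (quasiError (d + Pi.single i 1) l f)
      (quasiError d (fun f => l (segmentMean (boxDirection n i) f)) g) := by
  have h1 := isLinePrimitive_splineSeries hd i (latticeMeans l f)
  rw [latticeDiff_latticeMeans hl hf h] at h1
  intro x s
  simp only [DyadicBesov.quasiError]
  rw [sub_sub_sub_comm, h x s, h1 x s]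
  exact (intervalIntegral.integral_sub (hg.lineIntegrable _ _ _ _)
    ((isTame_splineSeries hd _).lineIntegrable _ _ _ _)).symm

lemma IsLinePrimitive.iterate_quasiError [NeZero n] {d : Fin (n + 1) → ℕ} (hd : HasOrder d 1)
    {l : ((Fin n → ℝ) → ℂ) → ℂ} (hl : IsMean l) {i : Fin (n + 1)}
    {f g : (Fin n → ℝ) → ℂ} (hf : IsTame f) (hg : IsTame g)
    (h : IsLinePrimitive (boxDirection n i) f g) (j : ℕ) :
    IsLinePrimitive (boxDirection n i)
      ((DyadicBesov.quasiError (d + Pi.single i 1) l)^[j] f)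
      ((DyadicBesov.quasiError d (fun f => l (segmentMean (boxDirection n i) f)))^[j] g) := by
  induction j with
  | zero => exact h
  | succ j ih =>
    rw [Function.iterate_succ_apply', Function.iterate_succ_apply']
    exact ih.quasiError hd hl (hf.iterate_quasiError (hd.mono le_self_add) l j)
      (hg.iterate_quasiError hd _ j)

lemma quasiError_const [NeZero n] {d : Fin (n + 1) → ℕ} (hd : HasOrder d 1)
    {l : ((Fin n → ℝ) → ℂ) → ℂ} (hl : IsMean l) (c : ℂ) (x : Fin n → ℝ) :
    quasiError d l (fun _ => c) x = 0 := by
  have h : latticeMeans l (fun _ => c) = fun _ => c * 1 := by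
    ext ν
    rw [latticeMeans, hl.const, mul_one]
  rw [quasiError, h, splineSeries_const_mul, splineSeries_one hd, mul_one, sub_self]

/-- A function without variation in the directions of a basis is constant. -/
lemma eq_of_isLinePrimitive_zero (i : Fin (n + 1)) {G : (Fin n → ℝ) → ℂ}
    (h : ∀ j, IsLinePrimitive (boxDirection n (baseIndex i j)) G fun _ => 0) (x : Fin n → ℝ) :
    G x = G 0 := by
  classical
  have h1 : ∀ s : Finset (Fin n), G (∑ j ∈ s, coordEquiv ℝ i x j • boxDirection n (baseIndex i j)) =
      G 0 := by
    intro s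
    induction s using Finset.induction_on with
    | empty => simp
    | insert j s hj ih =>
      rw [Finset.sum_insert hj, add_comm, ← ih, ← sub_eq_zero, h j]
      simp
  have h2 : ∑ j, coordEquiv ℝ i x j • boxDirection n (baseIndex i j) = x := by
    simp_rw [← coordEquiv_symm_single_real, ← map_smul, ← map_sum]
    rw [LinearEquiv.symm_apply_eq]
    ext l
    simp [Pi.single_apply]
  rw [← h1 Finset.univ, h2]

lemma HasOrder.exists_baseIndex_ne_zero {d : Fin (n + 1) → ℕ} (hd : HasOrder d 1) :
    ∃ i, ∀ j, d (baseIndex i j) ≠ 0 := by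
  obtain ⟨i, hi⟩ := hd.exists_baseMult_le
  refine ⟨i, fun j => ?_⟩
  have h := hi (baseIndex i j)
  have h2 := baseIndex_ne i j
  simp only [baseMult] at h
  simp_all
  omega

/-- Iterated quasi-interpolation reproduces polynomials. -/
lemma iterate_quasiError_eq_zero [NeZero n] (m : ℕ) {d : Fin (n + 1) → ℕ} (hd : HasOrder d (m + 1))
    {l : ((Fin n → ℝ) → ℂ) → ℂ} (hl : IsMean l) {P : (Fin n → ℝ) → ℂ} (hP : IsPoly m P)
    (x : Fin n → ℝ) : (quasiError d l)^[m + 1] P x = 0 := by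
  induction m generalizing d l P x with
  | zero =>
    obtain ⟨c, hc⟩ := hP.exists_eq_const
    rw [funext hc]
    exact quasiError_const hd hl c x
  | succ m ih =>
    have hd1 : HasOrder d 1 := hd.of_le (by omega)
    obtain ⟨i, hi⟩ := hd1.exists_baseIndex_ne_zero
    -- Along each basis direction, the derivative of the `(m + 1)`-fold error of `P` is an `(m +
    -- 1)`-fold error of a polynomial of degree `m`, which vanishes by induction. What remains is a
    -- constant, and one more step annihilates it.
    have h1 : ∀ j, IsLinePrimitive (boxDirection n (baseIndex i j))
        ((quasiError d l)^[m + 1] P) fun _ => 0 := by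
      intro j
      obtain ⟨e, rfl⟩ := exists_eq_add_single (hi j)
      have he := hd.of_add_single
      obtain ⟨P', hP', hPP'⟩ := hP.exists_isLinePrimitive (boxDirection n (baseIndex i j))
      have h2 := hPP'.iterate_quasiError (he.of_le (by omega)) hl
        (isTame_of_continuous hP.continuous) (isTame_of_continuous hP'.continuous) (m + 1)
      rwa [funext (ih he (hl.comp_segmentMean _) hP')] at h2
    rw [Function.iterate_succ_apply', funext (eq_of_isLinePrimitive_zero i h1)]
    exact quasiError_const hd1 hl _ x

/-! ### Local estimates for quasi-interpolation -/

lemma memℓp_of_eLpNorm_lt_top {ι : Type*} [MeasurableSpace ι] [MeasurableSingletonClass ι]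
    [Countable ι] {p : ℝ≥0∞} (hp : p ≠ 0) {a : ι → ℂ}
    (ha : eLpNorm a p Measure.count < ∞) : Memℓp a p := by
  have hm : MemLp a p Measure.count := ⟨AEStronglyMeasurable.of_discrete, ha⟩
  rcases eq_or_ne p ∞ with rfl | hp'
  · rw [eLpNorm_exponent_top, eLpNormEssSup_count] at ha
    rw [memℓp_infty_iff]
    refine ⟨(⨆ i, ‖a i‖ₑ).toReal, ?_⟩
    rintro _ ⟨i, rfl⟩
    have h := ENNReal.toReal_mono ha.ne (le_iSup (fun i => ‖a i‖ₑ) i)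
    simpa using h
  · rw [memℓp_gen_iff (ENNReal.toReal_pos hp hp')]
    refine (integrable_count_iff.1 (hm.integrable_norm_rpow hp hp')).congr fun i => ?_
    rw [Real.norm_of_nonneg (by positivity)]

/-- The mean over the unit cell. -/
def cellMean (f : (Fin n → ℝ) → ℂ) : ℂ := ∫ y in unitCell 0, f y

/-- Functions that are integrable over all unit cells. -/
structure IsCellIntegrable (f : (Fin n → ℝ) → ℂ) : Prop where
  aestronglyMeasurable : AEStronglyMeasurable f volume
  eLpNorm_lt_top : ∀ ν, eLpNorm f 1 (volume.restrict (unitCell ν)) < ∞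

lemma aestronglyMeasurable_comp_add {f : (Fin n → ℝ) → ℂ} (hf : AEStronglyMeasurable f volume)
    (y : Fin n → ℝ) : AEStronglyMeasurable (fun x => f (x + y)) volume :=
  hf.comp_measurePreserving (measurePreserving_add_right volume y)

lemma IsCellIntegrable.integrable {f : (Fin n → ℝ) → ℂ} (hf : IsCellIntegrable f)
    (ν : Fin n → ℤ) :
    Integrable (fun x => f (x + latticePoint ν)) (volume.restrict (unitCell 0)) := by
  rw [← memLp_one_iff_integrable]
  refine ⟨(aestronglyMeasurable_comp_add hf.1 _).restrict, ?_⟩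
  rw [← eLpNorm_unitCell_translate]
  exact hf.2 ν

lemma IsCellIntegrable.sub {f g : (Fin n → ℝ) → ℂ} (hf : IsCellIntegrable f)
    (hg : IsCellIntegrable g) : IsCellIntegrable fun x => f x - g x := by
  refine ⟨hf.1.sub hg.1, fun ν => ?_⟩
  exact (eLpNorm_sub_le hf.1.restrict hg.1.restrict le_rfl).trans_lt
    (ENNReal.add_lt_top.2 ⟨hf.2 ν, hg.2 ν⟩)

lemma unitCell_subset_closedBall {μ ν : Fin n → ℤ} {M : ℕ} (hμ : μ ∈ latticeBox n M) :
    unitCell (μ + ν) ⊆ Metric.closedBall (latticePoint ν) (M + 1) := by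
  intro y hy
  rw [Metric.mem_closedBall, dist_eq_norm]
  have h1 := norm_sub_floorPoint_le y
  rw [show floorPoint y = μ + ν from hy, latticePoint_add] at h1
  have h2 : ‖latticePoint μ‖ ≤ M := by
    rw [pi_norm_le_iff_of_nonneg (by positivity)]
    intro i
    rw [latticePoint_apply, Real.norm_eq_abs]
    exact_mod_cast mem_latticeBox.1 hμ i
  have h3 := norm_add_le (y - (latticePoint μ + latticePoint ν)) (latticePoint μ)
  have h4 : y - (latticePoint μ + latticePoint ν) + latticePoint μ = y - latticePoint ν := by abel
  rw [h4] at h3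
  linarith

lemma IsTame.isCellIntegrable {f : (Fin n → ℝ) → ℂ} (hf : IsTame f) : IsCellIntegrable f := by
  refine ⟨hf.1.aestronglyMeasurable, fun ν => ?_⟩
  obtain ⟨C, hC⟩ := hf.2 (‖latticePoint ν‖ + 1)
  have h : MemLp f 1 (volume.restrict (unitCell ν)) := by
    refine MemLp.of_bound hf.1.aestronglyMeasurable C ?_
    filter_upwards [ae_restrict_mem (measurableSet_unitCell ν)] with x hx
    apply hC
    have h1 := norm_sub_floorPoint_le x
    rw [show floorPoint x = ν from hx] at h1
    have h2 := norm_add_le (latticePoint ν) (x - latticePoint ν)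
    rw [add_sub_cancel] at h2
    linarith
  exact h.2

lemma isCellIntegrable_of_memLp {p : ℝ≥0∞} (hp : 1 ≤ p) {f : (Fin n → ℝ) → ℂ}
    (hf : MemLp f p volume) : IsCellIntegrable f :=
  ⟨hf.1, fun ν => (((hf.restrict (unitCell ν)).mono_exponent hp).2)⟩

/-- Needed for `f - P` with `f` in `L^p` and `P` a polynomial; cell integrability covers both. -/
lemma latticeMeans_cellMean_sub {f g : (Fin n → ℝ) → ℂ} (hf : IsCellIntegrable f)
    (hg : IsCellIntegrable g) (ν : Fin n → ℤ) :
    latticeMeans cellMean (fun x => f x - g x) ν =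
      latticeMeans cellMean f ν - latticeMeans cellMean g ν :=
  integral_sub (hf.integrable ν) (hg.integrable ν)

lemma isMean_cellMean : IsMean (cellMean (n := n)) := by
  refine ⟨fun f g hf hg => ?_, fun c => ?_⟩
  · simpa [latticeMeans, show latticePoint (0 : Fin n → ℤ) = 0 by ext; simp] using
      latticeMeans_cellMean_sub hf.isCellIntegrable hg.isCellIntegrable 0
  · rw [cellMean, integral_const]
    simp

lemma enorm_latticeMeans_le {p : ℝ≥0∞} (hp : 1 ≤ p) {f : (Fin n → ℝ) → ℂ}
    (hf : AEStronglyMeasurable f volume) (ν : Fin n → ℤ) :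
    ‖latticeMeans cellMean f ν‖ₑ ≤ eLpNorm f p (volume.restrict (unitCell ν)) := by
  rw [eLpNorm_unitCell_translate]
  refine (enorm_integral_le_lintegral_enorm _).trans ?_
  rw [← eLpNorm_one_eq_lintegral_enorm]
  exact eLpNorm_le_eLpNorm_of_exponent_le hp (aestronglyMeasurable_comp_add hf _).restrict

lemma IsCellIntegrable.quasiError [NeZero n] {d : Fin (n + 1) → ℕ} (hd : HasOrder d 1)
    (l : ((Fin n → ℝ) → ℂ) → ℂ) {f : (Fin n → ℝ) → ℂ} (hf : IsCellIntegrable f) :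
    IsCellIntegrable (quasiError d l f) :=
  hf.sub (isTame_splineSeries hd _).isCellIntegrable

lemma IsCellIntegrable.iterate_quasiError [NeZero n] {d : Fin (n + 1) → ℕ} (hd : HasOrder d 1)
    (l : ((Fin n → ℝ) → ℂ) → ℂ) {f : (Fin n → ℝ) → ℂ} (hf : IsCellIntegrable f) (j : ℕ) :
    IsCellIntegrable ((DyadicBesov.quasiError d l)^[j] f) := by
  induction j with
  | zero => exact hf
  | succ j ih =>
    rw [Function.iterate_succ_apply']
    exact ih.quasiError hd l

lemma iterate_quasiError_sub [NeZero n] {d : Fin (n + 1) → ℕ} (hd : HasOrder d 1)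
    {f g : (Fin n → ℝ) → ℂ} (hf : IsCellIntegrable f) (hg : IsCellIntegrable g) (j : ℕ) :
    (quasiError d cellMean)^[j] (fun x => f x - g x) = fun x =>
      (quasiError d cellMean)^[j] f x - (quasiError d cellMean)^[j] g x := by
  induction j with
  | zero => rfl
  | succ j ih =>
    ext x
    simp_rw [Function.iterate_succ_apply', ih, quasiError]
    rw [funext (latticeMeans_cellMean_sub (hf.iterate_quasiError hd _ j)
      (hg.iterate_quasiError hd _ j)), splineSeries_sub hd]
    ring

/-- On a ball only boundedly many means enter, and each is at most the `L^p` norm over its cell.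
Hence `C` and `R` are independent of `f` and `ν`. -/
lemma eLpNorm_quasiError_closedBall_le [NeZero n] {d : Fin (n + 1) → ℕ} (hd : HasOrder d 1)
    {p : ℝ≥0∞} (hp : 1 ≤ p) (ρ : ℝ) : ∃ C : ℝ≥0∞, C ≠ ∞ ∧ ∃ R : ℝ,
      ∀ f : (Fin n → ℝ) → ℂ, AEStronglyMeasurable f volume → ∀ ν,
      eLpNorm (quasiError d cellMean f) p
          (volume.restrict (Metric.closedBall (latticePoint ν) ρ)) ≤
        C * eLpNorm f p (volume.restrict (Metric.closedBall (latticePoint ν) R)) := by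
  obtain ⟨M, hM⟩ := exists_nat_ge (|ρ| + |ρ| + splineRadius d)
  have hs : (0 : ℝ) ≤ splineRadius d := Nat.cast_nonneg _
  have hρ := le_abs_self ρ
  have hρ' := abs_nonneg ρ
  set V : ℝ≥0∞ := volume (Metric.closedBall (0 : Fin n → ℝ) ρ) ^ p.toReal⁻¹
  have hV : V ≠ ∞ :=
    ENNReal.rpow_ne_top_of_nonneg (by positivity) measure_closedBall_lt_top.ne
  refine ⟨1 + V * (latticeBox n M).card, by finiteness, M + 1, fun f hf ν => ?_⟩
  set B := Metric.closedBall (latticePoint ν) ρ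
  set A := eLpNorm f p (volume.restrict (Metric.closedBall (latticePoint ν) (M + 1)))
  have h1 : eLpNorm f p (volume.restrict B) ≤ A :=
    eLpNorm_mono_measure _ (Measure.restrict_mono_set _
      (Metric.closedBall_subset_closedBall (by linarith)))
  have h2 : ∀ x ∈ B, ‖splineSeries d (latticeMeans cellMean f) x‖ₑ ≤
      (latticeBox n M).card * A := by
    intro x hx
    rw [Metric.mem_closedBall, dist_eq_norm] at hx
    have h3 := splineSeries_shift d (latticeMeans cellMean f) (x - latticePoint ν) (-ν)
    have h4 : latticePoint (-ν) = -latticePoint ν := by ext; simp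
    rw [h4, sub_neg_eq_add, sub_add_cancel] at h3
    rw [h3, splineSeries_eq_sum hd _ (M := M) (by linarith)]
    refine (enorm_sum_le _ _).trans ?_
    rw [← nsmul_eq_mul]
    refine Finset.sum_le_card_nsmul _ _ _ fun μ hμ => ?_
    rw [enorm_mul, sub_neg_eq_add]
    have h5 : ‖(spline d (x - latticePoint ν - latticePoint μ) : ℂ)‖ₑ ≤ 1 := by
      rw [← enorm_one (G := ℂ), enorm_le_iff_norm_le, norm_one]
      exact norm_spline_le_one hd _
    calc _ ≤ ‖latticeMeans cellMean f (μ + ν)‖ₑ * 1 := by gcongr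
      _ ≤ A := by
        rw [mul_one]
        exact (enorm_latticeMeans_le hp hf _).trans (eLpNorm_mono_measure _
          (Measure.restrict_mono_set _ (unitCell_subset_closedBall hμ)))
  have h6 : eLpNorm (splineSeries d (latticeMeans cellMean f)) p (volume.restrict B) ≤
      V * ((latticeBox n M).card * A) := by
    have h7 := eLpNorm_le_of_ae_enorm_bound (p := p) (μ := volume.restrict B)
      (f := splineSeries d (latticeMeans cellMean f)) (C := (latticeBox n M).card * A) (by
        filter_upwards [ae_restrict_mem Metric.isClosed_closedBall.measurableSet] with x hx
        exact h2 x hx)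
    rwa [Measure.restrict_apply_univ, Measure.addHaar_closedBall_center, smul_eq_mul,
      mul_comm] at h7
  refine (eLpNorm_sub_le hf.restrict
    (measurable_splineSeries hd _).aestronglyMeasurable hp).trans ?_
  refine (add_le_add h1 h6).trans (le_of_eq ?_)
  ring

lemma eLpNorm_iterate_quasiError_closedBall_le [NeZero n] {d : Fin (n + 1) → ℕ}
    (hd : HasOrder d 1) {p : ℝ≥0∞} (hp : 1 ≤ p) (j : ℕ) (ρ : ℝ) :
    ∃ C : ℝ≥0∞, C ≠ ∞ ∧ ∃ R : ℝ,
      ∀ f : (Fin n → ℝ) → ℂ, AEStronglyMeasurable f volume → ∀ ν,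
      eLpNorm ((quasiError d cellMean)^[j] f) p
          (volume.restrict (Metric.closedBall (latticePoint ν) ρ)) ≤
        C * eLpNorm f p (volume.restrict (Metric.closedBall (latticePoint ν) R)) := by
  induction j with
  | zero => exact ⟨1, by simp, ρ, fun f _ ν => by simp⟩
  | succ j ih =>
    obtain ⟨C, hC, R, h⟩ := ih
    obtain ⟨C', hC', R', h'⟩ := eLpNorm_quasiError_closedBall_le hd hp R
    refine ⟨C * C', ENNReal.mul_ne_top hC hC', R', fun f hf ν => ?_⟩
    rw [Function.iterate_succ_apply, mul_assoc]
    refine (h _ (hf.sub (measurable_splineSeries hd _).aestronglyMeasurable) ν).trans ?_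
    gcongr
    exact h' f hf ν

lemma memLp_iterate_quasiError [NeZero n] {d : Fin (n + 1) → ℕ}
    (hd : HasOrder d 1) {p : ℝ≥0∞} (hp : 1 ≤ p) (j : ℕ) {f : (Fin n → ℝ) → ℂ}
    (hf : MemLp f p volume) : MemLp ((quasiError d cellMean)^[j] f) p volume := by
  refine ⟨((isCellIntegrable_of_memLp hp hf).iterate_quasiError hd _ j).1, ?_⟩
  obtain ⟨C, hC, R, h⟩ := eLpNorm_iterate_quasiError_closedBall_le hd hp j 1
  obtain ⟨M, hM⟩ := exists_nat_ge (R + 1)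
  refine (eLpNorm_le_of_cells hp hM hC (G := f) fun ν => ?_).trans_lt
    (ENNReal.mul_lt_top (ENNReal.mul_lt_top hC.lt_top (by simp)) hf.2)
  refine le_trans (eLpNorm_mono_measure _ (Measure.restrict_mono_set _ ?_)) (h f hf.1 ν)
  have h2 := unitCell_subset_closedBall (μ := 0) (ν := ν) (M := 0) (by simp [mem_latticeBox])
  simpa using h2

/-- Approximation by spline series with local error bounds. -/
lemma exists_splineSeries_approx [NeZero n] {m : ℕ} {d : Fin (n + 1) → ℕ}
    (hd : HasOrder d (m + 1)) {p : ℝ≥0∞} (hp : 1 ≤ p) : ∃ C : ℝ≥0∞, C ≠ ∞ ∧ ∃ R : ℝ,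
      ∀ f : (Fin n → ℝ) → ℂ, MemLp f p volume → ∃ a : (Fin n → ℤ) → ℂ, Memℓp a p ∧
      ∀ ν, eLpNorm (fun x => f x - splineSeries d a x) p (volume.restrict (unitCell ν)) ≤
        C * localError m p f (latticePoint ν) R := by
  have hd1 : HasOrder d 1 := hd.of_le (by omega)
  have hp0 : p ≠ 0 := (zero_lt_one.trans_le hp).ne'
  obtain ⟨C, hC, R, h⟩ := eLpNorm_iterate_quasiError_closedBall_le hd1 hp (m + 1) 1
  -- The added `1` makes the constant nonzero, so that it can be moved into the infimum over
  -- polynomials.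
  refine ⟨C + 1, by finiteness, R, fun f hf => ?_⟩
  set T : ℕ → (Fin n → ℝ) → ℂ := fun j => (quasiError d cellMean)^[j] f
  have hT : ∀ j, MemLp (T j) p volume := fun j => memLp_iterate_quasiError hd1 hp j hf
  -- `T j - T (j + 1)` is the spline series of the means of `T j`, so `f - T (m + 1)` telescopes to
  -- the series with these coefficients. They depend neither on the cell nor on the comparison
  -- polynomial.
  set a : (Fin n → ℤ) → ℂ := fun ν => ∑ j ∈ Finset.range (m + 1), latticeMeans cellMean (T j) ν
  have ha : ∀ x, f x - splineSeries d a x = T (m + 1) x := by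
    intro x
    rw [splineSeries_sum hd1]
    have h1 : ∀ j, splineSeries d (latticeMeans cellMean (T j)) x = T j x - T (j + 1) x := by
      intro j
      simp only [T, Function.iterate_succ_apply', quasiError]
      ring
    rw [Finset.sum_congr rfl fun j _ => h1 j, Finset.sum_range_sub']
    simp [T]
  refine ⟨a, memℓp_of_eLpNorm_lt_top hp0 ?_, fun ν => ?_⟩
  · have h1 : ∀ j, eLpNorm (latticeMeans cellMean (T j)) p Measure.count < ∞ := by
      intro j
      refine lt_of_le_of_lt (eLpNorm_mono_enorm (g := fun ν =>
        eLpNorm (T j) p (volume.restrict (unitCell ν))) fun ν => ?_)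
        ((eLpNorm_eq_cells p (T j) volume).symm.trans_lt (hT j).2)
      simpa using enorm_latticeMeans_le hp (hT j).1 ν
    have h2 : a = ∑ j ∈ Finset.range (m + 1), latticeMeans cellMean (T j) := by
      ext ν; simp [a]
    rw [h2]
    exact (eLpNorm_sum_le (fun _ _ => AEStronglyMeasurable.of_discrete) hp).trans_lt
      (ENNReal.sum_lt_top.2 fun j _ => h1 j)
  · rw [funext ha]
    unfold localError
    simp_rw [ENNReal.mul_iInf_of_ne (a := C + 1) (by simp) (by finiteness)]
    refine le_iInf₂ fun P hP => ?_
    have hPc := (isTame_of_continuous hP.continuous).isCellIntegrable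
    have hfc := isCellIntegrable_of_memLp hp hf
    have h1 : T (m + 1) = (quasiError d cellMean)^[m + 1] fun x => f x - P x := by
      rw [iterate_quasiError_sub hd1 hfc hPc]
      ext x
      rw [iterate_quasiError_eq_zero m hd isMean_cellMean hP, sub_zero]
    rw [h1]
    refine le_trans (eLpNorm_mono_measure _ (Measure.restrict_mono_set _ ?_))
      ((h _ (hfc.sub hPc).1 ν).trans (by gcongr; exact le_self_add))
    simpa using unitCell_subset_closedBall (μ := 0) (ν := ν) (M := 0) (by simp [mem_latticeBox])

/-! ### The direct estimate -/

lemma mem_multiresSpace_spline {d : Fin (n + 1) → ℕ} {τ : Fin n → ℝ} {p : ℝ≥0∞} {l : ℕ}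
    {S : (Fin n → ℝ) → ℂ} : S ∈ multiresSpace (fun x => spline d (x + τ)) p l ↔
      ∃ a, Memℓp a p ∧ S = fun x => splineSeries d a ((2 : ℝ) ^ l • x + τ) := by
  have h : ∀ (a : (Fin n → ℤ) → ℂ) (x : Fin n → ℝ),
      ∑' ν : Fin n → ℤ, a ν * (spline d ((fun i => (2 : ℝ) ^ l * x i - (ν i : ℝ)) + τ) : ℂ) =
        splineSeries d a ((2 : ℝ) ^ l • x + τ) := by
    intro a x
    refine tsum_congr fun ν => ?_
    congr 3
    ext i
    simp [sub_add_eq_add_sub]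
  simp only [multiresSpace, Set.mem_ofPred_eq, h]

lemma zero_mem_multiresSpace (φ : (Fin n → ℝ) → ℝ) (p : ℝ≥0∞) (l : ℕ) :
    (fun _ => 0) ∈ multiresSpace φ p l :=
  ⟨0, zero_memℓp, by simp⟩

lemma approxError_le_eLpNorm (φ : (Fin n → ℝ) → ℝ) (p : ℝ≥0∞) (l : ℕ) (f : (Fin n → ℝ) → ℂ) :
    approxError φ p l f ≤ eLpNorm f p volume :=
  (iInf₂_le _ (zero_mem_multiresSpace φ p l)).trans (by simp)

lemma exists_closedBall_subset_baseCube {c : Fin n → ℝ}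
    (hc : (0 : Fin n → ℝ) ∈ interior (baseCube c)) :
    ∃ δ : ℝ, 0 < δ ∧ Metric.closedBall 0 δ ⊆ baseCube c := by
  obtain ⟨δ, hδ, h⟩ := Metric.nhds_basis_closedBall.mem_iff.1 (mem_interior_iff_mem_nhds.1 hc)
  exact ⟨δ, hδ, h⟩

lemma closedBall_subset_dyadicCube {c : Fin n → ℝ} {δ : ℝ}
    (h : Metric.closedBall 0 δ ⊆ baseCube c) (l : ℕ) (x : Fin n → ℝ) :
    Metric.closedBall x (δ / 2 ^ l) ⊆ dyadicCube c l x := by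
  intro y hy
  apply h
  rw [Metric.mem_closedBall, dist_eq_norm] at hy
  rw [mem_closedBall_zero_iff, norm_smul, norm_pow, Real.norm_ofNat]
  rwa [le_div_iff₀ (by positivity), mul_comm] at hy

/-- Local errors on sufficiently small balls are bounded by the oscillation. -/
lemma dilationFactor_mul_localError_le_osc {c : Fin n → ℝ} {δ : ℝ}
    (h : Metric.closedBall 0 δ ⊆ baseCube c) (r : ℕ) (p : ℝ≥0∞) (f : (Fin n → ℝ) → ℂ) (l : ℕ)
    {x y : Fin n → ℝ} {ρ : ℝ} (hxy : ‖x - y‖ + ρ ≤ δ / 2 ^ l) :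
    dilationFactor n p (2 ^ l) * localError r p f y ρ ≤ osc c r p f x l := by
  refine le_iInf₂ fun P hP => ?_
  rw [eLpNorm_dyadicCube]
  gcongr
  refine (localError_le p f y ρ (isPoly_polyFun hP)).trans ?_
  refine eLpNorm_mono_measure _ (Measure.restrict_mono_set _
    (Subset.trans ?_ (closedBall_subset_dyadicCube h l x)))
  intro z hz
  rw [Metric.mem_closedBall, dist_eq_norm] at hz ⊢
  have h1 := norm_sub_le (z - y) (x - y)
  rw [sub_sub_sub_cancel_right] at h1
  linarith

lemma approxError_le_osc [NeZero n] {m : ℕ} {d : Fin (n + 1) → ℕ} (hd : HasOrder d (m + 1))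
    (τ : Fin n → ℝ) {p : ℝ≥0∞} (hp : 1 ≤ p) {c : Fin n → ℝ}
    (hc : (0 : Fin n → ℝ) ∈ interior (baseCube c)) :
    ∃ C : ℝ≥0∞, C ≠ ∞ ∧ ∃ L : ℕ, ∀ f : (Fin n → ℝ) → ℂ, MemLp f p volume → ∀ l, L ≤ l →
      approxError (fun x => spline d (x + τ)) p l f ≤
        C * eLpNorm (fun x => osc c m p f x (l - L)) p volume := by
  have hp0 : p ≠ 0 := (zero_lt_one.trans_le hp).ne'
  obtain ⟨C, hC, R, hCR⟩ := exists_splineSeries_approx hd hp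
  obtain ⟨δ, hδ, hball⟩ := exists_closedBall_subset_baseCube hc
  -- Going back `L` levels makes `Q_{l-L}(x)` large enough for the balls of the local estimate: `R`
  -- is their radius on scale `2^{-l}`, and `1` bounds the distance of their center.
  obtain ⟨L, hL⟩ := pow_unbounded_of_one_lt ((1 + R) / δ) (one_lt_two (α := ℝ))
  rw [div_lt_iff₀ hδ] at hL
  have hF := dilationFactor_ne_top (n := n) (c := 2 ^ L) p
  refine ⟨C * dilationFactor n p (2 ^ L), ENNReal.mul_ne_top hC hF, L, fun f hf l hl => ?_⟩
  obtain ⟨i, rfl⟩ := Nat.exists_eq_add_of_le' hl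
  rw [Nat.add_sub_cancel]
  set N : ℝ := 2 ^ (i + L) with hN
  have hN0 : 0 < N := by positivity
  set b : Fin n → ℝ := -(N⁻¹ • τ) with hb
  set g : (Fin n → ℝ) → ℂ := fun y => f (N⁻¹ • y + b) with hg
  have hfg : ∀ x, f x = g (N • x + τ) := by
    intro x
    simp only [hg, hb, smul_add, smul_smul, inv_mul_cancel₀ hN0.ne', one_smul,
      add_neg_cancel_right]
  have hgm : AEStronglyMeasurable g volume := by
    refine hf.1.comp_quasiMeasurePreserving (f := fun y : Fin n → ℝ => N⁻¹ • y + b) ?_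
    have h1 : Measure.QuasiMeasurePreserving (fun y : Fin n → ℝ => N⁻¹ • y) volume volume := by
      refine ⟨measurable_const_smul _, ?_⟩
      rw [Measure.map_addHaar_smul _ (inv_ne_zero hN0.ne')]
      exact Measure.smul_absolutelyContinuous
    exact (measurePreserving_add_right volume b).quasiMeasurePreserving.comp h1
  have hgp : MemLp g p volume := by
    refine ⟨hgm, ?_⟩
    have h1 := eLpNorm_comp_affine_univ p f (inv_pos.2 hN0) b
    rw [← hg] at h1
    by_contra h2
    rw [not_lt, top_le_iff] at h2
    rw [h2, ENNReal.mul_top (dilationFactor_ne_zero (inv_pos.2 hN0) p)] at h1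
    exact hf.2.ne h1
  obtain ⟨a, ha, happ⟩ := hCR g hgp
  refine (iInf₂_le _ (mem_multiresSpace_spline.2 ⟨a, ha, rfl⟩)).trans ?_
  rw [← ENNReal.mul_le_mul_iff_right (dilationFactor_ne_zero (n := n) hN0 p)
    (dilationFactor_ne_top p)]
  have h1 := eLpNorm_comp_affine_univ p (fun y => g y - splineSeries d a y) hN0 τ
  simp_rw [← hfg] at h1
  rw [← hN, ← h1]
  have h2 := eLpNorm_comp_affine_univ p (fun y => osc c m p f (N⁻¹ • y + b) i) hN0 τ
  have h3 : ∀ x : Fin n → ℝ, N⁻¹ • (N • x + τ) + b = x := by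
    intro x
    simp only [hb, smul_add, smul_smul, inv_mul_cancel₀ hN0.ne', one_smul,
      add_neg_cancel_right]
  simp_rw [h3] at h2
  have h4 : ∀ y, localError m p g (latticePoint (floorPoint y)) R ≤
      dilationFactor n p (2 ^ L) * osc c m p f (N⁻¹ • y + b) i := by
    intro y
    have h5 := localError_comp_affine (r := m) p f (inv_pos.2 hN0) b
      (latticePoint (floorPoint y)) R
    rw [← hg] at h5
    have h6 := dilationFactor_mul_localError_le_osc hball m p f i (x := N⁻¹ • y + b)
      (y := N⁻¹ • latticePoint (floorPoint y) + b) (ρ := N⁻¹ * R) (by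
        rw [add_sub_add_right_eq_sub, ← smul_sub, norm_smul, norm_inv, Real.norm_eq_abs,
          abs_of_pos hN0, ← mul_add, hN, pow_add, mul_inv, le_div_iff₀ (by positivity)]
        have h7 := norm_sub_floorPoint_le y
        calc ((2 : ℝ) ^ i)⁻¹ * (2 ^ L)⁻¹ * (‖y - latticePoint (floorPoint y)‖ + R) * 2 ^ i
            = (‖y - latticePoint (floorPoint y)‖ + R) / 2 ^ L := by field_simp
          _ ≤ δ := by
            rw [div_le_iff₀ (by positivity)]
            linarith)
    rw [h5] at h6
    calc localError m p g (latticePoint (floorPoint y)) R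
        = dilationFactor n p (2 ^ L) * (dilationFactor n p (2 ^ i) * (dilationFactor n p N⁻¹ *
            localError m p g (latticePoint (floorPoint y)) R)) := by
          rw [← mul_assoc, ← mul_assoc, ← dilationFactor_mul (by positivity),
            ← dilationFactor_mul (by positivity), hN, ← pow_add, add_comm L i,
            mul_inv_cancel₀ (by positivity), dilationFactor_one, one_mul]
      _ ≤ _ := by gcongr
  calc eLpNorm (fun y => g y - splineSeries d a y) p volume
      = eLpNorm (fun ν => eLpNorm (fun y => g y - splineSeries d a y) p
          (volume.restrict (unitCell ν))) p Measure.count := eLpNorm_eq_cells _ _ _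
    _ ≤ eLpNorm (fun ν => C * localError m p g (latticePoint ν) R) p Measure.count :=
        eLpNorm_mono_enorm fun ν => by simpa using happ ν
    _ ≤ C * eLpNorm (fun ν => localError m p g (latticePoint ν) R) p Measure.count :=
        eLpNorm_ennreal_const_mul_le _ _ _ _ hC
    _ = C * eLpNorm (fun y => localError m p g (latticePoint (floorPoint y)) R) p volume := by
        rw [eLpNorm_comp_floorPoint hp0 fun ν => localError m p g (latticePoint ν) R]
    _ ≤ C * eLpNorm (fun y => dilationFactor n p (2 ^ L) * osc c m p f (N⁻¹ • y + b) i) p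
          volume := by
        gcongr
        exact eLpNorm_mono_enorm fun y => by simpa using h4 y
    _ ≤ C * (dilationFactor n p (2 ^ L) *
          eLpNorm (fun y => osc c m p f (N⁻¹ • y + b) i) p volume) := by
        gcongr
        exact eLpNorm_ennreal_const_mul_le _ _ _ _ hF
    _ = _ := by
        rw [h2]
        ring

lemma osc_anti_degree (c : Fin n → ℝ) {r r' : ℕ} (h : r ≤ r') (p : ℝ≥0∞) (f : (Fin n → ℝ) → ℂ)
    (x : Fin n → ℝ) (l : ℕ) : osc c r' p f x l ≤ osc c r p f x l :=
  le_iInf₂ fun P hP => iInf₂_le P (hP.trans h)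

lemma besovNorm_anti_degree (c : Fin n → ℝ) {r r' : ℕ} (h : r ≤ r') (s : ℝ) (p q : ℝ≥0∞)
    (f : (Fin n → ℝ) → ℂ) : besovNorm c r' s p q f ≤ besovNorm c r s p q f := by
  unfold besovNorm
  gcongr
  exact weightedNorm_mono fun l => eLpNorm_mono_enorm fun x => by
    simpa using osc_anti_degree c h p f x l

/-- **Direct theorem**: approximation by splines is controlled by the oscillation. -/
theorem approxNorm_spline_le_besovNorm [NeZero n] {r : ℕ} {d : Fin (n + 1) → ℕ}
    (hd : HasOrder d (r + 1)) (τ : Fin n → ℝ) {p q : ℝ≥0∞} (hp : 1 ≤ p) (hq : 1 ≤ q)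
    {c : Fin n → ℝ} (hc : (0 : Fin n → ℝ) ∈ interior (baseCube c)) (s : ℝ) :
    ∃ C : ℝ≥0∞, C ≠ ∞ ∧ ∀ f : (Fin n → ℝ) → ℂ, AEStronglyMeasurable f volume →
      approxNorm (fun x => spline d (x + τ)) s p q f ≤ C * besovNorm c r s p q f := by
  obtain ⟨C, hC, L, h⟩ := approxError_le_osc hd τ hp hc
  -- Levels below `L` have no level `l - L`; there the error is at most `‖f‖_p`, dominated by a
  -- geometric sequence. Its exponent `s + 1` could be any number above `s`.
  set A : ℝ≥0∞ := geomConst (s + 1 - s) * (2 : ℝ≥0∞) ^ ((L : ℝ) * |s + 1|)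
  have h2 : ∀ x : ℝ, (2 : ℝ≥0∞) ^ x ≠ ∞ := fun x => by simp [ENNReal.rpow_eq_top_iff]
  have hA : A ≠ ∞ := ENNReal.mul_ne_top (geomConst_ne_top (by simp)) (h2 _)
  set D : ℝ≥0∞ := C * (2 : ℝ≥0∞) ^ ((L : ℝ) * s)
  have hD : D ≠ ∞ := ENNReal.mul_ne_top hC (h2 _)
  refine ⟨1 + A + D, by finiteness, fun f hf => ?_⟩
  by_cases hfp : eLpNorm f p volume = ∞
  · rw [besovNorm, hfp, top_add, ENNReal.mul_top (by simp)]
    exact le_top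
  have hfm : MemLp f p volume := ⟨hf, Ne.lt_top hfp⟩
  set O : ℕ → ℝ≥0∞ := fun l => eLpNorm (fun x => osc c r p f x l) p volume
  have h3 : ∀ l, approxError (fun x => spline d (x + τ)) p l f ≤
      (2 : ℝ≥0∞) ^ (-((l : ℝ) * (s + 1))) *
        ((2 : ℝ≥0∞) ^ ((L : ℝ) * |s + 1|) * eLpNorm f p volume) + C * shiftSeq L O l := by
    intro l
    by_cases hl : L ≤ l
    · refine (h f hfm l hl).trans (le_add_left ?_)
      rw [shiftSeq, if_pos hl]
    · refine (approxError_le_eLpNorm _ _ _ _).trans (le_add_right ?_)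
      rw [← mul_assoc, ← ENNReal.rpow_add _ _ (by simp) (by simp)]
      refine le_mul_of_one_le_left' ?_
      rw [← ENNReal.rpow_zero (x := 2)]
      refine ENNReal.rpow_le_rpow_of_exponent_le one_le_two ?_
      have h5 : (l : ℝ) ≤ L := by exact_mod_cast (not_le.1 hl).le
      have h6 : (l : ℝ) * (s + 1) ≤ L * |s + 1| := by
        refine (mul_le_mul_of_nonneg_left (le_abs_self _) (by positivity)).trans ?_
        gcongr
      linarith
  have h4 : weightedNorm s q (fun l => approxError (fun x => spline d (x + τ)) p l f) ≤
      A * eLpNorm f p volume + D * weightedNorm s q O := by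
    refine (weightedNorm_mono h3).trans ((weightedNorm_add_le hq _ _).trans ?_)
    refine add_le_add ((weightedNorm_geom_le hq _).trans (le_of_eq ?_))
      ((weightedNorm_const_mul_le hC _).trans ?_)
    · rw [mul_assoc]
    · rw [mul_assoc]
      gcongr
      exact weightedNorm_shiftSeq_le hq L O
  rw [approxNorm, besovNorm]
  refine (add_le_add le_rfl h4).trans ?_
  calc eLpNorm f p volume + (A * eLpNorm f p volume + D * weightedNorm s q O)
      = (1 + A) * eLpNorm f p volume + D * weightedNorm s q O := by ring
    _ ≤ (1 + A + D) * eLpNorm f p volume + (1 + A + D) * weightedNorm s q O := by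
        exact add_le_add (mul_le_mul_left le_self_add _)
          (mul_le_mul_left (le_add_left le_rfl) _)
    _ = _ := by ring

/-! ### The inverse estimate -/

lemma stepError_sum_le {r : ℕ} {p : ℝ≥0∞} (hp : 1 ≤ p) {ι : Type*} (s : Finset ι)
    {g : ι → (Fin n → ℝ) → ℂ} (hg : ∀ i ∈ s, AEStronglyMeasurable (g i) volume) (m : ℕ)
    (x : Fin n → ℝ) :
    stepError r p (fun x => ∑ i ∈ s, g i x) m x ≤ ∑ i ∈ s, stepError r p (g i) m x := by
  have h := localError_sum_le (r := r) hp s (fun _ => 1) hg (dyadicCorner m x) (2 / 2 ^ m)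
  simp only [one_mul, enorm_one] at h
  unfold stepError
  rw [← Finset.mul_sum]
  gcongr

lemma eLpNorm_stepError_dilated_twoScaleSum_le [NeZero n] {p : ℝ≥0∞} (hp : 1 ≤ p) {k r : ℕ}
    {d : Fin (n + 1) → ℕ} (hd : HasOrder d k) (hr : r + 1 ≤ k) (τ : Fin n → ℝ) :
    ∃ C : ℝ≥0∞, C ≠ ∞ ∧ ∀ (a b : (Fin n → ℤ) → ℂ) (j m : ℕ), j ≤ m →
      eLpNorm (stepError r p (fun x => twoScaleSum d τ a b ((2 : ℝ) ^ j • x)) m) p volume ≤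
        C * (2 : ℝ≥0∞) ^ (-(((m - j : ℕ) : ℝ) * smoothExp p k r)) *
          eLpNorm (fun x => twoScaleSum d τ a b ((2 : ℝ) ^ j • x)) p volume := by
  obtain ⟨C, hC, h⟩ := eLpNorm_stepError_twoScaleSum_le hp hd hr τ
  refine ⟨C, hC, fun a b j m hj => ?_⟩
  have hN : (0 : ℝ) < 2 ^ j := by positivity
  have h1 := eLpNorm_comp_affine_univ p (stepError r p (twoScaleSum d τ a b) (m - j)) hN 0
  have h2 := eLpNorm_comp_affine_univ p (twoScaleSum d τ a b) hN 0
  simp only [add_zero, ← stepError_comp_dilation r p (twoScaleSum d τ a b) hj] at h1 h2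
  have h3 := h a b (m - j)
  rw [h1, h2, mul_left_comm] at h3
  exact (ENNReal.mul_le_mul_iff_right (dilationFactor_ne_zero hN p) (dilationFactor_ne_top p)).1 h3

/-- The infimum need not be attained. The excess is relative to `‖f‖_p`; if that norm vanishes, the
zero function is optimal. -/
lemma exists_near_best {φ : (Fin n → ℝ) → ℝ} {p : ℝ≥0∞} (l : ℕ) {f : (Fin n → ℝ) → ℂ}
    (hf : eLpNorm f p volume ≠ ∞) {ε : ℝ≥0∞} (hε : ε ≠ 0) :
    ∃ S ∈ multiresSpace φ p l, eLpNorm (fun x => f x - S x) p volume ≤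
      approxError φ p l f + ε * eLpNorm f p volume := by
  rcases eq_or_ne (eLpNorm f p volume) 0 with h0 | h0
  · exact ⟨_, zero_mem_multiresSpace φ p l, by simp [h0]⟩
  · have h1 : approxError φ p l f < approxError φ p l f + ε * eLpNorm f p volume :=
      ENNReal.lt_add_right ((approxError_le_eLpNorm φ p l f).trans_lt (Ne.lt_top hf)).ne
        (mul_ne_zero hε h0)
    obtain ⟨S, hS, h2⟩ : ∃ S ∈ multiresSpace φ p l, eLpNorm (fun x => f x - S x) p volume < _ := by
      simpa only [approxError, iInf_lt_iff, exists_prop] using h1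
    exact ⟨S, hS, h2.le⟩

/-- **Inverse theorem**: the oscillation is controlled by the approximation by splines. -/
theorem besovNorm_le_approxNorm_spline [NeZero n] {k r : ℕ} {d : Fin (n + 1) → ℕ}
    (hd : HasOrder d k) (hr : r + 1 ≤ k) (τ : Fin n → ℝ) {p q : ℝ≥0∞} (hp : 1 ≤ p) (hq : 1 ≤ q)
    {c : Fin n → ℝ} (hc : (0 : Fin n → ℝ) ∈ interior (baseCube c)) {s : ℝ} (hs : 0 < s)
    (hsα : s < smoothExp p k r) :
    ∃ C : ℝ≥0∞, C ≠ ∞ ∧ ∀ f : (Fin n → ℝ) → ℂ, AEStronglyMeasurable f volume →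
      besovNorm c r s p q f ≤ C * approxNorm (fun x => spline d (x + τ)) s p q f := by
  have hd1 : HasOrder d 1 := hd.of_le (by omega)
  obtain ⟨C, hC, hB⟩ := eLpNorm_stepError_dilated_twoScaleSum_le hp hd hr τ
  set α := smoothExp p k r
  have hα : 0 < α := hs.trans hsα
  have h2 : ∀ x : ℝ, (2 : ℝ≥0∞) ^ x ≠ ∞ := fun x => by simp [ENNReal.rpow_eq_top_iff]
  set G : ℝ≥0∞ := geomConst (α - s)
  have hG : G ≠ ∞ := geomConst_ne_top (by linarith)
  set A : ℝ≥0∞ := ((latticeBox n 3).card + C) * G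
  have hA : A ≠ ∞ := by finiteness
  set E : ℝ≥0∞ := 1 + (2 : ℝ≥0∞) ^ (((1 : ℕ) : ℝ) * s)
  have hE : E ≠ ∞ := ENNReal.add_ne_top.2 ⟨by simp, h2 _⟩
  refine ⟨1 + A * (E * (1 + G) + G), by finiteness, fun f hf => ?_⟩
  by_cases hfp : eLpNorm f p volume = ∞
  · rw [approxNorm, hfp, top_add, ENNReal.mul_top (by simp)]
    exact le_top
  set Φ : ℝ≥0∞ := eLpNorm f p volume
  set σ : ℕ → ℝ≥0∞ := fun l => approxError (fun x => spline d (x + τ)) p l f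
  -- The excess `2^{-lα} ‖f‖_p` has finite weighted norm because `s < α`.
  have hS : ∀ l : ℕ, ∃ a : (Fin n → ℤ) → ℂ,
      eLpNorm (fun x => f x - splineSeries d a ((2 : ℝ) ^ l • x + τ)) p volume ≤
        σ l + (2 : ℝ≥0∞) ^ (-((l : ℝ) * α)) * Φ := by
    intro l
    obtain ⟨S, hS, h3⟩ := exists_near_best (φ := fun x => spline d (x + τ)) (p := p) l hfp
      (ε := (2 : ℝ≥0∞) ^ (-((l : ℝ) * α))) (by simp [ENNReal.rpow_eq_zero_iff])
    obtain ⟨a, -, rfl⟩ := mem_multiresSpace_spline.1 hS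
    exact ⟨a, h3⟩
  choose a ha using hS
  set S : ℕ → (Fin n → ℝ) → ℂ := fun l x => splineSeries d (a l) ((2 : ℝ) ^ l • x + τ) with hSdef
  have hSm : ∀ l, AEStronglyMeasurable (S l) volume := fun l =>
    ((measurable_splineSeries hd1 (a l)).comp (by fun_prop)).aestronglyMeasurable
  set e : ℕ → ℝ≥0∞ := fun l => eLpNorm (fun x => f x - S l x) p volume
  set Z : ℕ → (Fin n → ℝ) → ℂ := fun l => Nat.casesOn l (fun _ => 0) S
  have hZm : ∀ l, AEStronglyMeasurable (Z l) volume := by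
    rintro (_ | l)
    · exact aestronglyMeasurable_const
    · exact hSm l
  set D : ℕ → (Fin n → ℝ) → ℂ := fun l x => Z (l + 1) x - Z l x
  have hDm : ∀ l, AEStronglyMeasurable (D l) volume := fun l =>
    (hZm (l + 1)).sub (hZm l)
  -- The first two terms bound `S l - S (l - 1)` through `f`. The last one supplies `‖f‖_p` at `l =
  -- 0`, where `S 0` has no predecessor.
  set δ : ℕ → ℝ≥0∞ := fun l => e l + shiftSeq 1 e l + (2 : ℝ≥0∞) ^ (-((l : ℝ) * α)) * Φ
  have hDδ : ∀ l, eLpNorm (D l) p volume ≤ δ l := by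
    rintro (_ | l)
    · have h3 : D 0 = fun x => f x - (f x - S 0 x) := by
        ext x; simp [D, Z]
      rw [h3]
      refine (eLpNorm_sub_le hf (hf.sub (hSm 0)) hp).trans ?_
      simp only [δ, shiftSeq]
      simp only [Nat.cast_zero, zero_mul, neg_zero, ENNReal.rpow_zero, one_mul]
      rw [add_comm]
      gcongr
      exact le_self_add
    · have h3 : D (l + 1) = fun x => (f x - S l x) - (f x - S (l + 1) x) := by
        ext x; simp [D, Z]
      rw [h3]
      refine (eLpNorm_sub_le (hf.sub (hSm l)) (hf.sub (hSm (l + 1))) hp).trans ?_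
      simp only [δ, shiftSeq, if_pos (Nat.le_add_left 1 l), Nat.add_sub_cancel]
      rw [add_comm]
      exact le_self_add
  have hDB : ∀ l m, l ≤ m → eLpNorm (stepError r p (D l) m) p volume ≤
      C * ((2 : ℝ≥0∞) ^ (-(((m - l : ℕ) : ℝ) * α)) * δ l) := by
    rintro (_ | l) m hlm
    -- Only one level is present; writing the other coefficients as `0 * 0` lets
    -- `splineSeries_const_mul` remove that series.
    · have h3 : D 0 = fun x => twoScaleSum d τ (a 0) (fun _ => 0 * 0) ((2 : ℝ) ^ 0 • x) := by
        ext x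
        simp only [twoScaleSum, splineSeries_const_mul]
        simp [D, Z, S]
      have h4 := hB (a 0) (fun _ => 0 * 0) 0 m hlm
      rw [← h3, mul_assoc] at h4
      refine h4.trans ?_
      gcongr
      exact hDδ 0
    · have h3 : D (l + 1) = fun x =>
          twoScaleSum d τ (fun ν => -1 * a l ν) (a (l + 1)) ((2 : ℝ) ^ l • x) := by
        ext x
        simp only [twoScaleSum, splineSeries_const_mul, smul_smul, D, Z, S]
        rw [← pow_succ']
        ring
      have h4 := hB (fun ν => -1 * a l ν) (a (l + 1)) l m (by omega)
      rw [← h3, mul_assoc] at h4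
      refine h4.trans ?_
      -- As a two-scale sum of level `l`, `D (l + 1)` even decays like `2^{-(m-l)α}`; since `α > 0`
      -- this may be weakened.
      refine mul_le_mul_right (mul_le_mul' ?_ (hDδ (l + 1))) _
      refine ENNReal.rpow_le_rpow_of_exponent_le one_le_two ?_
      have h5 : ((m - (l + 1) : ℕ) : ℝ) ≤ (m - l : ℕ) := by
        exact_mod_cast Nat.sub_le_sub_left (Nat.le_succ l) m
      nlinarith
  have hmain : ∀ m, eLpNorm (fun x => osc c r p f x m) p volume ≤ ((latticeBox n 3).card + C) *
      ∑ j ∈ Finset.range (m + 1), (2 : ℝ≥0∞) ^ (-(((m - j : ℕ) : ℝ) * α)) * δ j := by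
    intro m
    set T := ∑ j ∈ Finset.range (m + 1), (2 : ℝ≥0∞) ^ (-(((m - j : ℕ) : ℝ) * α)) * δ j 
    have h3 : ∀ x, f x = (f x - S m x) + ∑ j ∈ Finset.range (m + 1), D j x := by
      intro x
      have h4 := Finset.sum_range_sub (fun l => Z l x) (m + 1)
      simp only [D]
      rw [h4]
      simp [Z]
    have h4 : ∀ x, osc c r p f x m ≤ stepError r p (fun x => f x - S m x) m x +
        ∑ j ∈ Finset.range (m + 1), stepError r p (D j) m x := by
      intro x
      refine (osc_le_stepError hc r p f x m).trans ?_
      conv_lhs => rw [funext h3]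
      refine (stepError_add_le hp (hf.sub (hSm m))
        (Finset.aestronglyMeasurable_fun_sum _ fun j _ => hDm j) m x).trans ?_
      exact add_le_add le_rfl
        (stepError_sum_le hp (Finset.range (m + 1)) (g := D) (fun j _ => hDm j) m x)
    have h5 : eLpNorm (stepError r p (fun x => f x - S m x) m) p volume ≤
        (latticeBox n 3).card * T := by
      have h6 := Finset.single_le_sum (f := fun j =>
        (2 : ℝ≥0∞) ^ (-(((m - j : ℕ) : ℝ) * α)) * δ j) (fun _ _ => zero_le)
        (Finset.self_mem_range_succ m)
      simp only [Nat.sub_self, Nat.cast_zero, zero_mul, neg_zero, ENNReal.rpow_zero, one_mul] at h6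
      have h7 : e m ≤ δ m := le_self_add.trans le_self_add
      exact (eLpNorm_stepError_le hp r _ m).trans (mul_le_mul_right (h7.trans h6) _)
    have hsm : ∀ g : (Fin n → ℝ) → ℂ, AEStronglyMeasurable (stepError r p g m) volume :=
      fun g => (measurable_stepError r p g m).aestronglyMeasurable
    calc _ ≤ eLpNorm (stepError r p (fun x => f x - S m x) m +
          ∑ j ∈ Finset.range (m + 1), stepError r p (D j) m) p volume := by
          refine eLpNorm_mono_enorm fun x => ?_
          simpa only [enorm_eq_self, Pi.add_apply, Finset.sum_apply] using h4 x
      _ ≤ (latticeBox n 3).card * T +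
          ∑ j ∈ Finset.range (m + 1), eLpNorm (stepError r p (D j) m) p volume := by
          refine (eLpNorm_add_le (hsm _)
            (Finset.aestronglyMeasurable_sum _ fun j _ => hsm _) hp).trans ?_
          exact add_le_add h5 (eLpNorm_sum_le (fun j _ => hsm _) hp)
      _ ≤ (latticeBox n 3).card * T + ∑ j ∈ Finset.range (m + 1),
          C * ((2 : ℝ≥0∞) ^ (-(((m - j : ℕ) : ℝ) * α)) * δ j) := by
          gcongr with j hj
          exact hDB j m (Finset.mem_range_succ_iff.1 hj)
      _ = _ := by rw [← Finset.mul_sum, add_mul]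
  have hWe : weightedNorm s q e ≤ weightedNorm s q σ + G * Φ :=
    (weightedNorm_mono ha).trans ((weightedNorm_add_le hq _ _).trans
      (add_le_add le_rfl (weightedNorm_geom_le hq Φ)))
  have hWδ : weightedNorm s q δ ≤ E * weightedNorm s q e + G * Φ := by
    refine (weightedNorm_add_le hq _ _).trans (add_le_add ?_ (weightedNorm_geom_le hq Φ))
    refine (weightedNorm_add_le hq _ _).trans ?_
    rw [add_mul, one_mul]
    gcongr
    exact weightedNorm_shiftSeq_le hq 1 e
  have hcard : ((latticeBox n 3).card + C : ℝ≥0∞) ≠ ∞ := by finiteness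
  have hW : weightedNorm s q (fun m => eLpNorm (fun x => osc c r p f x m) p volume) ≤
      A * (E * (weightedNorm s q σ + G * Φ) + G * Φ) := by
    refine (weightedNorm_mono hmain).trans ((weightedNorm_const_mul_le hcard _).trans ?_)
    rw [mul_assoc]
    gcongr
    refine (weightedNorm_hardy_le hq δ).trans ?_
    gcongr
    refine hWδ.trans ?_
    gcongr
  have hσ : weightedNorm s q σ ≤ approxNorm (fun x => spline d (x + τ)) s p q f := le_add_self
  have hΦ : Φ ≤ approxNorm (fun x => spline d (x + τ)) s p q f := le_self_add
  set W := approxNorm (fun x => spline d (x + τ)) s p q f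
  calc besovNorm c r s p q f ≤ W + A * (E * (W + G * W) + G * W) := by
        rw [besovNorm]
        refine add_le_add hΦ (hW.trans ?_)
        gcongr
    _ = _ := by ring

/-! ### Equivalence of the two norms for one spline -/

lemma smoothExp_eq_of_le {p : ℝ≥0∞} {k r : ℕ} (h : r + 1 ≤ k - 1) :
    smoothExp p k r = r + 1 := by
  rw [smoothExp, min_eq_left h]
  push_cast
  ring

lemma smoothExp_self {p : ℝ≥0∞} (m : ℕ) :
    smoothExp p (m + 1) m = m + (p⁻¹).toReal := by
  rw [smoothExp, Nat.add_sub_cancel, min_eq_right (Nat.le_succ m)]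
  push_cast
  ring

lemma hasOrder_const (n K : ℕ) : HasOrder (fun _ : Fin (n + 1) => K) K :=
  fun _ _ _ => Nat.le_add_right K K

/-- The characterization of Besov spaces by spline approximation. -/
theorem besovNorm_equiv_approxNorm_spline [NeZero n] {k r : ℕ} {d : Fin (n + 1) → ℕ}
    (hd : HasOrder d k) (hk : 1 ≤ k) (τ : Fin n → ℝ) {p q : ℝ≥0∞} (hp : 1 ≤ p) (hq : 1 ≤ q)
    {c : Fin n → ℝ} (hc : (0 : Fin n → ℝ) ∈ interior (baseCube c)) {s : ℝ} (hs : 0 < s)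
    (hsk : s < (k : ℝ) - 1 + (p⁻¹).toReal) (hsr : s < (r : ℝ) + 1) :
    ∃ A B : ℝ≥0∞, A ≠ ∞ ∧ B ≠ ∞ ∧ ∀ f : (Fin n → ℝ) → ℂ, AEStronglyMeasurable f volume →
      besovNorm c r s p q f ≤ A * approxNorm (fun x => spline d (x + τ)) s p q f ∧
      approxNorm (fun x => spline d (x + τ)) s p q f ≤ B * besovNorm c r s p q f := by
  obtain ⟨m, rfl⟩ := Nat.exists_eq_add_of_le' hk
  push_cast at hsk
  rw [add_sub_cancel_right] at hsk
  have hθ : (p⁻¹).toReal ≤ 1 := by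
    have h := ENNReal.toReal_mono (by simp) (ENNReal.inv_le_one.2 hp)
    simpa using h
  -- The inverse theorem requires degree at most `m = k - 1`. Using `min r m` is no loss, since the
  -- oscillation decreases when the degree grows.
  have hlow : s < smoothExp p (m + 1) (min r m) := by
    rcases lt_or_ge r m with h | h
    · rw [min_eq_left h.le, smoothExp_eq_of_le (by omega)]
      exact hsr
    · rw [min_eq_right h, smoothExp_self]
      exact hsk
  obtain ⟨A, hA, h1⟩ := besovNorm_le_approxNorm_spline hd
    (Nat.succ_le_succ (min_le_right r m)) τ hp hq hc hs hlow
  have h2 : ∃ B : ℝ≥0∞, B ≠ ∞ ∧ ∀ f : (Fin n → ℝ) → ℂ, AEStronglyMeasurable f volume →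
      approxNorm (fun x => spline d (x + τ)) s p q f ≤ B * besovNorm c r s p q f := by
    rcases le_total r m with h | h
    · exact approxNorm_spline_le_besovNorm (hd.of_le (by omega)) τ hp hq hc s
    -- The direct theorem only yields degree `m ≤ r`. The degree is raised through an auxiliary
    -- spline of order `r + 2`: its inverse theorem with degree `m` has exponent `m + 1 > s`, and
    -- its direct theorem is available with degree `r`.
    · obtain ⟨B₁, hB₁, h3⟩ := approxNorm_spline_le_besovNorm hd τ hp hq hc s
      have hexp : s < smoothExp p (r + 2) m := by
        rw [smoothExp_eq_of_le (by omega)]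
        linarith
      obtain ⟨B₂, hB₂, h4⟩ := besovNorm_le_approxNorm_spline (r := m) (hasOrder_const n (r + 2))
        (by omega) 0 hp hq hc hs hexp
      obtain ⟨B₃, hB₃, h5⟩ := approxNorm_spline_le_besovNorm (r := r)
        ((hasOrder_const n (r + 2)).of_le (by omega)) 0 hp hq hc s
      refine ⟨B₁ * (B₂ * B₃), by finiteness, fun f hf => (h3 f hf).trans ?_⟩
      rw [mul_assoc, mul_assoc]
      gcongr
      refine (h4 f hf).trans ?_
      gcongr
      exact h5 f hf
  obtain ⟨B, hB, h3⟩ := h2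
  exact ⟨A, B, hA, hB, fun f hf =>
    ⟨(besovNorm_anti_degree c (min_le_left r m) s p q f).trans (h1 f hf), h3 f hf⟩⟩

/-! ### Box splines as densities -/

/-- The law of the sum of the vectors `w j` with independent uniformly distributed coefficients. -/
def sumLaw {ι : Type*} [Fintype ι] (w : ι → Fin n → ℝ) : Measure (Fin n → ℝ) :=
  (Measure.pi fun _ : ι => volume.restrict (Icc (0 : ℝ) 1)).map fun t => ∑ j, t j • w j

lemma restrict_Icc_eq_pi (ι : Type*) [Fintype ι] :
    (volume : Measure (ι → ℝ)).restrict (Icc 0 1) =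
      Measure.pi fun _ : ι => volume.restrict (Icc (0 : ℝ) 1) := by
  rw [← Measure.restrict_pi_pi, ← volume_pi, Set.pi_univ_Icc]
  rfl

lemma boxMeasure_eq_sumLaw (d : Fin (n + 1) → ℕ) :
    boxMeasure d = sumLaw fun j : Σ i, Fin (d i) => boxDirection n j.1 := by
  rw [boxMeasure, restrict_Icc_eq_pi]
  rfl

lemma sumLaw_reindex {ι κ : Type*} [Fintype ι] [Fintype κ] (e : ι ≃ κ) (w : κ → Fin n → ℝ) :
    sumLaw (fun j => w (e j)) = sumLaw w := by
  have h := measurePreserving_piCongrLeft (α := fun _ : κ => ℝ)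
    (fun _ : κ => volume.restrict (Icc (0 : ℝ) 1)) e
  unfold sumLaw
  rw [← h.map_eq, Measure.map_map (by fun_prop) h.measurable]
  congr 1
  ext1 t
  rw [Function.comp_apply, ← e.sum_comp]
  refine Finset.sum_congr rfl fun j _ => ?_
  rw [MeasurableEquiv.coe_piCongrLeft, Equiv.piCongrLeft_apply_apply]

lemma sumLaw_option {ι : Type*} [Fintype ι] (w : Option ι → Fin n → ℝ) :
    sumLaw w = ((sumLaw fun j => w (some j)).prod (volume.restrict (Icc (0 : ℝ) 1))).map
      fun z => z.1 + z.2 • w none := by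
  have h := Measure.pi_map_piOptionEquivProd (β := fun _ : Option ι => ℝ)
    (fun _ => volume.restrict (Icc (0 : ℝ) 1))
  have hm : Measurable fun t : ι → ℝ => ∑ j, t j • w (some j) := by fun_prop
  have h2 := Measure.map_prod_map (Measure.pi fun _ : ι => volume.restrict (Icc (0 : ℝ) 1))
    (volume.restrict (Icc (0 : ℝ) 1)) hm measurable_id
  rw [Measure.map_id] at h2
  unfold sumLaw
  rw [h2, Measure.map_map (by fun_prop) (by fun_prop), ← h,
    Measure.map_map (by fun_prop) (MeasurableEquiv.measurable _)]
  congr 1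
  ext1 z
  rw [Function.comp_apply, Fintype.sum_option, add_comm]
  rfl

/-- One more independent uniform coefficient is added; the bijection `F` puts its index at the end
of the `i`-th block. -/
lemma boxMeasure_add_single (d : Fin (n + 1) → ℕ) (i : Fin (n + 1)) :
    boxMeasure (d + Pi.single i 1) =
      ((boxMeasure d).prod (volume.restrict (Icc (0 : ℝ) 1))).map
        fun z => z.1 + z.2 • boxDirection n i := by
  set e := d + Pi.single i 1 with he
  have hle : ∀ j, d j ≤ e j := fun j => Nat.le_add_right _ _
  have hlt : d i < e i := by simp [he]
  let F : Option (Σ j, Fin (d j)) → Σ j, Fin (e j)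
    | none => ⟨i, ⟨d i, hlt⟩⟩
    | some ⟨j, x⟩ => ⟨j, Fin.castLE (hle j) x⟩
  have hF : Function.Bijective F := by
    rw [Fintype.bijective_iff_injective_and_card]
    constructor
    · rintro (_ | ⟨j, x⟩) (_ | ⟨j', x'⟩) h
      · rfl
      · exfalso
        simp only [F, Sigma.mk.injEq] at h
        obtain ⟨rfl, h⟩ := h
        have h1 := congrArg Fin.val (eq_of_heq h)
        have h2 := x'.2
        simp only [Fin.val_castLE] at h1
        omega
      · exfalso
        simp only [F, Sigma.mk.injEq] at h
        obtain ⟨rfl, h⟩ := h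
        have h1 := congrArg Fin.val (eq_of_heq h)
        have h2 := x.2
        simp only [Fin.val_castLE] at h1
        omega
      · simp only [F, Sigma.mk.injEq] at h
        obtain ⟨rfl, h⟩ := h
        rw [Fin.castLE_injective (hle j) (eq_of_heq h)]
    · simp [he, Finset.sum_add_distrib]
  rw [boxMeasure_eq_sumLaw, boxMeasure_eq_sumLaw, ← sumLaw_reindex (Equiv.ofBijective F hF),
    sumLaw_option]
  rfl

lemma baseIndex_injective (i : Fin (n + 1)) : Function.Injective (baseIndex i) := by
  intro a b h
  have h2 := congrArg (coordEquiv ℝ i) (congrArg (boxDirection n) h)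
  simp only [← coordEquiv_symm_single_real, LinearEquiv.apply_symm_apply] at h2
  by_contra hab
  have h3 := congrFun h2 a
  simp [hab] at h3

lemma boxMeasure_baseMult (i : Fin (n + 1)) :
    boxMeasure (baseMult i) =
      (volume.restrict (Icc (0 : Fin n → ℝ) 1)).map (coordEquiv ℝ i).symm := by
  let F : Fin n → Σ j, Fin (baseMult i j) := fun j =>
    ⟨baseIndex i j, ⟨0, by simp [baseMult, baseIndex_ne]⟩⟩
  have hF : Function.Bijective F := by
    rw [Fintype.bijective_iff_injective_and_card]
    constructor
    · intro a b h
      exact baseIndex_injective i (congrArg Sigma.fst h)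
    · have h : ∑ j, baseMult i j = n := by
        simp [baseMult, Finset.sum_ite, Finset.filter_ne']
      rw [Fintype.card_sigma, Fintype.card_fin]
      simp_rw [Fintype.card_fin, h]
  rw [boxMeasure_eq_sumLaw, ← sumLaw_reindex (Equiv.ofBijective F hF), restrict_Icc_eq_pi, sumLaw]
  congr 1
  ext1 t
  have h : ∀ j, boxDirection n (Equiv.ofBijective F hF j).1 =
      (coordEquiv ℝ i).symm (Pi.single j 1) := fun j => (coordEquiv_symm_single_real i j).symm
  simp_rw [h, ← map_smul, ← map_sum]
  congr 1
  ext l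
  simp [Pi.single_apply]

/-- The matrix comes from an invertible integral one, so its determinant is a unit of `ℤ`. -/
lemma abs_det_coordEquiv (i : Fin (n + 1)) :
    |LinearMap.det (coordEquiv ℝ i : (Fin n → ℝ) →ₗ[ℝ] (Fin n → ℝ))| = 1 := by
  have h : LinearMap.toMatrix' (coordEquiv ℝ i : (Fin n → ℝ) →ₗ[ℝ] (Fin n → ℝ)) =
      (LinearMap.toMatrix' (coordEquiv ℤ i : (Fin n → ℤ) →ₗ[ℤ] (Fin n → ℤ))).map
        (Int.castRingHom ℝ) := by
    ext a b
    have h1 := congrFun (coordEquiv_latticePoint i (Pi.single b 1)) a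
    have h2 : latticePoint (Pi.single b 1 : Fin n → ℤ) = Pi.single b 1 := by
      ext l
      by_cases h : l = b
      · subst h; simp
      · simp [h]
    rw [h2] at h1
    simpa [LinearMap.toMatrix'_apply, Matrix.map_apply] using h1
  rw [← LinearMap.det_toMatrix', h, ← RingHom.mapMatrix_apply, ← RingHom.map_det,
    LinearMap.det_toMatrix']
  rcases Int.isUnit_iff.1 (LinearEquiv.isUnit_det' (coordEquiv ℤ i)) with h1 | h1 <;> simp [h1]

lemma measurePreserving_coordEquiv (i : Fin (n + 1)) :
    MeasurePreserving (coordEquiv ℝ i) (volume : Measure (Fin n → ℝ)) volume := by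
  refine ⟨(coordEquiv ℝ i).toLinearMap.continuous_of_finiteDimensional.measurable, ?_⟩
  have h := abs_det_coordEquiv i
  have h0 : LinearMap.det (coordEquiv ℝ i : (Fin n → ℝ) →ₗ[ℝ] (Fin n → ℝ)) ≠ 0 := by
    intro h0
    simp [h0] at h
  have h1 := Real.map_linearMap_volume_pi_eq_smul_volume_pi h0
  rw [abs_inv, h] at h1
  simpa using h1

lemma boxMeasure_baseMult_eq_withDensity [NeZero n] (i : Fin (n + 1)) :
    boxMeasure (baseMult i) =
      (volume : Measure (Fin n → ℝ)).withDensity fun x => ENNReal.ofReal (spline (baseMult i) x) := by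
  set U : Set (Fin n → ℝ) := Set.pi univ fun _ => Ico (0 : ℝ) 1
  have hU : MeasurableSet U := MeasurableSet.univ_pi fun _ => measurableSet_Ico
  have hmp := measurePreserving_coordEquiv i
  have h1 : (fun x => ENNReal.ofReal (spline (baseMult i) x)) =
      (coordEquiv ℝ i ⁻¹' U).indicator 1 := by
    ext x
    rw [spline_baseMult]
    by_cases hx : coordEquiv ℝ i x ∈ U
    · rw [indicator_of_mem (show x ∈ coordEquiv ℝ i ⁻¹' U from hx)]
      have h2 : ∀ j, indicator (Ico (0 : ℝ) 1) (1 : ℝ → ℝ) (coordEquiv ℝ i x j) = 1 :=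
        fun j => by rw [indicator_of_mem (hx j (mem_univ j))]; rfl
      simp [h2]
    · rw [indicator_of_notMem (show x ∉ coordEquiv ℝ i ⁻¹' U from hx)]
      have h3 : ∃ j, coordEquiv ℝ i x j ∉ Ico (0 : ℝ) 1 := by
        by_contra h4
        push Not at h4
        exact hx fun j _ => h4 j
      obtain ⟨j, hj⟩ := h3
      rw [Finset.prod_eq_zero (Finset.mem_univ j) (indicator_of_notMem hj _), ENNReal.ofReal_zero]
  have h2 : (Icc 0 1 : Set (Fin n → ℝ)) =ᵐ[volume] U := by
    rw [← Set.pi_univ_Icc, volume_pi]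
    exact (Measure.ae_eq_set_pi fun j _ => Ico_ae_eq_Icc).symm
  rw [h1, withDensity_indicator_one (hmp.measurable hU), boxMeasure_baseMult,
    Measure.restrict_congr_set h2, ← (hmp.restrict_preimage hU).map_eq]
  have hsymm : Measurable (coordEquiv ℝ i).symm :=
    (coordEquiv ℝ i).symm.toLinearMap.continuous_of_finiteDimensional.measurable
  rw [Measure.map_map hsymm hmp.measurable]
  have h3 : (coordEquiv ℝ i).symm ∘ coordEquiv ℝ i = id := by ext1 x; simp
  rw [h3, Measure.map_id]

/-- By Tonelli and translation invariance, convolving with the uniform law on a segment averages the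
density along it, which is `spline_add_single`. -/
lemma map_prod_withDensity_spline [NeZero n] {d : Fin (n + 1) → ℕ} (hd : HasOrder d 1)
    (i : Fin (n + 1)) :
    (((volume : Measure (Fin n → ℝ)).withDensity fun x => ENNReal.ofReal (spline d x)).prod
      (volume.restrict (Icc (0 : ℝ) 1))).map (fun z => z.1 + z.2 • boxDirection n i) =
    (volume : Measure (Fin n → ℝ)).withDensity
      fun x => ENNReal.ofReal (spline (d + Pi.single i 1) x) := by
  set v := boxDirection n i
  have hm : Measurable fun x => ENNReal.ofReal (spline d x) :=
    ENNReal.measurable_ofReal.comp (measurable_spline hd)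
  ext A hA
  have hadd : Measurable fun z : (Fin n → ℝ) × ℝ => z.1 + z.2 • v := by fun_prop
  rw [Measure.map_apply hadd hA, Measure.prod_apply_symm (hadd hA), withDensity_apply _ hA]
  have h1 : ∀ t : ℝ, (volume.withDensity fun x => ENNReal.ofReal (spline d x))
      ((fun x => (x, t)) ⁻¹' ((fun z : (Fin n → ℝ) × ℝ => z.1 + z.2 • v) ⁻¹' A)) =
      ∫⁻ y in A, ENNReal.ofReal (spline d (y - t • v)) := by
    intro t
    have hmp := measurePreserving_add_right (volume : Measure (Fin n → ℝ)) (t • v)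
    have h2 := hmp.setLIntegral_comp_preimage hA
      (f := fun y => ENNReal.ofReal (spline d (y - t • v))) (hm.comp (by fun_prop))
    simp only [add_sub_cancel_right] at h2
    rw [← h2, ← withDensity_apply _ (hmp.measurable hA)]
    rfl
  simp_rw [h1]
  have hunc : Measurable (Function.uncurry fun (t : ℝ) (y : Fin n → ℝ) =>
      ENNReal.ofReal (spline d (y - t • v))) :=
    hm.comp (f := fun z : ℝ × (Fin n → ℝ) => z.2 - z.1 • v) (by fun_prop)
  rw [lintegral_lintegral_swap hunc.aemeasurable]
  refine lintegral_congr fun y => ?_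
  have hy : Measurable fun t : ℝ => spline d (y - t • v) :=
    (measurable_spline hd).comp (by fun_prop)
  rw [spline_add_single hd, intervalIntegral.integral_of_le zero_le_one,
    ← integral_Icc_eq_integral_Ioc, ofReal_integral_eq_lintegral_ofReal]
  · exact (intervalIntegrable_iff_integrableOn_Icc_of_le zero_le_one).1
      (intervalIntegrable_of_mem_Icc hy (fun t => spline_mem_Icc hd _) 0 1)
  · exact Filter.Eventually.of_forall fun t => (spline_mem_Icc hd _).1

lemma boxMeasure_eq_withDensity [NeZero n] {d : Fin (n + 1) → ℕ} (hd : HasOrder d 1) :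
    boxMeasure d = (volume : Measure (Fin n → ℝ)).withDensity
      fun x => ENNReal.ofReal (spline d x) := by
  induction d, hd using HasOrder.induction with
  | base i => exact boxMeasure_baseMult_eq_withDensity i
  | step d i hd ih =>
    rw [boxMeasure_add_single, ih]
    exact map_prod_withDensity_spline hd i

lemma boxSpline_ae_eq [NeZero n] {d : Fin (n + 1) → ℕ} (hd : HasOrder d 1) :
    boxSpline d =ᵐ[volume] spline d := by
  have hm : Measurable fun x => ENNReal.ofReal (spline d x) :=
    ENNReal.measurable_ofReal.comp (measurable_spline hd)
  have h := Measure.rnDeriv_withDensity (volume : Measure (Fin n → ℝ)) hm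
  rw [← boxMeasure_eq_withDensity hd] at h
  filter_upwards [h] with x hx
  rw [boxSpline, hx, ENNReal.toReal_ofReal (spline_mem_Icc hd x).1]

/-! ### Tensor product B-splines -/

/-- The only discrepancy is the endpoint `t = 1 / 2` for `k = 1`; one integration removes it. -/
lemma centralBSpline_ae_eq {k : ℕ} (hk : 1 ≤ k) :
    ∀ᵐ t : ℝ, centralBSpline k t = cardinalBSpline k (t + k / 2) := by
  induction k, hk using Nat.le_induction with
  | base =>
    have h : ∀ᵐ t : ℝ, t ≠ 1 / 2 := by simp [ae_iff]
    filter_upwards [h] with t ht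
    have h1 : t ∈ Icc (-(1 / 2) : ℝ) (1 / 2) ↔ t + (1 : ℕ) / 2 ∈ Ico (0 : ℝ) 1 := by
      rw [mem_Icc, mem_Ico]
      constructor
      · rintro ⟨h1, h2⟩
        have := lt_of_le_of_ne h2 ht
        constructor <;> push_cast <;> linarith
      · rintro ⟨h1, h2⟩
        push_cast at h1 h2
        constructor <;> linarith
    change indicator (Icc (-(1 / 2) : ℝ) (1 / 2)) 1 t = indicator (Ico (0 : ℝ) 1) 1 _
    by_cases h2 : t ∈ Icc (-(1 / 2) : ℝ) (1 / 2)
    · rw [indicator_of_mem h2, indicator_of_mem (h1.1 h2)]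
      rfl
    · rw [indicator_of_notMem h2, indicator_of_notMem (mt h1.2 h2)]
  | succ k hk ih =>
    refine Filter.Eventually.of_forall fun t => ?_
    have h1 : centralBSpline (k + 1) t =
        ∫ u in (-(1 / 2 : ℝ))..(1 / 2), centralBSpline k (t - u) := by
      obtain ⟨j, rfl⟩ := Nat.exists_eq_add_of_le' hk
      rfl
    have h2 : ∀ᵐ u : ℝ, centralBSpline k (t - u) = cardinalBSpline k (t - u + k / 2) :=
      (quasiMeasurePreserving_sub_left volume t).ae ih
    rw [h1, intervalIntegral.integral_congr_ae (h2.mono fun u hu _ => hu), cardinalBSpline_succ hk]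
    have h3 := intervalIntegral.integral_comp_sub_right (a := 0) (b := 1)
      (fun u : ℝ => cardinalBSpline k (t - u + k / 2)) (1 / 2)
    rw [show (0 : ℝ) - 1 / 2 = -(1 / 2) by norm_num, show (1 : ℝ) - 1 / 2 = 1 / 2 by norm_num] at h3
    rw [← h3]
    refine intervalIntegral.integral_congr fun u _ => ?_
    congr 1
    push_cast
    ring

/-- The multiplicities of the tensor product B-spline of order `k`. -/
def tensorMult (n k : ℕ) : Fin (n + 1) → ℕ := Fin.snoc (α := fun _ => ℕ) (fun _ => k) 0

lemma hasOrder_tensorMult (n k : ℕ) : HasOrder (tensorMult n k) k := by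
  intro i j hij
  induction i using Fin.lastCases with
  | last =>
    induction j using Fin.lastCases with
    | last => exact absurd rfl hij
    | cast j => simp [tensorMult]
  | cast i => simp [tensorMult]

lemma tensorBSpline_ae_eq {k : ℕ} (hk : 1 ≤ k) :
    tensorBSpline n k =ᵐ[volume] fun x => spline (tensorMult n k) (x + fun _ => (k : ℝ) / 2) := by
  have h : ∀ᵐ x : Fin n → ℝ, ∀ i, centralBSpline k (x i) = cardinalBSpline k (x i + k / 2) := by
    rw [ae_all_iff]
    intro i
    exact (Measure.quasiMeasurePreserving_eval (fun _ : Fin n => (volume : Measure ℝ)) i).ae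
      (centralBSpline_ae_eq hk)
  filter_upwards [h] with x hx
  rw [spline_of_last (by simp [tensorMult]), tensorBSpline]
  refine Finset.prod_congr rfl fun i _ => ?_
  rw [hx i]
  simp [tensorMult]

/-! ### Independence of the choice of representatives -/

/-- Only countably many shifts enter, so outside one null set all terms of the series agree. -/
lemma approxError_congr_ae {φ ψ : (Fin n → ℝ) → ℝ} (h : φ =ᵐ[volume] ψ) (p : ℝ≥0∞) (l : ℕ)
    (f : (Fin n → ℝ) → ℂ) : approxError φ p l f = approxError ψ p l f := by
  have hN : (2 : ℝ) ^ l ≠ 0 := by positivity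
  have h1 : ∀ᵐ x : Fin n → ℝ, ∀ ν : Fin n → ℤ, φ (fun i => (2 : ℝ) ^ l * x i - (ν i : ℝ)) =
      ψ (fun i => (2 : ℝ) ^ l * x i - (ν i : ℝ)) := by
    rw [ae_all_iff]
    intro ν
    have h2 : Measure.QuasiMeasurePreserving (fun y : Fin n → ℝ => (2 : ℝ) ^ l • y)
        volume volume := by
      refine ⟨measurable_const_smul _, ?_⟩
      rw [Measure.map_addHaar_smul _ hN]
      exact Measure.smul_absolutelyContinuous
    exact ((measurePreserving_sub_right volume (latticePoint ν)).quasiMeasurePreserving.comp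
      h2).ae h
  have h2 : ∀ {φ ψ : (Fin n → ℝ) → ℝ}, (∀ᵐ x : Fin n → ℝ, ∀ ν : Fin n → ℤ,
      φ (fun i => (2 : ℝ) ^ l * x i - (ν i : ℝ)) = ψ (fun i => (2 : ℝ) ^ l * x i - (ν i : ℝ))) →
      approxError φ p l f ≤ approxError ψ p l f := by
    intro φ ψ h1
    refine le_iInf₂ fun S hS => ?_
    obtain ⟨a, ha, rfl⟩ := hS
    refine (iInf₂_le _ ⟨a, ha, rfl⟩).trans (le_of_eq (eLpNorm_congr_ae ?_))
    filter_upwards [h1] with x hx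
    simp only [hx]
  exact le_antisymm (h2 h1) (h2 (h1.mono fun x hx ν => (hx ν).symm))

lemma approxNorm_congr_ae {φ ψ : (Fin n → ℝ) → ℝ} (h : φ =ᵐ[volume] ψ) (s : ℝ) (p q : ℝ≥0∞)
    (f : (Fin n → ℝ) → ℂ) : approxNorm φ s p q f = approxNorm ψ s p q f := by
  simp only [approxNorm, approxError_congr_ae h]

lemma hasOrder_boxOrder (d : Fin (n + 1) → ℕ) : HasOrder d (boxOrder d) :=
  fun i j hij => Nat.sInf_le ⟨i, j, hij, rfl⟩

end DyadicBesov

end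

/-! ### The theorem for tensor product and box splines -/

open DyadicBesov in
theorem corollary2 (n : ℕ) (hn : 1 ≤ n) (p q : ℝ≥0∞) (hp : 1 ≤ p) (hq : 1 ≤ q)
    (c : Fin n → ℝ) (hc : (0 : Fin n → ℝ) ∈ interior (baseCube c))
    (φ : (Fin n → ℝ) → ℝ) (k : ℕ)
    (hφ : φ = tensorBSpline n k ∨
      ∃ d : Fin (n + 1) → ℕ, φ = boxSpline d ∧ k = boxOrder d)
    (s : ℝ) (hs : 0 < s) (hsk : s < (k : ℝ) - 1 + (p⁻¹).toReal)
    (r : ℕ) (hr : s < (r : ℝ) + 1) :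
    besovSpace c r s p q = approxSpace φ s p q ∧
    ∃ C₁ C₂ : ℝ≥0, 0 < C₁ ∧ 0 < C₂ ∧
      ∀ f : (Fin n → ℝ) → ℂ, AEStronglyMeasurable f volume →
        C₁ * besovNorm c r s p q f ≤ approxNorm φ s p q f ∧
        approxNorm φ s p q f ≤ C₂ * besovNorm c r s p q f := by
  have : NeZero n := ⟨by omega⟩
  have hθ : (p⁻¹).toReal ≤ 1 := by
    have h := ENNReal.toReal_mono (by simp) (ENNReal.inv_le_one.2 hp)
    simpa using h
  have hk : 1 ≤ k := by
    have h : (0 : ℝ) < k := by linarith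
    exact_mod_cast h
  obtain ⟨d, τ, hd, hφd⟩ : ∃ (d : Fin (n + 1) → ℕ) (τ : Fin n → ℝ), HasOrder d k ∧
      φ =ᵐ[volume] fun x => spline d (x + τ) := by
    rcases hφ with rfl | ⟨d, rfl, rfl⟩
    · exact ⟨_, _, hasOrder_tensorMult n k, tensorBSpline_ae_eq hk⟩
    · refine ⟨d, 0, hasOrder_boxOrder d, ?_⟩
      simpa using boxSpline_ae_eq ((hasOrder_boxOrder d).of_le hk)
  obtain ⟨A, B, hA, hB, h⟩ := besovNorm_equiv_approxNorm_spline hd hk τ hp hq hc hs hsk hr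
  simp_rw [← approxNorm_congr_ae hφd] at h
  -- The added `1` makes both constants positive and the first one invertible.
  refine ⟨?_, (A.toNNReal + 1)⁻¹, B.toNNReal + 1, by positivity, by positivity, fun f hf => ?_⟩
  · ext f
    refine and_congr_right fun hf => ⟨fun h1 => ?_, fun h1 => ?_⟩
    · exact (h f hf).2.trans_lt (ENNReal.mul_lt_top hB.lt_top h1)
    · exact (h f hf).1.trans_lt (ENNReal.mul_lt_top hA.lt_top h1)
  · constructor
    · rw [ENNReal.coe_inv (by positivity), ← ENNReal.div_eq_inv_mul]
      refine ENNReal.div_le_of_le_mul' ((h f hf).1.trans ?_)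
      gcongr
      rw [ENNReal.coe_add, ENNReal.coe_toNNReal hA]
      exact le_self_add
    · refine (h f hf).2.trans ?_
      gcongr
      rw [ENNReal.coe_add, ENNReal.coe_toNNReal hB]
      exact le_self_add
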